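/- **Setting.** Let $\mathbb F$ be a finite field, let $\alpha,\beta,\gamma,K,L_A,L_B$ be positive integers and let $\mathcal S\subseteq[L_A]\times[L_B]$ be non-empty. For all matrices $\mathbf A_1,\dots,\mathbf A_{L_A}\in\mathbb F^{\alpha\times\beta}$ and $\mathbf B_1,\dots,\mathbf B_{L_B}\in\mathbb F^{\beta\times\gamma}$, the products $\mathbf A_i\mathbf B_j$, $(i,j)\in\mathcal S$, are to be computed with $K$ workers. A code consists of encoding functions $f_k,g_k$ for $k\in[K]$ and decoding functions $d_{\mathcal R}$ for $\mathcal R\subseteq[K]$. Worker $k$ receives $\widetilde{\mathbf A}_k=f_k(\mathbf A_1,\dots,\mathbf A_{L_A})\in\mathbb F^{\widetilde\alpha_k\times\widetilde\beta_k}$ and $\widetilde{\mathbf B}_k=g_k(\mathbf B_1,\dots,\mathbf B_{L_B})\in\mathbb F^{\widetilde\beta_k\times\widetilde\gamma_k}$ and returns $\widetilde{\mathbf A}_k\widetilde{\mathbf B}_k$. The *recovery threshold* is the least integer $T$ such that, for every $\mathcal R$ with $|\mathcal R|\ge T$ and all inputs, $d_{\mathcal R}$ maps the responses of the workers in $\mathcal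 R$ to $(\mathbf A_i\mathbf B_j)_{(i,j)\in\mathcal S}$. The *upload costs* are $U_A=\frac1K\sum_k\widetilde\alpha_k\widetilde\beta_k$ and $U_B=\frac1K\sum_k\widetilde\beta_k\widetilde\gamma_k$. The *download cost* $D_C$ is the maximum of $\frac1T\sum_{k\in\mathcal R}\widetilde\alpha_k\widetilde\gamma_k$ over $|\mathcal R|=T$, where $T$ is the recovery threshold. Complexities count the additions, subtractions and multiplications in $\mathbb F$ of straight-line programs that may use constants of $\mathbb F$: $C_A$ and $C_B$ for generating all outputs of each source, $C_w$ for the products formed by the workers (averaged over the workers), and $C_d$ for evaluating $d_{\mathcal R}$ with $|\mathcal R|=T$. A *task assignment* $\mathcal Q=\{(\mathcal L_A^q,\mathcal L_B^q)\}_{q=1}^{|\mathcal Q|}$ consists of sets $\mathcal L_A^q\subseteq[L_A]$, $\mathcal L_B^q\subseteq[L_B]$ of sizes $L_A^q,L_B^q$ such that the products $\mathcal L_A^q\times\mathcal L_B^q$ are pairwise disjoint and every $s\in\mathcal S$ lies in exactly one of them. A *power assignment* for $\mathcal Q$ consists of vectors $P^{A,q}\in\mathbb Z_{\ge0}^{L_A}$,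 $P^{B,q}\in\mathbb Z_{\ge0}^{L_B}$ such that, for each $q$: $P_i^{A,q}=0$ for $i\notin\mathcal L_A^q$ and $P_j^{B,q}=0$ for $j\notin\mathcal L_B^q$; the non-zero entries of $P^{A,q}$ are distinct, and so are those of $P^{B,q}$; and at least one of the following holds: (i) every $P^{A,q}_i$ with $i\in\mathcal L_A^q$ is of the form $L_A^qL_B^q-x+1$ with $x\in[L_A^q]$, and every $P^{B,q}_j$ with $j\in\mathcal L_B^q$ is of the form $yL_A^q$ with $y\in[L_B^q]$; (ii) every $P^{B,q}_j$ with $j\in\mathcal L_B^q$ is of the form $L_A^qL_B^q-x+1$ with $x\in[L_B^q]$, and every $P^{A,q}_i$ with $i\in\mathcal L_A^q$ is of the form $yL_B^q$ with $y\in[L_A^q]$. The *bilinear complexity* $R_{m,p,n}$ is the least $R$ for which there are tensors $a\in\mathbb F^{R\times m\times p}$, $b\in\mathbb F^{R\times p\times n}$, $c\in\mathbb F^{R\times m\times n}$ with $\sum_{i=1}^R c_{i,j,k}\bigl(\sum_{q,r}a_{i,q,r}A_{q,r}\bigr)\bigl(\sum_{r,s}b_{i,r,s}B_{r,s}\bigr)=(AB)_{j,k}$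 for all $j,k$ and all $A\in\mathbb F^{m\times p}$, $B\in\mathbb F^{p\times n}$. **The codes.** Let $\mathcal Q$ and $\mathcal P$ be a task assignment for $\mathcal S$ and a power assignment for $\mathcal Q$, let $m\mid\alpha$, $p\mid\beta$, $n\mid\gamma$ be positive integers, $R=R_{m,p,n}$, $\rho\mid R$, $\phi=R/\rho$. Take tensors $a,b,c$ as above and distinct elements $f_{r,q}$ ($r\in[R]$, $q\in[|\mathcal Q|]$), $x_1,\dots,x_K$ of $\mathbb F$. Split each $\mathbf A_i$ into an $m\times p$ grid of equal blocks $\mathbf A_i^{k,l}$ and each $\mathbf B_j$ into a $p\times n$ grid of equal blocks $\mathbf B_j^{k,l}$, and put $\mathbf A_i^r=\sum_{k,l}a_{r,k,l}\mathbf A_i^{k,l}$, $\mathbf B_j^r=\sum_{k,l}b_{r,k,l}\mathbf B_j^{k,l}$. For $h\in[\phi]$ let $I_h=\{(h-1)\rho+1,\dots,h\rho\}$ and $$\mathbf A^h(x)=\prod_{q}\prod_{r\in I_h}(x-f_{r,q})^{L_A^qL_B^q}\sum_{i=1}^{L_A}\sum_{r\in I_h}\frac{\mathbf A_i^r}{\prod_q(x-f_{r,q})^{P_i^{A,q}}},\qquad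 \mathbf B^h(x)=\sum_{j=1}^{L_B}\sum_{r\in I_h}\frac{\mathbf B_j^r}{\prod_q(x-f_{r,q})^{P_j^{B,q}}}.$$ An FCSA+FCC code sends to worker $k$ the matrices $\widetilde{\mathbf A}_k=[\mathbf A^1(x_k)\ \cdots\ \mathbf A^\phi(x_k)]$ and $\widetilde{\mathbf B}_k$, which consists of $\mathbf B^1(x_k),\dots,\mathbf B^\phi(x_k)$ stacked vertically. **Theorem 2 (Achievability of FCSA+FCC codes).** Assume $|\mathbb F|>R|\mathcal Q|+K$. Then such tensors and elements exist. The integer $$T=(R+\rho)\sum_{q}L_A^qL_B^q-\min_{i\in[L_A]}\sum_qP_i^{A,q}-\min_{j\in[L_B]}\sum_qP_j^{B,q}+1$$ is non-negative, and for every choice of the tensors and elements there are decoding functions such that the FCSA+FCC code achieves the following, with absolute constants in all $\mathcal O$: * any $T$ or more responses suffice to recover the desired products; if $T\le K$, the recovery threshold is $T$ and the download cost is $D_C=\frac{\alpha\gamma}{mn}$; * the upload costs are $(U_A,U_B)=\left(\frac R\rho\cdot\frac{\alpha\beta}{mp},\ \frac R\rho\cdot\frac{\beta\gamma}{pn}\right)$;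 * the encoding complexities are $C_A=\mathcal O\left(\alpha\beta L_AR\left(\frac K{mp}+1\right)\right)$ and $C_B=\mathcal O\left(\beta\gamma L_BR\left(\frac K{np}+1\right)\right)$; * the worker complexity is $C_w=\mathcal O\left(\frac R\rho\cdot\frac{\alpha\beta\gamma}{mpn}\right)$; * the decoding complexity is $C_d=\mathcal O(\alpha\gamma R|\mathcal S|)+\mathcal O\left(\frac{\alpha\gamma}{mn}\left(T\log_2^2T\cdot\log_2\log_2T+R\sum_q(L_A^qL_B^q)^2\right)\right)$, where the first summand in the inner bracket is read as $0$ for $T=1$. -/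

import Mathlib

open scoped BigOperators

/-! ### The batch multiplication problem and its codes -/

/-- A code for the following problem: from matrices `A₁, …, A_LA` of size `α × β` and
`B₁, …, B_LB` of size `β × γ` over `F`, compute `Aᵢ Bⱼ` for every `(i, j) ∈ S`, using `K` workers.
Worker `k` receives one matrix from each source (of size `rows k × inner k` and
`inner k × cols k`) and answers with their product; `dec W` is the decoding function used when
the set of responding workers is `W`. -/
structure VCDBMMCode (F : Type*) [Field F] {LA LB : ℕ} (S : Finset (Fin LA × Fin LB))
    (α β γ K : ℕ) where
  rows : Fin K → ℕ
  inner : Fin K → ℕ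
  cols : Fin K → ℕ
  encA : (k : Fin K) → (Fin LA → Matrix (Fin α) (Fin β) F) →
    Matrix (Fin (rows k)) (Fin (inner k)) F
  encB : (k : Fin K) → (Fin LB → Matrix (Fin β) (Fin γ) F) →
    Matrix (Fin (inner k)) (Fin (cols k)) F
  dec : (W : Finset (Fin K)) → ((k : W) → Matrix (Fin (rows k)) (Fin (cols k)) F) →
    S → Matrix (Fin α) (Fin γ) F

namespace VCDBMMCode

variable {F : Type*} [Field F] {LA LB : ℕ} {S : Finset (Fin LA × Fin LB)} {α β γ K : ℕ}

/-- Every set of at least `R` responding workers lets the fusion node recover all the desired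
products, whatever the input matrices are. -/
def RecoversFrom (code : VCDBMMCode F S α β γ K) (R : ℕ) : Prop :=
  ∀ W : Finset (Fin K), R ≤ W.card →
    ∀ (A : Fin LA → Matrix (Fin α) (Fin β) F) (B : Fin LB → Matrix (Fin β) (Fin γ) F),
      code.dec W (fun k => code.encA k A * code.encB k B) = fun s => A s.1.1 * B s.1.2

/-- The recovery threshold: the least `R` such that any `R` or more responses suffice. -/
noncomputable def recoveryThreshold (code : VCDBMMCode F S α β γ K) : ℕ :=
  sInf {R | code.RecoversFrom R}

/-- Average number of field symbols sent by the first source to a worker. -/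
noncomputable def uploadCostA (code : VCDBMMCode F S α β γ K) : ℝ :=
  (1 / (K : ℝ)) * ∑ k, (code.rows k : ℝ) * (code.inner k : ℝ)

/-- Average number of field symbols sent by the second source to a worker. -/
noncomputable def uploadCostB (code : VCDBMMCode F S α β γ K) : ℝ :=
  (1 / (K : ℝ)) * ∑ k, (code.inner k : ℝ) * (code.cols k : ℝ)

/-- Worst-case average number of field symbols per response, over the sets of responding workers
whose size is the recovery threshold. -/
noncomputable def downloadCost (code : VCDBMMCode F S α β γ K) : ℝ :=
  ⨆ W : {W : Finset (Fin K) // W.card = code.recoveryThreshold},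
    (∑ k ∈ W.1, (code.rows k : ℝ) * (code.cols k : ℝ)) / (code.recoveryThreshold : ℝ)

end VCDBMMCode

/-! ### Arithmetic complexity

Complexity is the number of arithmetic operations in `F` of a straight-line program. Programs over
a data type `D` are described by the functions `D → F` which they have available. -/

/-- `StraightLine base t A`: starting from the functions in `base`, a straight-line program with
exactly `t` additions, subtractions and multiplications in `F` makes exactly the functions in `A`
available. -/
inductive StraightLine {D F : Type*} [Field F] (base : Set (D → F)) : ℕ → Set (D → F) → Prop
  | start : StraightLine base 0 base
  | add {t : ℕ} {A : Set (D → F)} {g h : D → F} : StraightLine base t A → g ∈ A → h ∈ A →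
      StraightLine base (t + 1) (insert (g + h) A)
  | sub {t : ℕ} {A : Set (D → F)} {g h : D → F} : StraightLine base t A → g ∈ A → h ∈ A →
      StraightLine base (t + 1) (insert (g - h) A)
  | mul {t : ℕ} {A : Set (D → F)} {g h : D → F} : StraightLine base t A → g ∈ A → h ∈ A →
      StraightLine base (t + 1) (insert (g * h) A)

/-- The family `output` of functions of the data can be computed from the family `input` of
coordinates of the data, and constants of `F`, with `t` arithmetic operations. -/
def ArithComputable {D F ι κ : Type*} [Field F] (input : ι → D → F) (output : κ → D → F)
    (t : ℕ) : Prop :=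
  ∃ A : Set (D → F),
    StraightLine (Set.range input ∪ Set.range (Function.const D : F → D → F)) t A ∧
      ∀ j, output j ∈ A

namespace VCDBMMCode

variable {F : Type*} [Field F] {LA LB : ℕ} {S : Finset (Fin LA × Fin LB)} {α β γ K : ℕ}

/-- The first source can generate all its `K` outputs with `t` operations. -/
def EncodesAIn (code : VCDBMMCode F S α β γ K) (t : ℕ) : Prop :=
  ArithComputable (D := Fin LA → Matrix (Fin α) (Fin β) F)
    (fun (e : Fin LA × Fin α × Fin β) A => A e.1 e.2.1 e.2.2)
    (fun (e : Σ k : Fin K, Fin (code.rows k) × Fin (code.inner k)) A =>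
      code.encA e.1 A e.2.1 e.2.2) t

/-- The second source can generate all its `K` outputs with `t` operations. -/
def EncodesBIn (code : VCDBMMCode F S α β γ K) (t : ℕ) : Prop :=
  ArithComputable (D := Fin LB → Matrix (Fin β) (Fin γ) F)
    (fun (e : Fin LB × Fin β × Fin γ) B => B e.1 e.2.1 e.2.2)
    (fun (e : Σ k : Fin K, Fin (code.inner k) × Fin (code.cols k)) B =>
      code.encB e.1 B e.2.1 e.2.2) t

/-- Worker `k` can multiply the two matrices it receives with `t` operations. -/
def WorksIn (code : VCDBMMCode F S α β γ K) (k : Fin K) (t : ℕ) : Prop :=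
  ArithComputable (D := Matrix (Fin (code.rows k)) (Fin (code.inner k)) F ×
      Matrix (Fin (code.inner k)) (Fin (code.cols k)) F)
    (Sum.elim
      (fun (e : Fin (code.rows k) × Fin (code.inner k)) M => M.1 e.1 e.2)
      (fun (e : Fin (code.inner k) × Fin (code.cols k)) M => M.2 e.1 e.2))
    (fun (e : Fin (code.rows k) × Fin (code.cols k)) M => (M.1 * M.2) e.1 e.2) t

/-- The decoding function for the set `W` of responding workers can be evaluated with `t`
operations. -/
def DecodesIn (code : VCDBMMCode F S α β γ K) (W : Finset (Fin K)) (t : ℕ) : Prop :=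
  ArithComputable (D := (k : W) → Matrix (Fin (code.rows k)) (Fin (code.cols k)) F)
    (fun (e : Σ k : W, Fin (code.rows k) × Fin (code.cols k)) C => C e.1 e.2.1 e.2.2)
    (fun (e : S × Fin α × Fin γ) C => code.dec W C e.1 e.2.1 e.2.2) t

end VCDBMMCode

/-! ### Task and power assignments -/

/-- A task assignment with `N` task groups for the computation list `S`. -/
structure TaskAssignment {LA LB : ℕ} (S : Finset (Fin LA × Fin LB)) (N : ℕ) where
  left : Fin N → Finset (Fin LA)
  right : Fin N → Finset (Fin LB)
  disjoint : ∀ q q', q ≠ q' → Disjoint (left q ×ˢ right q) (left q' ×ˢ right q')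
  covers : ∀ s ∈ S, ∃! q, s ∈ left q ×ˢ right q

/-- The number of products in task group `q`. -/
def TaskAssignment.size {LA LB : ℕ} {S : Finset (Fin LA × Fin LB)} {N : ℕ}
    (Q : TaskAssignment S N) (q : Fin N) : ℕ :=
  (Q.left q).card * (Q.right q).card

/-- A power assignment for the task assignment `Q`. The equation `v = L - x + 1` is written
`v + x = L + 1`. -/
structure PowerAssignment {LA LB : ℕ} {S : Finset (Fin LA × Fin LB)} {N : ℕ}
    (Q : TaskAssignment S N) where
  powA : Fin N → Fin LA → ℕ
  powB : Fin N → Fin LB → ℕ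
  powA_eq_zero : ∀ q, ∀ i ∉ Q.left q, powA q i = 0
  powB_eq_zero : ∀ q, ∀ j ∉ Q.right q, powB q j = 0
  values : ∀ q,
    ((∀ i ∈ Q.left q, ∃ x ∈ Finset.Icc 1 (Q.left q).card, powA q i + x = Q.size q + 1) ∧
      (∀ j ∈ Q.right q, ∃ y ∈ Finset.Icc 1 (Q.right q).card, powB q j = y * (Q.left q).card)) ∨
    ((∀ j ∈ Q.right q, ∃ x ∈ Finset.Icc 1 (Q.right q).card, powB q j + x = Q.size q + 1) ∧
      (∀ i ∈ Q.left q, ∃ y ∈ Finset.Icc 1 (Q.left q).card, powA q i = y * (Q.right q).card))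
  powA_distinct : ∀ q i i', powA q i ≠ 0 → powA q i' ≠ 0 → powA q i = powA q i' → i = i'
  powB_distinct : ∀ q j j', powB q j ≠ 0 → powB q j' ≠ 0 → powB q j = powB q j' → j = j'

/-! ### Bilinear complexity -/

/-- The tensors `a`, `b`, `c` form a bilinear algorithm with `R` multiplications for the product
of an `m × p` and a `p × n` matrix over `F`. -/
def IsBilinearAlgorithm {F : Type*} [Field F] {m p n R : ℕ} (a : Fin R → Matrix (Fin m) (Fin p) F)
    (b : Fin R → Matrix (Fin p) (Fin n) F) (c : Fin R → Matrix (Fin m) (Fin n) F) : Prop :=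
  ∀ (A : Matrix (Fin m) (Fin p) F) (B : Matrix (Fin p) (Fin n) F) (j : Fin m) (k : Fin n),
    ∑ i, c i j k * (∑ q, ∑ r, a i q r * A q r) * (∑ r, ∑ s, b i r s * B r s) = (A * B) j k

/-- The bilinear complexity of multiplying an `m × p` and a `p × n` matrix over `F`. -/
noncomputable def bilinearComplexity (F : Type*) [Field F] (m p n : ℕ) : ℕ :=
  sInf {R | ∃ (a : Fin R → Matrix (Fin m) (Fin p) F) (b : Fin R → Matrix (Fin p) (Fin n) F)
    (c : Fin R → Matrix (Fin m) (Fin n) F), IsBilinearAlgorithm a b c}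

/-! ### FCSA+FCC codes -/

/-- The index in `{0, …, d - 1}` of the `u`-th element of the `k`-th of `m` consecutive intervals
of length `d / m`. -/
def blockIndex {d m : ℕ} (k : Fin m) (u : Fin (d / m)) : Fin d :=
  Fin.castLE (Nat.mul_div_le d m) (finProdFinEquiv (k, u))

/-- The block in position `(k, l)` of a matrix split into an `m × p` grid. -/
def gridBlock {F : Type*} {d e m p : ℕ} (M : Matrix (Fin d) (Fin e) F) (k : Fin m) (l : Fin p) :
    Matrix (Fin (d / m)) (Fin (e / p)) F :=
  Matrix.of fun u v => M (blockIndex k u) (blockIndex l v)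

/-- The linear combination of the blocks of `M` with coefficients `a`. -/
def combineBlocks {F : Type*} [Field F] {d e m p : ℕ} (a : Matrix (Fin m) (Fin p) F)
    (M : Matrix (Fin d) (Fin e) F) : Matrix (Fin (d / m)) (Fin (e / p)) F :=
  ∑ k, ∑ l, a k l • gridBlock M k l

/-- What is chosen freely in an FCSA+FCC code: a bilinear algorithm with `R` multiplications,
a pole `f r q` for every instance `r` and task group `q`, and an evaluation point `x k` for every
worker `k`, all poles and evaluation points being distinct. -/
structure FCCData (F : Type*) [Field F] (m p n R N K : ℕ) where
  a : Fin R → Matrix (Fin m) (Fin p) F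
  b : Fin R → Matrix (Fin p) (Fin n) F
  c : Fin R → Matrix (Fin m) (Fin n) F
  bilinear : IsBilinearAlgorithm a b c
  f : Fin R → Fin N → F
  x : Fin K → F
  distinct : Function.Injective (Sum.elim (fun t : Fin R × Fin N => f t.1 t.2) x)

namespace FCCData

variable {F : Type*} [Field F] {m p n R N K : ℕ} {LA LB : ℕ} {S : Finset (Fin LA × Fin LB)}
  {Q : TaskAssignment S N}

/-- The `h`-th group of `ρ` consecutive instances. -/
def instances (R ρ : ℕ) (h : Fin (R / ρ)) : Finset (Fin R) :=
  Finset.univ.filter fun r => r.val / ρ = h.val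

/-- The encoding function of the first source for the `h`-th group of instances, at the point
`z`. -/
def encodeA (X : FCCData F m p n R N K) (P : PowerAssignment Q) (ρ : ℕ) {α β : ℕ}
    (A : Fin LA → Matrix (Fin α) (Fin β) F) (h : Fin (R / ρ)) (z : F) :
    Matrix (Fin (α / m)) (Fin (β / p)) F :=
  (∏ q, ∏ r ∈ instances R ρ h, (z - X.f r q) ^ Q.size q) •
    ∑ i, ∑ r ∈ instances R ρ h,
      (∏ q, (z - X.f r q) ^ P.powA q i)⁻¹ • combineBlocks (X.a r) (A i)

/-- The encoding function of the second source for the `h`-th group of instances, at the point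
`z`. -/
def encodeB (X : FCCData F m p n R N K) (P : PowerAssignment Q) (ρ : ℕ) {β γ : ℕ}
    (B : Fin LB → Matrix (Fin β) (Fin γ) F) (h : Fin (R / ρ)) (z : F) :
    Matrix (Fin (β / p)) (Fin (γ / n)) F :=
  ∑ j, ∑ r ∈ instances R ρ h,
    (∏ q, (z - X.f r q) ^ P.powB q j)⁻¹ • combineBlocks (X.b r) (B j)

/-- The FCSA+FCC code with a given family of decoding functions. Worker `k` receives the
evaluations at `x k` for all groups of instances, placed next to each other for the first source
and below each other for the second one. -/
def code (X : FCCData F m p n R N K) (P : PowerAssignment Q) (ρ α β γ : ℕ)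
    (dec : (W : Finset (Fin K)) → (W → Matrix (Fin (α / m)) (Fin (γ / n)) F) →
      S → Matrix (Fin α) (Fin γ) F) : VCDBMMCode F S α β γ K where
  rows _ := α / m
  inner _ := (R / ρ) * (β / p)
  cols _ := γ / n
  encA k A := Matrix.of fun u v =>
    X.encodeA P ρ A (finProdFinEquiv.symm v).1 (X.x k) u (finProdFinEquiv.symm v).2
  encB k B := Matrix.of fun v w =>
    X.encodeB P ρ B (finProdFinEquiv.symm v).1 (X.x k) (finProdFinEquiv.symm v).2 w
  dec := dec

end FCCData

/-- The recovery threshold of FCSA+FCC codes. -/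
noncomputable def fcsaThreshold {LA LB N : ℕ} {S : Finset (Fin LA × Fin LB)}
    {Q : TaskAssignment S N} (P : PowerAssignment Q) (R ρ : ℕ) : ℤ :=
  ((R : ℤ) + ρ) * ∑ q, (Q.size q : ℤ) - ((⨅ i, ∑ q, P.powA q i : ℕ) : ℤ)
    - ((⨅ j, ∑ q, P.powB q j : ℕ) : ℤ) + 1

/-!
The responses of the workers are, up to known non-zero factors, values of one polynomial. Multiply
`∑ h, A ^ h(z) * B ^ h(z)` by `∏ (z - f r q) ^ size q`, over all poles: the pole orders never exceed
the sizes of the groups, so all denominators cancel, and each entry becomes a polynomial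
`U = ∑ c t • E t`. The unknowns `c t` are the entries of the products `A_i ^ r * B_j ^ r'` of
combinations of blocks, and each `E t` is a product of powers of the `z - f r q`
(`FCCData.contribution`). Counting exponents shows `deg U < T`, so that `T` responses determine `U`
(`FCCData.natDegree_contribution_le`, `FCCData.mul_response_eq_eval`).

The remainder of `U` modulo `(z - f r q) ^ size q` determines `A_i ^ r * B_j ^ r` for all `(i, j)`
in the group `q`. The two pole orders of such a product add up to more than `size q`, and the sum
identifies `(i, j)`, because it is a representation in mixed radix; all other contributions vanish
modulo `(z - f r q) ^ size q`, because the groups are disjoint. Hence only contributions with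
different orders of vanishing below `size q` survive, and they are linearly independent
(`FCCData.eq_zero_of_dvd_sum_contribution`). The bilinear algorithm then assembles `A_i * B_j`.

The costs of encoding and of the workers come from evaluating the defining formulas. For decoding,
let `n` be the larger of `T` and the total size of the groups over all instances. Lagrange's formula
is evaluated along a binary tree (`computes_combination`), and so are the remainders
(`computes_remainderTree`); each of the `O(log n)` levels costs as much as a multiplication of
polynomials of degree `n`, one of them fixed. Divisions are avoided by storing a remainder as an
initial segment of the expansion of `U / G` at infinity, where `G` is the product of the moduli;
passing to a factor of `G` is then multiplication by the cofactor, so both trees consist of Toeplitz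
matrix-vector products. The last step is one linear map per pole, with at most `size q` inputs and
outputs (`exists_linear_decoding`).

Toeplitz products are multiplications by a fixed element of `F[X] / Φ`, for the cyclotomic
polynomial `Φ` of order `r ^ (k + 1)`. The field need not contain roots of unity, so they are
supplied by the Schönhage–Strassen recursion: an element is cut into blocks, the blocks are
transformed with a root of unity in a smaller ring of the same kind, where multiplication by it is
a shift of coordinates, and the pointwise products are computed recursively (`MulCost.step`). This
works for `r = 2` if `2` is invertible in `F` and for `r = 3` otherwise, and costs
`O(k log k)` operations per coordinate (`MulCost.fast`).

The total `n log n * O(log n * log log n)` is bounded by `T log² T log log T` if `n` is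
comparable to `T`. Otherwise a single group is larger than `T`, and the quadratic term of the local
systems dominates (`mul_treeFactor_le`). Finally, decoding functions for fewer than `T` responses
return a fixed non-zero matrix, which makes `T` the exact recovery threshold.
-/

/-! ### A calculus of straight-line programs -/

section Calculus

variable {D F : Type*} [Field F]

theorem StraightLine.base_subset {base A : Set (D → F)} {t : ℕ} (h : StraightLine base t A) :
    base ⊆ A := by
  induction h with
  | start => exact subset_rfl
  | add _ _ _ ih => exact ih.trans (Set.subset_insert _ _)
  | sub _ _ _ ih => exact ih.trans (Set.subset_insert _ _)
  | mul _ _ _ ih => exact ih.trans (Set.subset_insert _ _)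

/-- A program may be run with more functions available. -/
theorem StraightLine.union {base A : Set (D → F)} {t : ℕ} (h : StraightLine base t A)
    {base' : Set (D → F)} (hb : base ⊆ base') : StraightLine base' t (A ∪ base') := by
  induction h with
  | start => rw [Set.union_eq_self_of_subset_left hb]; exact .start
  | add _ hg hh ih => rw [Set.insert_union]; exact ih.add (.inl hg) (.inl hh)
  | sub _ hg hh ih => rw [Set.insert_union]; exact ih.sub (.inl hg) (.inl hh)
  | mul _ hg hh ih => rw [Set.insert_union]; exact ih.mul (.inl hg) (.inl hh)

theorem StraightLine.trans {base A B : Set (D → F)} {s t : ℕ} (h : StraightLine base s A)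
    (h' : StraightLine A t B) : StraightLine base (s + t) B := by
  induction h' with
  | start => exact h
  | add _ hg hh ih => exact ih.add hg hh
  | sub _ hg hh ih => exact ih.sub hg hh
  | mul _ hg hh ih => exact ih.mul hg hh

/-- `Computes base out t`: from the functions in `base` and constants, a straight-line program
with `t` operations makes all the functions in `out` available. In contrast to `ArithComputable`,
inputs and outputs are sets, so that subfamilies and reindexings need no bookkeeping. -/
def Computes (base out : Set (D → F)) (t : ℕ) : Prop :=
  ∃ A, StraightLine (base ∪ Set.range (Function.const D : F → D → F)) t A ∧ out ⊆ A

theorem Computes.arithComputable {ι κ : Type*} {input : ι → D → F} {output : κ → D → F} {t : ℕ}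
    (h : Computes (Set.range input) (Set.range output) t) : ArithComputable input output t := by
  obtain ⟨A, hA, ho⟩ := h
  exact ⟨A, hA, fun j => ho ⟨j, rfl⟩⟩

namespace Computes

variable {base base' mid out out' : Set (D → F)} {s t : ℕ}

theorem of_subset (h : out ⊆ base ∪ Set.range (Function.const D : F → D → F)) :
    Computes base out 0 := ⟨_, .start, h⟩

theorem mono_out (h : Computes base out t) (ho : out' ⊆ out) : Computes base out' t :=
  let ⟨A, hA, h'⟩ := h
  ⟨A, hA, ho.trans h'⟩

theorem mono_cost (h : Computes base out s) (hst : s ≤ t) : Computes base out t := by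
  induction hst with
  | refl => exact h
  | step _ ih =>
    obtain ⟨A, hA, h'⟩ := ih
    -- a superfluous operation `0 + 0`
    have h0 : Function.const D (0 : F) ∈ A := hA.base_subset (.inr ⟨0, rfl⟩)
    exact ⟨_, hA.add h0 h0, h'.trans (Set.subset_insert _ _)⟩

theorem trans (h : Computes base mid s) (h' : Computes mid out t) :
    Computes base out (s + t) := by
  obtain ⟨A, hA, hm⟩ := h
  obtain ⟨B, hB, ho⟩ := h'
  have hsub : mid ∪ Set.range (Function.const D : F → D → F) ⊆ A :=
    Set.union_subset hm (fun x hx => hA.base_subset (.inr hx))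
  exact ⟨_, hA.trans (hB.union hsub), ho.trans Set.subset_union_left⟩

/-- Functions that are available stay available. -/
theorem keep (h : Computes base out t) : Computes base (base ∪ out) t := by
  obtain ⟨A, hA, ho⟩ := h
  exact ⟨A, hA, Set.union_subset (fun x hx => hA.base_subset (.inl hx)) ho⟩

theorem mono_base (h : Computes base out t) (hb : base ⊆ base') : Computes base' out t := by
  have h0 : Computes base' base 0 := of_subset (hb.trans Set.subset_union_left)
  simpa using h0.trans h

theorem union (h : Computes base out s) (h' : Computes base out' t) :
    Computes base (out ∪ out') (s + t) := by
  have := h.keep.trans (h'.mono_base (base' := base ∪ out) Set.subset_union_left).keep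
  exact this.mono_out (by
    rintro x (hx | hx)
    · exact .inl (.inr hx)
    · exact .inr hx)

theorem biUnion {ι : Type*} (I : Finset ι) (o : ι → Set (D → F)) (c : ι → ℕ)
    (h : ∀ i ∈ I, Computes base (o i) (c i)) :
    Computes base {f | ∃ i ∈ I, f ∈ o i} (∑ i ∈ I, c i) := by
  classical
  induction I using Finset.induction_on with
  | empty => exact of_subset (by rintro f ⟨i, hi, -⟩; simp at hi)
  | insert a I ha ih =>
    rw [Finset.sum_insert ha]
    refine ((h a (by simp)).union (ih fun i hi => h i (by simp [hi]))).mono_out ?_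
    rintro f ⟨i, hi, hf⟩
    rcases Finset.mem_insert.1 hi with rfl | hi
    · exact .inl hf
    · exact .inr ⟨i, hi, hf⟩

/-- A finite family of functions, each of which costs at most `t`. -/
theorem family {ι : Type*} (I : Finset ι) (o : ι → D → F)
    (h : ∀ i ∈ I, Computes base {o i} t) :
    Computes base {f | ∃ i ∈ I, f = o i} (I.card * t) := by
  simpa using biUnion I (fun i => {o i}) (fun _ => t) h

theorem add {g h : D → F} (hg : g ∈ base) (hh : h ∈ base) :
    Computes base {fun d => g d + h d} 1 :=
  ⟨_, StraightLine.start.add (.inl hg) (.inl hh), by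
    rintro _ rfl; exact Set.mem_insert _ _⟩

theorem sub {g h : D → F} (hg : g ∈ base) (hh : h ∈ base) :
    Computes base {fun d => g d - h d} 1 :=
  ⟨_, StraightLine.start.sub (.inl hg) (.inl hh), by
    rintro _ rfl; exact Set.mem_insert _ _⟩

theorem mul {g h : D → F} (hg : g ∈ base) (hh : h ∈ base) :
    Computes base {fun d => g d * h d} 1 :=
  ⟨_, StraightLine.start.mul (.inl hg) (.inl hh), by
    rintro _ rfl; exact Set.mem_insert _ _⟩

theorem const_mul (a : F) {h : D → F} (hh : h ∈ base) :
    Computes base {fun d => a * h d} 1 :=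
  ⟨_, StraightLine.start.mul (.inr ⟨a, rfl⟩) (.inl hh), by
    rintro _ rfl; exact Set.mem_insert _ _⟩

/-- A sum of functions, each of which costs at most `t`. -/
theorem sum {ι : Type*} (I : Finset ι) (g : ι → D → F)
    (hg : ∀ i ∈ I, Computes base {g i} t) :
    Computes base {fun d => ∑ i ∈ I, g i d} (I.card * (t + 1)) := by
  classical
  induction I using Finset.induction_on with
  | empty =>
    refine (of_subset ?_).mono_cost (Nat.zero_le _)
    rintro _ rfl
    exact .inr ⟨0, by ext; simp⟩
  | insert a I ha ih =>
    have h1 := (ih fun i hi => hg i (by simp [hi])).union (hg a (by simp))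
    have h2 := h1.trans (add (g := fun d => ∑ i ∈ I, g i d) (h := g a) (.inl rfl) (.inr rfl))
    refine (h2.mono_cost ?_).mono_out ?_
    · rw [Finset.card_insert_of_notMem ha]; ring_nf; omega
    · rintro _ rfl
      refine Set.mem_singleton_iff.2 ?_
      ext d
      rw [Finset.sum_insert ha, add_comm]

/-- A linear form in available functions, with constant coefficients. -/
theorem linear {ι : Type*} (I : Finset ι) (a : ι → F) (g : ι → D → F)
    (hg : ∀ i ∈ I, g i ∈ base) :
    Computes base {fun d => ∑ i ∈ I, a i * g i d} (2 * I.card) := by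
  have := sum I (fun i d => a i * g i d) (fun i hi => const_mul (a i) (hg i hi))
  exact this.mono_cost (by omega)

end Computes

end Calculus

/-! ### Discrete Fourier transforms over a group algebra -/

section Fourier

open Finset

theorem sum_range_mul_split {M : Type*} [AddCommMonoid M] (f : ℕ → M) (m s : ℕ) :
    ∑ l ∈ range (m * s), f l = ∑ t ∈ range m, ∑ i ∈ range s, f (s * t + i) := by
  induction m with
  | zero => simp
  | succ m ih => rw [Nat.succ_mul, sum_range_add, ih, sum_range_succ, mul_comm m s]

/-- The fast Fourier transform of length `r ^ a` over the group algebra of `ℤ/L`. An element of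
the group algebra is given by its `L` coordinates, so that multiplication by a power of the
generator is a cyclic shift and costs nothing. -/
theorem computes_dft {D F : Type*} [Field F] {r L : ℕ} (hr : 0 < r) (hL : 0 < L) (a : ℕ) :
    ∀ (σ : ℕ) (I : ℕ → ℕ → D → F), L ∣ σ * r ^ a →
      Computes {f | ∃ j < r ^ a, ∃ l < L, f = I j l}
        {f | ∃ e < r ^ a, ∃ l < L,
          f = fun d => ∑ j ∈ range (r ^ a), I j ((l + σ * e * j) % L) d}
        (2 * r * a * r ^ a * L) := by
  induction a with
  | zero =>
    intro σ I _
    refine (Computes.of_subset ?_).mono_cost (Nat.zero_le _)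
    rintro _ ⟨e, he, l, hl, rfl⟩
    refine .inl ⟨0, by simp, l, hl, ?_⟩
    ext d
    simp [Nat.mod_eq_of_lt hl]
  | succ a ih =>
    intro σ I hσ
    have hσ' : L ∣ σ * r * r ^ a := by
      rwa [pow_succ', ← mul_assoc] at hσ
    -- the transforms of the `r` subsequences with a fixed residue modulo `r`
    set M : ℕ → ℕ → ℕ → D → F := fun i e l d =>
      ∑ j ∈ range (r ^ a), I (r * j + i) ((l + σ * r * e * j) % L) d with hM
    have h1 : ∀ i ∈ range r, Computes {f | ∃ j < r ^ (a + 1), ∃ l < L, f = I j l}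
        {f | ∃ e < r ^ a, ∃ l < L, f = M i e l} (2 * r * a * r ^ a * L) := by
      intro i hi
      refine (ih (σ * r) (fun j => I (r * j + i)) hσ').mono_base ?_
      rintro _ ⟨j, hj, l, hl, rfl⟩
      refine ⟨r * j + i, ?_, l, hl, rfl⟩
      have := mem_range.1 hi
      calc r * j + i < r * (j + 1) := by rw [mul_add]; omega
        _ ≤ r * r ^ a := Nat.mul_le_mul_left _ hj
        _ = r ^ (a + 1) := (pow_succ' r a).symm
    have h2 := Computes.biUnion (range r) _ _ h1
    -- `σ * r ^ a * r` is divisible by `L`, so that the transforms depend on `e` modulo `r ^ a` only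
    have key : ∀ e l : ℕ, (fun d => ∑ j ∈ range (r ^ (a + 1)), I j ((l + σ * e * j) % L) d) =
        fun d => ∑ i ∈ range r, 1 * M i (e % r ^ a) ((l + σ * e * i) % L) d := by
      intro e l
      ext d
      rw [pow_succ, sum_range_mul_split, sum_comm]
      refine sum_congr rfl fun i _ => ?_
      rw [one_mul]
      refine sum_congr rfl fun j _ => ?_
      congr 1
      obtain ⟨c, hc⟩ := hσ'
      have he : e = r ^ a * (e / r ^ a) + e % r ^ a := (Nat.div_add_mod _ _).symm
      change _ = ((l + σ * e * i) % L + _) % L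
      rw [Nat.mod_add_mod]
      set q := e / r ^ a
      set e' := e % r ^ a
      have : l + σ * e * (r * j + i) =
          (l + σ * e * i + σ * r * e' * j) + L * (c * q * j) := by
        calc l + σ * e * (r * j + i) = l + σ * e * i + σ * r * j * e := by ring
          _ = l + σ * e * i + σ * r * j * (r ^ a * q + e') := by rw [← he]
          _ = l + σ * e * i + σ * r * e' * j + (σ * r * r ^ a) * (q * j) := by ring
          _ = _ := by rw [hc]; ring
      rw [this, Nat.add_mul_mod_self_left]
    have h3 : Computes {f | ∃ i ∈ range r, f ∈ {f | ∃ e < r ^ a, ∃ l < L, f = M i e l}}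
        {f | ∃ p ∈ range (r ^ (a + 1)) ×ˢ range L, f = (fun p : ℕ × ℕ => fun d =>
          ∑ j ∈ range (r ^ (a + 1)), I j ((p.2 + σ * p.1 * j) % L) d) p}
        ((range (r ^ (a + 1)) ×ˢ range L).card * (2 * r)) := by
      refine Computes.family _ _ ?_
      rintro ⟨e, l⟩ -
      rw [key]
      refine (Computes.linear (range r) (fun _ => 1) _ ?_).mono_cost (by simp)
      intro i hi
      exact ⟨i, hi, e % r ^ a, Nat.mod_lt _ (pow_pos hr a), _, Nat.mod_lt _ hL, rfl⟩
    refine ((h2.trans h3).mono_cost ?_).mono_out ?_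
    · simp only [sum_const, card_range, card_product, smul_eq_mul]
      apply le_of_eq
      ring
    · rintro _ ⟨e, he, l, hl, rfl⟩
      exact ⟨(e, l), by simp [he, hl], rfl⟩

variable {F A : Type*} [Field F] [CommRing A] [Algebra F A]

/-- A cyclic shift of the coordinates is multiplication by a power of `y⁻¹`. -/
theorem sum_shift {L : ℕ} (hL : 0 < L) {y η : A} (hy : y ^ L = 1) (hη : y * η = 1) (w : ℕ → A)
    (c : ℕ) :
    ∑ l ∈ range L, w ((l + c) % L) * y ^ l =
      η ^ c * ∑ l ∈ range L, w l * y ^ l := by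
  have hyc : y ^ c * η ^ c = 1 := by rw [← mul_pow, hη, one_pow]
  have hmod : ∀ l, y ^ l = y ^ (l % L) := by
    intro l
    conv_lhs => rw [← Nat.div_add_mod l L, pow_add, pow_mul, hy, one_pow, one_mul]
  have h : y ^ c * ∑ l ∈ range L, w ((l + c) % L) * y ^ l =
      ∑ l ∈ range L, w l * y ^ l := by
    rw [mul_sum]
    refine sum_nbij' (fun l => (l + c) % L) (fun l => (l + (L - c % L)) % L) ?_ ?_ ?_ ?_ ?_
    · intro l _; exact mem_range.2 (Nat.mod_lt _ hL)
    · intro l _; exact mem_range.2 (Nat.mod_lt _ hL)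
    · intro l hl
      have hc := Nat.mod_lt c hL
      have : l + c + (L - c % L) = l + L * (c / L + 1) := by
        have := Nat.div_add_mod c L
        rw [mul_add]
        omega
      rw [Nat.mod_add_mod, this, Nat.add_mul_mod_self_left, Nat.mod_eq_of_lt (mem_range.1 hl)]
    · intro l hl
      have hc := Nat.mod_lt c hL
      have : l + (L - c % L) + c = l + L * (c / L + 1) := by
        have := Nat.div_add_mod c L
        rw [mul_add]
        omega
      rw [Nat.mod_add_mod, this, Nat.add_mul_mod_self_left, Nat.mod_eq_of_lt (mem_range.1 hl)]
    · intro l _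
      rw [← hmod (l + c), pow_add]
      ring
  calc _ = y ^ c * η ^ c * ∑ l ∈ range L, w ((l + c) % L) * y ^ l := by
        rw [hyc, one_mul]
    _ = η ^ c * (y ^ c * ∑ l ∈ range L, w ((l + c) % L) * y ^ l) := by ring
    _ = _ := by rw [h]

/-- What `computes_dft` computes, after the generator of the group algebra is mapped to `y`: the
transform with the root of unity `η ^ σ`, where `η = y⁻¹`. -/
theorem eval_dft {L : ℕ} (hL : 0 < L) {y η : A} (hy : y ^ L = 1) (hη : y * η = 1)
    (v : ℕ → ℕ → F) (σ e m : ℕ) :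
    ∑ l ∈ range L, algebraMap F A (∑ j ∈ range m, v j ((l + σ * e * j) % L)) * y ^ l =
      ∑ j ∈ range m, (η ^ σ) ^ (e * j) * ∑ l ∈ range L, algebraMap F A (v j l) * y ^ l := by
  simp_rw [map_sum, sum_mul]
  rw [sum_comm]
  refine sum_congr rfl fun j _ => ?_
  rw [sum_shift hL hy hη (fun l => algebraMap F A (v j l)), ← pow_mul, mul_assoc]

/-! ### Principal roots of unity -/

/-- In a ring with `1 + x ^ r ^ k + ⋯ + x ^ ((r - 1) r ^ k) = 0`, the coordinates with exponents
up to `r ^ (k + 1)` fold to coordinates with exponents up to `(r - 1) r ^ k`. -/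
theorem sum_fold {r k M : ℕ} (hr : 0 < r) (hM : r ^ (k + 1) = M) {x : A}
    (hx : ∑ i ∈ range r, x ^ (r ^ k * i) = 0) (w : ℕ → F) :
    ∑ o ∈ range ((r - 1) * r ^ k),
        algebraMap F A (w o - w ((r - 1) * r ^ k + o % r ^ k)) * x ^ o =
      ∑ l ∈ range M, algebraMap F A (w l) * x ^ l := by
  subst hM
  obtain ⟨r, rfl⟩ : ∃ r', r = r' + 1 := ⟨r - 1, by omega⟩
  simp only [Nat.add_sub_cancel]
  set n := (r + 1) ^ k
  have hpow : (r + 1) ^ (k + 1) = (r + 1) * n := pow_succ' _ _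
  rw [hpow, sum_range_mul_split, sum_range_mul_split, sum_range_succ]
  have h1 : ∀ t ∈ range r, ∀ i ∈ range n, (n * t + i) % n = i := by
    intro t _ i hi
    rw [Nat.mul_add_mod, Nat.mod_eq_of_lt (mem_range.1 hi)]
  have h2 : ∑ t ∈ range r, ∑ i ∈ range n,
      algebraMap F A (w (n * t + i) - w (r * n + (n * t + i) % n)) * x ^ (n * t + i) =
      ∑ t ∈ range r, ∑ i ∈ range n, algebraMap F A (w (n * t + i)) * x ^ (n * t + i) -
      ∑ t ∈ range r, ∑ i ∈ range n, algebraMap F A (w (r * n + i)) * x ^ (n * t + i) := by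
    rw [← sum_sub_distrib]
    refine sum_congr rfl fun t ht => ?_
    rw [← sum_sub_distrib]
    refine sum_congr rfl fun i hi => ?_
    rw [h1 t ht i hi, map_sub, sub_mul]
  rw [h2, sub_eq_add_neg]
  congr 1
  rw [sum_comm, ← sum_neg_distrib]
  refine sum_congr rfl fun i _ => ?_
  rw [sum_range_succ] at hx
  simp_rw [pow_add, ← mul_assoc]
  rw [← sum_mul, ← mul_sum, ← neg_mul, ← mul_neg, mul_comm r n]
  congr 2
  rw [neg_eq_iff_add_eq_zero]
  exact hx

theorem pow_eq_one_of_geom {r m : ℕ} {x : A} (hx : ∑ i ∈ range r, x ^ (m * i) = 0) :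
    x ^ (m * r) = 1 := by
  have h := geom_sum_mul (x ^ m) r
  simp_rw [← pow_mul] at h
  rw [hx, zero_mul] at h
  exact (sub_eq_zero.1 h.symm)

theorem pow_succ_eq_one_of_geom {r a : ℕ} {x : A} (hx : ∑ i ∈ range r, x ^ (r ^ a * i) = 0) :
    x ^ r ^ (a + 1) = 1 := by
  rw [pow_succ]
  exact pow_eq_one_of_geom hx

/-- If `1 + θ + ⋯ + θ ^ (r - 1) = 0` for a prime `r` that is invertible, then `1 - θ ^ w` is
invertible for all `w` prime to `r`. -/
theorem isUnit_one_sub_pow {r : ℕ} (hr : r.Prime) (hrF : (r : F) ≠ 0) {θ : A}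
    (hθ : ∑ i ∈ range r, θ ^ i = 0) {w : ℕ} (hw : ¬ r ∣ w) : IsUnit (1 - θ ^ w) := by
  have h1 : θ ^ r = 1 := by
    have := pow_eq_one_of_geom (m := 1) (r := r) (x := θ) (by simpa using hθ)
    simpa using this
  have hmod : ∀ l, θ ^ l = θ ^ (l % r) := by
    intro l
    conv_lhs => rw [← Nat.div_add_mod l r, pow_add, pow_mul, h1, one_pow, one_mul]
  have hcop : Nat.Coprime r w := (hr.coprime_iff_not_dvd).2 hw
  have hsum : ∑ i ∈ range r, θ ^ (w * i) = 0 := by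
    rw [← hθ]
    refine sum_nbij (fun i => w * i % r) ?_ ?_ ?_ ?_
    · intro i _; exact mem_range.2 (Nat.mod_lt _ hr.pos)
    · intro i hi j hj hij
      have hm : w * i ≡ w * j [MOD r] := hij
      have hm := Nat.ModEq.cancel_left_of_coprime hcop hm
      rw [coe_range, Set.mem_Iio] at hi hj
      rwa [Nat.ModEq, Nat.mod_eq_of_lt hi, Nat.mod_eq_of_lt hj] at hm
    · intro j hj
      rw [coe_range, Set.mem_Iio] at hj
      obtain ⟨m, hm⟩ := Nat.exists_mul_mod_eq_one_of_coprime hcop.symm hr.one_lt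
      refine ⟨m * j % r, ?_, ?_⟩
      · rw [coe_range, Set.mem_Iio]; exact Nat.mod_lt _ hr.pos
      · change w * (m * j % r) % r = j
        rw [Nat.mul_mod, Nat.mod_mod, ← Nat.mul_mod, ← mul_assoc, Nat.mul_mod, hm.2, one_mul,
          Nat.mod_mod, Nat.mod_eq_of_lt hj]
    · intro i _; exact hmod _
  have hdvd : (1 - θ ^ w) ∣ (r : A) := by
    have : (r : A) = ∑ i ∈ range r, (1 - θ ^ (w * i)) := by
      rw [sum_sub_distrib, hsum]; simp
    rw [this]
    refine dvd_sum fun i _ => ?_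
    rw [pow_mul]
    simpa using sub_dvd_pow_sub_pow (1 : A) (θ ^ w) i
  have hunit : IsUnit (r : A) := by
    have := (IsUnit.mk0 (r : F) hrF).map (algebraMap F A)
    rwa [map_natCast] at this
  exact isUnit_of_dvd_unit hdvd hunit

/-- The differences of distinct powers of a principal root of unity of order `r ^ (a + 1)` are
units. This makes geometric sums vanish, although the ring may have zero divisors. -/
theorem isUnit_one_sub_pow_of_geom {r a : ℕ} (hr : r.Prime) (hrF : (r : F) ≠ 0) {ω : A}
    (hω : ∑ i ∈ range r, ω ^ (r ^ a * i) = 0) {u : ℕ} (hu : ¬ r ^ (a + 1) ∣ u) :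
    IsUnit (1 - ω ^ u) := by
  have hu0 : u ≠ 0 := by rintro rfl; simp at hu
  obtain ⟨j, w, hw, rfl⟩ := Nat.exists_eq_pow_mul_and_not_dvd hu0 r hr.ne_one
  have hj : j ≤ a := by
    by_contra! h
    exact hu (Dvd.dvd.mul_right (pow_dvd_pow r h) w)
  simp_rw [pow_mul] at hω
  refine isUnit_of_dvd_unit ?_ (isUnit_one_sub_pow (F := F) hr hrF hω hw)
  have : (ω ^ r ^ a) ^ w = (ω ^ (r ^ j * w)) ^ r ^ (a - j) := by
    rw [← pow_mul, ← pow_mul]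
    congr 1
    rw [mul_right_comm, ← pow_add, Nat.add_sub_cancel' hj]
  rw [this]
  simpa using sub_dvd_pow_sub_pow (1 : A) (ω ^ (r ^ j * w)) (r ^ (a - j))

/-- Orthogonality of the powers of a principal root of unity of order `r ^ (a + 1)`, where the
summation is over the exponents that are prime to `r`. -/
theorem sum_coprime_root {r a : ℕ} (hr : r.Prime) (hrF : (r : F) ≠ 0) {ω : A}
    (hω : ∑ i ∈ range r, ω ^ (r ^ a * i) = 0) (u : ℕ) :
    ∑ e ∈ (range (r ^ (a + 1))).filter (fun e => ¬ r ∣ e), ω ^ (e * u) =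
      (if r ^ (a + 1) ∣ u then (r : A) ^ (a + 1) else 0) -
        (if r ^ a ∣ u then (r : A) ^ a else 0) := by
  have h1 : ω ^ r ^ (a + 1) = 1 := by rw [pow_succ]; exact pow_eq_one_of_geom hω
  have hfull : ∑ e ∈ range (r ^ (a + 1)), ω ^ (e * u) =
      if r ^ (a + 1) ∣ u then (r : A) ^ (a + 1) else 0 := by
    split_ifs with h
    · obtain ⟨c, rfl⟩ := h
      rw [sum_congr rfl (g := fun _ => (1 : A))]
      · simp
      · intro e _
        rw [mul_left_comm, pow_mul, h1, one_pow]
    · have h2 := mul_neg_geom_sum (ω ^ u) (r ^ (a + 1))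
      rw [← pow_mul, mul_comm u, pow_mul, h1, one_pow, sub_self] at h2
      have h3 := (isUnit_one_sub_pow_of_geom (F := F) hr hrF hω h).mul_right_eq_zero.1 h2
      rw [← h3]
      exact sum_congr rfl fun e _ => by rw [← pow_mul, mul_comm]
  have hmult : ∑ e ∈ range (r ^ a), ω ^ (r * e * u) =
      if r ^ a ∣ u then (r : A) ^ a else 0 := by
    split_ifs with h
    · obtain ⟨c, rfl⟩ := h
      rw [sum_congr rfl (g := fun _ => (1 : A))]
      · simp
      · intro e _
        have : r * e * (r ^ a * c) = r ^ (a + 1) * (e * c) := by ring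
        rw [this, pow_mul, h1, one_pow]
    · have hu' : ¬ r ^ (a + 1) ∣ r * u := by
        rw [pow_succ']
        exact fun h' => h (Nat.dvd_of_mul_dvd_mul_left hr.pos h')
      have h2 := mul_neg_geom_sum (ω ^ (r * u)) (r ^ a)
      have h4 : (ω ^ (r * u)) ^ r ^ a = 1 := by
        rw [← pow_mul, show r * u * r ^ a = r ^ (a + 1) * u by ring, pow_mul, h1, one_pow]
      rw [h4, sub_self] at h2
      have h3 := (isUnit_one_sub_pow_of_geom (F := F) hr hrF hω hu').mul_right_eq_zero.1 h2
      rw [← h3]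
      exact sum_congr rfl fun e _ => by rw [← pow_mul]; ring_nf
  have hsplit : ∑ e ∈ (range (r ^ (a + 1))).filter (fun e => r ∣ e), ω ^ (e * u) =
      ∑ e ∈ range (r ^ a), ω ^ (r * e * u) := by
    symm
    refine sum_nbij (fun e => r * e) ?_ ?_ ?_ ?_
    · intro e he
      rw [mem_filter, mem_range, pow_succ']
      exact ⟨Nat.mul_lt_mul_of_pos_left (mem_range.1 he) hr.pos, dvd_mul_right _ _⟩
    · intro e _ e' _ h
      exact Nat.eq_of_mul_eq_mul_left hr.pos h
    · intro e he
      rw [mem_coe, mem_filter, mem_range, pow_succ'] at he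
      obtain ⟨he, c, rfl⟩ := he
      exact ⟨c, by simpa using Nat.lt_of_mul_lt_mul_left he, rfl⟩
    · intro e _; rfl
  rw [← hfull, ← hmult, ← hsplit, eq_sub_iff_add_eq]
  have := sum_filter_add_sum_filter_not (range (r ^ (a + 1))) (fun e => r ∣ e)
    (fun e => ω ^ (e * u))
  rw [← this, add_comm]

end Fourier

/-! ### Products of polynomials cut into blocks -/

section Multiplication

open Finset Polynomial

variable {F A : Type*} [Field F] [CommRing A] [Algebra F A]

/-- The `t`-th block of length `s` of a coordinate sequence, as a polynomial. -/
noncomputable def blockPoly (v : ℕ → F) (s t : ℕ) : F[X] :=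
  ∑ i ∈ range s, C (v (s * t + i)) * X ^ i

theorem aeval_blockPoly (v : ℕ → F) (s t : ℕ) (x : A) :
    aeval x (blockPoly v s t) = ∑ i ∈ range s, algebraMap F A (v (s * t + i)) * x ^ i := by
  simp [blockPoly, map_sum]

theorem natDegree_blockPoly_le (v : ℕ → F) (s t : ℕ) : (blockPoly v s t).natDegree ≤ s - 1 := by
  refine natDegree_sum_le_of_forall_le _ _ fun i hi => ?_
  refine (natDegree_C_mul_X_pow_le _ _).trans ?_
  have := mem_range.1 hi
  omega

/-- Cutting a polynomial in `x` into blocks makes it a polynomial in `z = x ^ s`. -/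
theorem sum_eq_sum_blockPoly (v : ℕ → F) {m s M : ℕ} (hM : M = m * s) (x : A) :
    ∑ i ∈ range M, algebraMap F A (v i) * x ^ i =
      ∑ t ∈ range m, aeval x (blockPoly v s t) * (x ^ s) ^ t := by
  rw [hM, sum_range_mul_split]
  refine sum_congr rfl fun t _ => ?_
  rw [aeval_blockPoly, sum_mul]
  refine sum_congr rfl fun i _ => ?_
  rw [← pow_mul, pow_add]
  ring

/-- The coefficient of `z ^ t` in a representative of `z ^ u` modulo
`1 + z ^ r ^ a + ⋯ + z ^ ((r - 1) r ^ a)` of degree less than `r ^ (a + 1)`: the representative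
which vanishes modulo `z ^ r ^ a - 1`. -/
noncomputable def cyclicCoeff (F : Type*) [Field F] (r a u t : ℕ) : F :=
  (if u ≡ t [MOD r ^ (a + 1)] then 1 else 0) - (r : F)⁻¹ * (if u ≡ t [MOD r ^ a] then 1 else 0)

theorem sum_cyclicCoeff {r a : ℕ} (hr : 0 < r) {z : A}
    (hz : ∑ i ∈ range r, z ^ (r ^ a * i) = 0) (u : ℕ) :
    ∑ t ∈ range (r ^ (a + 1)), algebraMap F A (cyclicCoeff F r a u t) * z ^ t = z ^ u := by
  have h1 : z ^ r ^ (a + 1) = 1 := by rw [pow_succ]; exact pow_eq_one_of_geom hz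
  have hN : 0 < r ^ (a + 1) := pow_pos hr _
  have hn : 0 < r ^ a := pow_pos hr _
  simp only [cyclicCoeff, map_sub, map_mul, sub_mul, sum_sub_distrib]
  have e1 : ∑ t ∈ range (r ^ (a + 1)),
      algebraMap F A (if u ≡ t [MOD r ^ (a + 1)] then 1 else 0) * z ^ t = z ^ u := by
    rw [sum_eq_single (u % r ^ (a + 1))]
    · rw [if_pos (Nat.mod_modEq _ _).symm, map_one, one_mul]
      conv_rhs => rw [← Nat.div_add_mod u (r ^ (a + 1)), pow_add, pow_mul, h1, one_pow, one_mul]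
    · intro t ht hne
      rw [if_neg, map_zero, zero_mul]
      intro h
      exact hne (by rw [h, Nat.mod_eq_of_lt (mem_range.1 ht)])
    · intro h
      exact absurd (mem_range.2 (Nat.mod_lt _ hN)) h
  have e2 : ∑ t ∈ range (r ^ (a + 1)), algebraMap F A (r : F)⁻¹ *
      algebraMap F A (if u ≡ t [MOD r ^ a] then 1 else 0) * z ^ t = 0 := by
    simp_rw [mul_assoc]
    rw [← mul_sum, pow_succ', sum_range_mul_split, sum_comm]
    convert mul_zero _
    refine sum_eq_zero fun t _ => ?_
    have : ∀ i ∈ range r, algebraMap F A (if u ≡ r ^ a * i + t [MOD r ^ a] then 1 else 0) *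
        z ^ (r ^ a * i + t) =
        algebraMap F A (if u ≡ t [MOD r ^ a] then 1 else 0) * z ^ t * z ^ (r ^ a * i) := by
      intro i _
      have : (u ≡ r ^ a * i + t [MOD r ^ a]) ↔ (u ≡ t [MOD r ^ a]) := by
        simp [Nat.ModEq]
      simp only [this, pow_add]
      ring
    rw [sum_congr rfl this, ← mul_sum, hz, mul_zero]
  rw [e1, e2, sub_zero]

/-- The coefficients of a product of two polynomials in `z` with `m` coefficients each, reduced
as in `cyclicCoeff`. -/
noncomputable def cyclicProd (r a m : ℕ) (f g : ℕ → F[X]) (t : ℕ) : F[X] :=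
  ∑ j ∈ range m, ∑ j' ∈ range m, C (cyclicCoeff F r a (j + j') t) * (f j * g j')

/-- The reduced product is the product, in rings where `z` is a root of the cyclotomic
polynomial. -/
theorem sum_cyclicProd {r a : ℕ} (hr : 0 < r) {x z : A}
    (hz : ∑ i ∈ range r, z ^ (r ^ a * i) = 0) (m : ℕ) (f g : ℕ → F[X]) :
    ∑ t ∈ range (r ^ (a + 1)), aeval x (cyclicProd r a m f g t) * z ^ t =
      (∑ j ∈ range m, aeval x (f j) * z ^ j) * ∑ j ∈ range m, aeval x (g j) * z ^ j := by
  rw [sum_mul_sum]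
  simp only [cyclicProd, map_sum, sum_mul, map_mul, aeval_C]
  rw [sum_comm]
  refine sum_congr rfl fun j _ => ?_
  rw [sum_comm]
  refine sum_congr rfl fun j' _ => ?_
  have := sum_cyclicCoeff (F := F) hr hz (j + j')
  calc _ = aeval x (f j) * aeval x (g j') * ∑ t ∈ range (r ^ (a + 1)),
        algebraMap F A (cyclicCoeff F r a (j + j') t) * z ^ t := by
        rw [mul_sum]; exact sum_congr rfl fun t _ => by ring
    _ = _ := by rw [this, pow_add]; ring

/-- The reduced product by the convolution theorem: it is the inverse transform, over the exponents
prime to `r`, of the pointwise product of the transforms. Here the root of unity `ω` lies in the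
ring in which the coefficients are evaluated. The transform at the other exponents is irrelevant,
because `cyclicProd` was chosen to vanish modulo `z ^ r ^ a - 1`. -/
theorem aeval_cyclicProd {r a : ℕ} (hr : r.Prime) (hrF : (r : F) ≠ 0) {y ω ζ : A}
    (hω : ∑ i ∈ range r, ω ^ (r ^ a * i) = 0) (hωζ : ω * ζ = 1) (m : ℕ) (f g : ℕ → F[X]) (t : ℕ) :
    (r : A) ^ (a + 1) * aeval y (cyclicProd r a m f g t) =
      ∑ e ∈ (range (r ^ (a + 1))).filter (fun e => ¬ r ∣ e), ζ ^ (e * t) *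
        ((∑ j ∈ range m, aeval y (f j) * ω ^ (e * j)) *
          ∑ j ∈ range m, aeval y (g j) * ω ^ (e * j)) := by
  have h1 : ω ^ r ^ (a + 1) = 1 := by rw [pow_succ]; exact pow_eq_one_of_geom hω
  have hN : 0 < r ^ (a + 1) := pow_pos hr.pos _
  have hζ : ζ = ω ^ (r ^ (a + 1) - 1) := by
    have h2 : ω ^ (r ^ (a + 1) - 1) * ω = 1 := by rw [← pow_succ, Nat.sub_add_cancel hN, h1]
    calc ζ = ω ^ (r ^ (a + 1) - 1) * ω * ζ := by rw [h2, one_mul]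
      _ = _ := by rw [mul_assoc, hωζ, mul_one]
  have hmod : ∀ u M, M ∣ r ^ (a + 1) →
      (M ∣ (r ^ (a + 1) - 1) * t + u ↔ u ≡ t [MOD M]) := by
    intro u M hM
    have h3 : (r ^ (a + 1) - 1) * t + t ≡ 0 [MOD M] := by
      rw [← Nat.succ_mul, Nat.succ_eq_add_one, Nat.sub_add_cancel hN]
      exact (Nat.modEq_zero_iff_dvd).2 (hM.mul_right t)
    rw [← Nat.modEq_zero_iff_dvd]
    constructor
    · intro h
      exact Nat.ModEq.add_left_cancel' _ (h.trans h3.symm)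
    · intro h
      exact (Nat.ModEq.add_left _ h).trans h3
  have hκ : ∀ u, (r : A) ^ (a + 1) * algebraMap F A (cyclicCoeff F r a u t) =
      ∑ e ∈ (range (r ^ (a + 1))).filter (fun e => ¬ r ∣ e), ζ ^ (e * t) * ω ^ (e * u) := by
    intro u
    have h4 : ∀ e, ζ ^ (e * t) * ω ^ (e * u) = ω ^ (e * ((r ^ (a + 1) - 1) * t + u)) := by
      intro e
      rw [hζ, ← pow_mul, ← pow_add]
      congr 1
      ring
    simp_rw [h4]
    rw [sum_coprime_root (F := F) hr hrF hω]
    simp only [hmod u _ dvd_rfl, hmod u _ (pow_dvd_pow r (Nat.le_succ a))]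
    have hrA : (r : A) * algebraMap F A (r : F)⁻¹ = 1 := by
      rw [← map_natCast (algebraMap F A), ← map_mul, mul_inv_cancel₀ hrF, map_one]
    simp only [cyclicCoeff, map_sub, map_mul, mul_sub]
    congr 1
    · split_ifs <;> simp
    · split_ifs
      · rw [map_one, mul_one, pow_succ, mul_assoc, hrA, mul_one]
      · simp
  simp only [cyclicProd, map_sum, map_mul, aeval_C]
  calc _ = ∑ j ∈ range m, ∑ j' ∈ range m,
        ((r : A) ^ (a + 1) * algebraMap F A (cyclicCoeff F r a (j + j') t)) *
          (aeval y (f j) * aeval y (g j')) := by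
        simp_rw [mul_sum, mul_assoc]
    _ = ∑ j ∈ range m, ∑ j' ∈ range m,
        ∑ e ∈ (range (r ^ (a + 1))).filter (fun e => ¬ r ∣ e), ζ ^ (e * t) *
          ((aeval y (f j) * ω ^ (e * j)) * (aeval y (g j') * ω ^ (e * j'))) := by
        simp_rw [hκ, sum_mul]
        refine sum_congr rfl fun j _ => sum_congr rfl fun j' _ => sum_congr rfl fun e _ => ?_
        rw [mul_add, pow_add]
        ring
    _ = _ := by
        simp_rw [sum_mul_sum, mul_sum]
        rw [sum_comm]
        simp_rw [fun j' => sum_comm (s := range m)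
          (t := (range (r ^ (a + 1))).filter (fun e => ¬ r ∣ e))
          (f := fun j e => ζ ^ (e * t) *
            ((aeval y (f j) * ω ^ (e * j)) * (aeval y (g j') * ω ^ (e * j'))))]
        rw [sum_comm]
        exact sum_congr rfl fun e _ => sum_comm

theorem natDegree_cyclicProd_le {r a m s : ℕ} {f g : ℕ → F[X]} (hf : ∀ j, (f j).natDegree ≤ s)
    (hg : ∀ j, (g j).natDegree ≤ s) (t : ℕ) : (cyclicProd r a m f g t).natDegree ≤ s + s := by
  refine natDegree_sum_le_of_forall_le _ _ fun j _ => ?_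
  refine natDegree_sum_le_of_forall_le _ _ fun j' _ => ?_
  refine (natDegree_C_mul_le _ _).trans (natDegree_mul_le.trans (add_le_add (hf j) (hg j')))

/-! ### Cyclotomic quotients of a polynomial ring -/

/-- The ring `F[X] / Φ` for the cyclotomic polynomial `Φ` of order `r ^ (k + 1)`. -/
abbrev CycloQuot (F : Type*) [Field F] (r k : ℕ) : Type _ :=
  AdjoinRoot (cyclotomic (r ^ (k + 1)) F)

/-- The class of `X`. -/
noncomputable abbrev CycloQuot.x (F : Type*) [Field F] (r k : ℕ) : CycloQuot F r k :=
  AdjoinRoot.root _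

namespace CycloQuot

/-- The class of `X` is a principal root of unity of order `r ^ (k + 1)`. -/
theorem geom (r k : ℕ) [hr : Fact r.Prime] :
    ∑ i ∈ range r, (x F r k) ^ (r ^ k * i) = 0 := by
  have h : aeval (x F r k) (cyclotomic (r ^ (k + 1)) F) = 0 := by
    rw [AdjoinRoot.aeval_eq, AdjoinRoot.mk_self]
  have h' := congrArg (aeval (x F r k))
    (cyclotomic_prime_pow_eq_geom_sum (R := F) hr.out (n := k))
  rw [h] at h'
  simpa [map_sum, ← pow_mul] using h'.symm

theorem natDegree (r k : ℕ) [hr : Fact r.Prime] :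
    (cyclotomic (r ^ (k + 1)) F).natDegree = (r - 1) * r ^ k := by
  rw [natDegree_cyclotomic, Nat.totient_prime_pow_succ hr.out, mul_comm]

/-- A polynomial of small degree can be read off its class. -/
theorem coeff_eq {r k : ℕ} [hr : Fact r.Prime] {H : ℕ → F} {p : F[X]}
    (hp : p.natDegree < (r - 1) * r ^ k)
    (h : ∑ i ∈ range ((r - 1) * r ^ k), algebraMap F (CycloQuot F r k) (H i) * x F r k ^ i =
      aeval (x F r k) p) {i : ℕ} (hi : i < (r - 1) * r ^ k) : H i = p.coeff i := by
  set q : F[X] := ∑ i ∈ range ((r - 1) * r ^ k), C (H i) * X ^ i with hq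
  have hqc : q.coeff i = H i := by
    simp [hq, coeff_X_pow, hi]
  have h1 : aeval (x F r k) (q - p) = 0 := by
    rw [map_sub, ← h, sub_eq_zero, hq]
    simp [map_sum]
  rw [AdjoinRoot.aeval_eq, AdjoinRoot.mk_eq_zero] at h1
  have hdeg : (q - p).degree < (cyclotomic (r ^ (k + 1)) F).degree := by
    rw [degree_eq_natDegree (cyclotomic_ne_zero _ F), natDegree]
    refine (degree_sub_le _ _).trans_lt (max_lt ?_ ?_)
    · refine (degree_sum_le _ _).trans_lt ?_
      refine (Finset.sup_lt_iff (WithBot.bot_lt_coe _)).2 fun j hj => ?_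
      refine (degree_C_mul_X_pow_le _ _).trans_lt ?_
      exact_mod_cast mem_range.1 hj
    · exact degree_le_natDegree.trans_lt (by exact_mod_cast hp)
  have h2 := eq_zero_of_dvd_of_degree_lt h1 hdeg
  rw [← hqc, sub_eq_zero.1 h2]

theorem exists_repr {r k : ℕ} [hr : Fact r.Prime] (z : CycloQuot F r k) :
    ∃ w : ℕ → F, z = ∑ i ∈ range ((r - 1) * r ^ k), algebraMap F _ (w i) * x F r k ^ i := by
  obtain ⟨p, rfl⟩ := AdjoinRoot.mk_surjective z
  have hm := cyclotomic.monic (r ^ (k + 1)) F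
  refine ⟨(p %ₘ cyclotomic (r ^ (k + 1)) F).coeff, ?_⟩
  have hlt : (p %ₘ cyclotomic (r ^ (k + 1)) F).natDegree < (r - 1) * r ^ k := by
    rw [← natDegree (F := F) r k]
    refine natDegree_modByMonic_lt _ hm fun h => ?_
    have h1 := natDegree (F := F) r k
    rw [h, natDegree_one] at h1
    have := hr.out.two_le
    have : 0 < (r - 1) * r ^ k := Nat.mul_pos (by omega) (pow_pos hr.out.pos _)
    omega
  have h1 : AdjoinRoot.mk (cyclotomic (r ^ (k + 1)) F) p =
      aeval (x F r k) (p %ₘ cyclotomic (r ^ (k + 1)) F) := by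
    rw [AdjoinRoot.aeval_eq, AdjoinRoot.mk_eq_mk]
    have := modByMonic_add_div p (cyclotomic (r ^ (k + 1)) F)
    refine ⟨p /ₘ cyclotomic (r ^ (k + 1)) F, ?_⟩
    exact sub_eq_of_eq_add' this.symm
  rw [h1, aeval_eq_sum_range' hlt]
  simp only [Algebra.smul_def]

end CycloQuot

end Multiplication

/-! ### The Schönhage–Strassen recursion -/

section MulStep

open Finset Polynomial

theorem sum_range_ite_lt {M : Type*} [AddCommMonoid M] {s L : ℕ} (h : s ≤ L) (G : ℕ → M) :
    ∑ l ∈ range L, (if l < s then G l else 0) = ∑ l ∈ range s, G l := by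
  rw [← sum_filter]
  congr 1
  ext l
  simp only [mem_filter, mem_range]
  omega

variable {F : Type*} [Field F]

/-- Correctness of one level of the Schönhage–Strassen recursion. The multiplicand `v` is cut into
blocks of length `r ^ b`, the blocks are transformed over the group algebra, `Y e` is the product
of the `e`-th coefficient of the transform with that of `γ`, and `H` is the inverse transform of
`Y`. -/
theorem coeff_cyclicProd_of_dft {r δ a b : ℕ} [hr : Fact r.Prime] (hrF : (r : F) ≠ 0)
    (hδ : (r - 1) * r ^ δ = 2) (hab : a ≤ b + δ) (v γ : ℕ → F) (Y : ℕ → ℕ → F)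
    (hY : ∀ e < r ^ (a + 1), ¬ r ∣ e →
      ∑ i ∈ range ((r - 1) * r ^ (b + δ)),
        algebraMap F _ (Y e i) * CycloQuot.x F r (b + δ) ^ i =
      (∑ j ∈ range ((r - 1) * r ^ a),
        aeval (CycloQuot.x F r (b + δ)) (blockPoly γ (r ^ b) j) *
          (CycloQuot.x F r (b + δ) ^ r ^ (b + δ - a)) ^ (e * j)) *
      ∑ l ∈ range (r ^ (b + δ + 1)), algebraMap F _ (∑ j ∈ range (r ^ (a + 1)),
        (fun j l => if j < (r - 1) * r ^ a ∧ l < r ^ b then v (r ^ b * j + l) else 0) j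
          ((l + (r ^ (b + δ - a) * (r ^ (b + δ + 1) - 1)) * e * j) % r ^ (b + δ + 1))) *
        CycloQuot.x F r (b + δ) ^ l)
    (H : ℕ → ℕ → F)
    (hH : ∀ t i, H t i = ((r : F) ^ (a + 1))⁻¹ *
      ((fun l => ∑ e ∈ range (r ^ (a + 1)),
        (fun e l => if ¬ r ∣ e ∧ l < (r - 1) * r ^ (b + δ) then Y e l else 0) e
          ((l + r ^ (b + δ - a) * t * e) % r ^ (b + δ + 1))) i -
      (fun l => ∑ e ∈ range (r ^ (a + 1)),
        (fun e l => if ¬ r ∣ e ∧ l < (r - 1) * r ^ (b + δ) then Y e l else 0) e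
          ((l + r ^ (b + δ - a) * t * e) % r ^ (b + δ + 1)))
            ((r - 1) * r ^ (b + δ) + i % r ^ (b + δ)))) (t : ℕ) {i : ℕ}
    (hi : i < (r - 1) * r ^ (b + δ)) :
    H t i = (cyclicProd r a ((r - 1) * r ^ a) (blockPoly v (r ^ b)) (blockPoly γ (r ^ b)) t).coeff
      i := by
  set c := b + δ with hc
  set y := CycloQuot.x F r c
  set σ := r ^ (c - a)
  set L := r ^ (c + 1) with hL
  set m := (r - 1) * r ^ a with hm
  set Nc := (r - 1) * r ^ c with hNc
  have hr0 : 0 < r := hr.out.pos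
  have hr2 : 2 ≤ r := hr.out.two_le
  have hNc2 : Nc = 2 * r ^ b := by
    rw [hNc, hc, pow_add, ← hδ]; ring
  have hLpos : 0 < L := pow_pos hr0 _
  have hNcL : Nc ≤ L := by
    rw [hL, pow_succ']; exact Nat.mul_le_mul_right _ (Nat.sub_le _ _)
  have hs : 0 < r ^ b := pow_pos hr0 _
  have hgeom : ∑ i ∈ range r, y ^ (r ^ c * i) = 0 := CycloQuot.geom r c
  have hyL : y ^ L = 1 := pow_succ_eq_one_of_geom hgeom
  set η := y ^ (L - 1) with hη'
  have hη : y * η = 1 := by rw [hη', ← pow_succ', Nat.sub_add_cancel hLpos, hyL]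
  have hω : ∑ i ∈ range r, (y ^ σ) ^ (r ^ a * i) = 0 := by
    rw [← hgeom]
    refine sum_congr rfl fun i _ => ?_
    rw [← pow_mul, ← mul_assoc, ← pow_add, Nat.sub_add_cancel hab]
  have hωζ : y ^ σ * η ^ σ = 1 := by rw [← mul_pow, hη, one_pow]
  -- `L - 1` stands for `-1` in exponents, which have to be natural numbers
  have hηL : η ^ (σ * (L - 1)) = y ^ σ := by
    have h1 : η ^ L = 1 := by rw [hη', ← pow_mul, mul_comm, pow_mul, hyL, one_pow]
    have h2 : η ^ (L - 1) = y := by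
      calc η ^ (L - 1) = η ^ (L - 1) * (y * η) := by rw [hη, mul_one]
        _ = η ^ (L - 1) * η * y := by ring
        _ = y := by rw [← pow_succ, Nat.sub_add_cancel hLpos, h1, one_mul]
    rw [mul_comm, pow_mul, h2]
  have hdeg : (cyclicProd r a m (blockPoly v (r ^ b)) (blockPoly γ (r ^ b)) t).natDegree < Nc := by
    refine (natDegree_cyclicProd_le (natDegree_blockPoly_le v (r ^ b))
      (natDegree_blockPoly_le γ (r ^ b)) t).trans_lt ?_
    omega
  refine CycloQuot.coeff_eq hdeg ?_ hi
  have hfac : ∑ i ∈ range Nc, algebraMap F _ (H t i) * y ^ i =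
      algebraMap F _ ((r : F) ^ (a + 1))⁻¹ *
        ∑ l ∈ range L, algebraMap F _ (∑ e ∈ range (r ^ (a + 1)),
          (fun e l => if ¬ r ∣ e ∧ l < Nc then Y e l else 0) e ((l + σ * t * e) % L)) * y ^ l := by
    rw [← sum_fold hr0 rfl hgeom, mul_sum]
    refine sum_congr rfl fun i _ => ?_
    rw [hH, map_mul]
    ring
  have hpad : ∀ j, ∑ l ∈ range L, algebraMap F (CycloQuot F r c)
      (if j < m ∧ l < r ^ b then v (r ^ b * j + l) else 0) * y ^ l =
      if j < m then aeval y (blockPoly v (r ^ b) j) else 0 := by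
    intro j
    split_ifs with hj
    · rw [aeval_blockPoly, ← sum_range_ite_lt (show r ^ b ≤ L by omega)]
      refine sum_congr rfl fun l _ => ?_
      simp only [hj, true_and]
      split_ifs <;> simp
    · simp [hj]
  have hvh : ∀ e, ∑ l ∈ range L, algebraMap F (CycloQuot F r c) (∑ j ∈ range (r ^ (a + 1)),
      (fun j l => if j < m ∧ l < r ^ b then v (r ^ b * j + l) else 0) j
        ((l + σ * (L - 1) * e * j) % L)) * y ^ l =
      ∑ j ∈ range m, aeval y (blockPoly v (r ^ b) j) * (y ^ σ) ^ (e * j) := by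
    intro e
    rw [eval_dft hLpos hyL hη (fun j l => if j < m ∧ l < r ^ b then v (r ^ b * j + l) else 0),
      hηL]
    have hmN : m ≤ r ^ (a + 1) := by
      rw [hm, pow_succ']; exact Nat.mul_le_mul_right _ (Nat.sub_le _ _)
    rw [← sum_range_ite_lt hmN]
    refine sum_congr rfl fun j _ => ?_
    rw [hpad]
    split_ifs <;> ring
  have hYe : ∀ e ∈ range (r ^ (a + 1)), ∑ l ∈ range L, algebraMap F (CycloQuot F r c)
      (if ¬ r ∣ e ∧ l < Nc then Y e l else 0) * y ^ l =
      if ¬ r ∣ e then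
        (∑ j ∈ range m, aeval y (blockPoly v (r ^ b) j) * (y ^ σ) ^ (e * j)) *
          ∑ j ∈ range m, aeval y (blockPoly γ (r ^ b) j) * (y ^ σ) ^ (e * j) else 0 := by
    intro e he
    split_ifs with hre
    · simp [hre]
    · rw [← hvh, mul_comm, ← hY e (mem_range.1 he) hre, ← sum_range_ite_lt hNcL]
      refine sum_congr rfl fun l _ => ?_
      simp only [hre, not_false_eq_true, true_and]
      split_ifs <;> simp
  have hinv : algebraMap F (CycloQuot F r c) ((r : F) ^ (a + 1))⁻¹ * (r : CycloQuot F r c) ^ (a + 1)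
      = 1 := by
    rw [← map_natCast (algebraMap F (CycloQuot F r c)), ← map_pow, ← map_mul,
      inv_mul_cancel₀ (pow_ne_zero _ hrF), map_one]
  rw [hfac, eval_dft hLpos hyL hη (fun e l => if ¬ r ∣ e ∧ l < Nc then Y e l else 0)]
  rw [← one_mul (aeval y _), ← hinv, mul_assoc, aeval_cyclicProd hr.out hrF hω hωζ, sum_filter]
  congr 1
  refine sum_congr rfl fun e he => ?_
  rw [hYe e he, mul_comm t e]
  split_ifs <;> simp

/-- Putting the blocks of a product together: neighbouring blocks overlap by one half. -/
theorem sum_overlap {A : Type*} [CommRing A] [Algebra F A] {N s : ℕ} (hN : 0 < N) (hs : 0 < s)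
    {x : A} (hx : (x ^ s) ^ N = 1) (H : ℕ → ℕ → F) :
    ∑ l ∈ range (N * s), algebraMap F A
      (H (l / s) (l % s) + H ((l / s + (N - 1)) % N) (s + l % s)) * x ^ l =
    ∑ t ∈ range N, (∑ i ∈ range (2 * s), algebraMap F A (H t i) * x ^ i) * (x ^ s) ^ t := by
  set z := x ^ s with hz
  set η := z ^ (N - 1) with hη'
  have hη : z * η = 1 := by rw [hη', ← pow_succ', Nat.sub_add_cancel hN, hx]
  have hηN : η ^ (N - 1) = z := by
    have h1 : η ^ N = 1 := by rw [hη', ← pow_mul, mul_comm, pow_mul, hx, one_pow]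
    calc η ^ (N - 1) = η ^ (N - 1) * (z * η) := by rw [hη, mul_one]
      _ = η ^ (N - 1) * η * z := by ring
      _ = z := by rw [← pow_succ, Nat.sub_add_cancel hN, h1, one_mul]
  have h1 : ∑ l ∈ range (N * s), algebraMap F A
      (H (l / s) (l % s) + H ((l / s + (N - 1)) % N) (s + l % s)) * x ^ l =
      ∑ t ∈ range N, (∑ i ∈ range s, algebraMap F A (H t i) * x ^ i) * z ^ t +
      ∑ t ∈ range N, (∑ i ∈ range s, algebraMap F A (H ((t + (N - 1)) % N) (s + i)) * x ^ i) *
        z ^ t := by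
    rw [sum_range_mul_split, ← sum_add_distrib]
    refine sum_congr rfl fun t _ => ?_
    rw [← add_mul, ← sum_add_distrib, sum_mul]
    refine sum_congr rfl fun i hi => ?_
    have hi' := mem_range.1 hi
    rw [Nat.mul_add_div hs, Nat.div_eq_of_lt hi', Nat.mul_add_mod, Nat.mod_eq_of_lt hi', map_add,
      pow_add, pow_mul, add_zero]
    ring
  rw [h1, sum_shift hN hx hη
    (fun t => ∑ i ∈ range s, algebraMap F A (H t (s + i)) * x ^ i) (N - 1), hηN, mul_sum,
    ← sum_add_distrib]
  refine sum_congr rfl fun t _ => ?_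
  rw [two_mul, sum_range_add, add_mul, ← mul_assoc, mul_sum]
  congr 2
  refine sum_congr rfl fun i _ => ?_
  rw [pow_add]
  ring

/-- `MulCost D F r k t`: on elements of `F[X] / Φ`, given by their coordinates, multiplication by
a fixed element can be carried out with `t` operations. -/
def MulCost (D F : Type*) [Field F] (r k t : ℕ) : Prop :=
  ∀ (g : CycloQuot F r k) (V : ℕ → D → F), ∃ O : ℕ → D → F,
    Computes {f | ∃ i < (r - 1) * r ^ k, f = V i} {f | ∃ i < (r - 1) * r ^ k, f = O i} t ∧
    ∀ d, ∑ i ∈ range ((r - 1) * r ^ k), algebraMap F _ (O i d) * CycloQuot.x F r k ^ i =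
      g * ∑ i ∈ range ((r - 1) * r ^ k), algebraMap F _ (V i d) * CycloQuot.x F r k ^ i

variable {D : Type*}

theorem MulCost.mono {r k t t' : ℕ} (h : MulCost D F r k t) (htt' : t ≤ t') :
    MulCost D F r k t' := fun g V =>
  let ⟨O, hO, h'⟩ := h g V
  ⟨O, hO.mono_cost htt', h'⟩

/-- Multiplication by the matrix of `g`. -/
theorem MulCost.naive (r k : ℕ) [hr : Fact r.Prime] :
    MulCost D F r k (((r - 1) * r ^ k) * (2 * ((r - 1) * r ^ k))) := by
  intro g V
  choose w hw using fun j => CycloQuot.exists_repr (g * CycloQuot.x F r k ^ j)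
  refine ⟨fun i d => ∑ j ∈ range ((r - 1) * r ^ k), w j i * V j d, ?_, fun d => ?_⟩
  · have := Computes.family (base := {f | ∃ i < (r - 1) * r ^ k, f = V i})
      (range ((r - 1) * r ^ k))
      (fun i d => ∑ j ∈ range ((r - 1) * r ^ k), w j i * V j d)
      (t := 2 * ((r - 1) * r ^ k)) (fun i _ => by
        simpa using Computes.linear (base := {f | ∃ i < (r - 1) * r ^ k, f = V i})
          (range ((r - 1) * r ^ k)) (fun j => w j i) V
          (fun j hj => ⟨j, mem_range.1 hj, rfl⟩))
    refine (this.mono_cost (by simp)).mono_out ?_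
    rintro _ ⟨i, hi, rfl⟩
    exact ⟨i, mem_range.2 hi, rfl⟩
  · simp_rw [map_sum, sum_mul]
    rw [sum_comm, mul_sum]
    refine sum_congr rfl fun j _ => ?_
    rw [mul_left_comm, hw j, mul_sum]
    refine sum_congr rfl fun i _ => ?_
    rw [map_mul]
    ring

theorem card_filter_not_dvd {r : ℕ} (hr : r.Prime) (a : ℕ) :
    ((range (r ^ (a + 1))).filter (fun e => ¬ r ∣ e)).card = (r - 1) * r ^ a := by
  rw [mul_comm, ← Nat.totient_prime_pow_succ hr, Nat.totient_eq_card_coprime]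
  congr 1
  ext e
  simp only [mem_filter, mem_range, and_congr_right_iff]
  intro _
  rw [Nat.coprime_pow_left_iff (Nat.succ_pos a), hr.coprime_iff_not_dvd]

/-- One level of the Schönhage–Strassen recursion: the multiplicand has `(r - 1) r ^ a` blocks of
length `r ^ b`, and the recursive multiplications take place in the ring with parameter `b + δ`.
Its rank is `2 r ^ b` by the choice of `δ`, so that products of two blocks do not wrap around. -/
theorem MulCost.step {r δ a b t : ℕ} [hr : Fact r.Prime] (hrF : (r : F) ≠ 0)
    (hδ : (r - 1) * r ^ δ = 2) (hab : a ≤ b + δ) (h : MulCost D F r (b + δ) t) :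
    MulCost D F r (a + b)
      (2 * r * (a + 1) * r ^ (a + 1) * r ^ (b + δ + 1) +
        (r - 1) * r ^ a * ((r - 1) * r ^ (b + δ) + t) +
        2 * r * (a + 1) * r ^ (a + 1) * r ^ (b + δ + 1) +
        r ^ (a + 1) * ((r - 1) * r ^ (b + δ)) * 2 + r ^ (a + b + 1) + (r - 1) * r ^ (a + b)) := by
  intro g V
  obtain ⟨γ, hγ⟩ := CycloQuot.exists_repr g
  set c := b + δ with hc
  set y := CycloQuot.x F r c
  set σ := r ^ (c - a) with hσ
  set L := r ^ (c + 1) with hL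
  set N := r ^ (a + 1) with hN
  set s := r ^ b with hs
  set m := (r - 1) * r ^ a with hm
  set Nc := (r - 1) * r ^ c with hNc
  set Nk := (r - 1) * r ^ (a + b) with hNk
  have hr0 : 0 < r := hr.out.pos
  have hr2 : 2 ≤ r := hr.out.two_le
  have hNc2 : Nc = 2 * s := by
    rw [hNc, hc, pow_add, hs, ← hδ]; ring
  have hNkm : Nk = m * s := by rw [hNk, hm, hs, pow_add]; ring
  have hLpos : 0 < L := pow_pos hr0 _
  have hNpos : 0 < N := pow_pos hr0 _
  have hspos : 0 < s := pow_pos hr0 _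
  have hrc : 0 < r ^ c := pow_pos hr0 _
  have hLNc : L = Nc + r ^ c := by
    rw [hL, hNc, pow_succ', ← Nat.succ_mul, Nat.succ_eq_add_one, Nat.sub_add_cancel hr0]
  have hNs : r ^ (a + b + 1) = N * s := by rw [hN, hs, ← pow_add]; congr 1; omega
  have hNk' : r ^ (a + b + 1) = Nk + r ^ (a + b) := by
    rw [hNk, pow_succ', ← Nat.succ_mul, Nat.succ_eq_add_one, Nat.sub_add_cancel hr0]
  have hσN : L ∣ σ * r ^ (a + 1) := by
    rw [hσ, ← pow_add, hL]
    exact pow_dvd_pow r (by omega)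
  have hσN' : L ∣ σ * (L - 1) * r ^ (a + 1) := by
    rw [mul_right_comm]; exact hσN.mul_right _
  -- the blocks of the multiplicand and their transform
  set I : ℕ → ℕ → D → F := fun j l d => if j < m ∧ l < s then V (s * j + l) d else 0 with hI
  set Vh : ℕ → ℕ → D → F := fun e l d =>
    ∑ j ∈ range N, I j ((l + σ * (L - 1) * e * j) % L) d with hVh
  set R : ℕ → ℕ → D → F := fun e i d => Vh e i d - Vh e (Nc + i % r ^ c) d with hR
  choose Y hYc hYe using fun e => h (∑ j ∈ range m, aeval y (blockPoly γ s j) *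
    (y ^ σ) ^ (e * j)) (R e)
  set Yp : ℕ → ℕ → D → F := fun e l d => if ¬ r ∣ e ∧ l < Nc then Y e l d else 0 with hYp
  set Z : ℕ → ℕ → D → F := fun t l d =>
    ∑ e ∈ range N, Yp e ((l + σ * t * e) % L) d with hZ
  set H : ℕ → ℕ → D → F := fun t i d =>
    ((r : F) ^ (a + 1))⁻¹ * (Z t i d - Z t (Nc + i % r ^ c) d) with hH
  set W : ℕ → D → F := fun l d =>
    H (l / s) (l % s) d + H ((l / s + (N - 1)) % N) (s + l % s) d with hW
  refine ⟨fun o d => W o d - W (Nk + o % r ^ (a + b)) d, ?_, fun d => ?_⟩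
  · have c1 : Computes {f | ∃ i < Nk, f = V i} {f | ∃ j < N, ∃ l < L, f = I j l} 0 := by
      refine Computes.of_subset ?_
      rintro _ ⟨j, -, l, -, rfl⟩
      by_cases hjl : j < m ∧ l < s
      · refine .inl ⟨s * j + l, ?_, ?_⟩
        · rw [hNkm]
          calc s * j + l < s * (j + 1) := by rw [mul_add]; omega
            _ ≤ s * m := Nat.mul_le_mul_left _ hjl.1
            _ = m * s := mul_comm _ _
        · ext d; simp [hI, hjl]
      · refine .inr ⟨0, ?_⟩
        ext d; simp [hI, hjl]
    have c2 := c1.trans (computes_dft hr0 hLpos (a + 1) (σ * (L - 1)) I hσN')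
    -- recursive products, needed only at the exponents prime to `r`
    have c3 : Computes {f | ∃ e < N, ∃ l < L, f = Vh e l} {f | ∃ e < N, ∃ l < L, f = Yp e l}
        (m * (Nc + t)) := by
      have : ∀ e ∈ (range N).filter (fun e => ¬ r ∣ e),
          Computes {f | ∃ e < N, ∃ l < L, f = Vh e l} {f | ∃ i < Nc, f = Y e i} (Nc + t) := by
        intro e he
        have he' := mem_range.1 (mem_filter.1 he).1
        have hf := Computes.family (base := {f | ∃ e < N, ∃ l < L, f = Vh e l}) (range Nc)
          (R e) (t := 1) (fun i hi => Computes.sub ⟨e, he', i, by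
            have := mem_range.1 hi; omega, rfl⟩ ⟨e, he', Nc + i % r ^ c, by
            have := Nat.mod_lt i hrc; omega, rfl⟩)
        rw [card_range, mul_one] at hf
        refine (hf.mono_out ?_).trans (hYc e)
        rintro _ ⟨i, hi, rfl⟩
        exact ⟨i, mem_range.2 hi, rfl⟩
      have := Computes.biUnion _ _ _ this
      rw [sum_const, hN, card_filter_not_dvd hr.out, smul_eq_mul] at this
      have h0 := this.trans (Computes.of_subset (out := {f | ∃ e < N, ∃ l < L, f = Yp e l}) ?_)
      · exact h0
      · rintro _ ⟨e, he, l, hl, rfl⟩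
        by_cases hel : ¬ r ∣ e ∧ l < Nc
        · refine .inl ⟨e, mem_filter.2 ⟨mem_range.2 he, hel.1⟩, l, hel.2, ?_⟩
          ext d; simp [hYp, hel]
        · refine .inr ⟨0, ?_⟩
          ext d
          simp only [hYp, if_neg hel, Function.const_apply]
    have c4 := computes_dft hr0 hLpos (a + 1) σ Yp hσN
    -- the inverse transform, of which `H` is the reduction
    have c5 : Computes {f | ∃ t < N, ∃ l < L, f = Z t l} {f | ∃ t < N, ∃ i < Nc, f = H t i}
        (N * Nc * 2) := by
      have := Computes.family (base := {f | ∃ t < N, ∃ l < L, f = Z t l}) (range N ×ˢ range Nc)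
        (fun p => H p.1 p.2) (t := 1 + 1) (by
          rintro ⟨t, i⟩ hp
          rw [mem_product, mem_range, mem_range] at hp
          have hZ1 : Z t i ∈ {f | ∃ t < N, ∃ l < L, f = Z t l} :=
            ⟨t, hp.1, i, by have := hp.2; simp only at this; omega, rfl⟩
          have hZ2 : Z t (Nc + i % r ^ c) ∈ {f | ∃ t < N, ∃ l < L, f = Z t l} :=
            ⟨t, hp.1, _, by have := Nat.mod_lt i hrc; omega, rfl⟩
          exact (Computes.sub hZ1 hZ2).trans (Computes.const_mul _ (Set.mem_singleton _)))
      refine (this.mono_cost (by simp)).mono_out ?_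
      rintro _ ⟨t, ht, i, hi, rfl⟩
      exact ⟨(t, i), by simp [ht, hi], rfl⟩
    -- overlapping blocks are added, and the result is reduced modulo the cyclotomic polynomial
    have c6 : Computes {f | ∃ t < N, ∃ i < Nc, f = H t i} {f | ∃ l ∈ range (N * s), f = W l}
        (r ^ (a + b + 1)) := by
      have := Computes.family (base := {f | ∃ t < N, ∃ i < Nc, f = H t i}) (range (N * s))
        W (t := 1) (fun l hl => Computes.add
          ⟨l / s, Nat.div_lt_of_lt_mul (by rw [mul_comm]; exact mem_range.1 hl), l % s, by
            have := Nat.mod_lt l hspos; omega, rfl⟩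
          ⟨(l / s + (N - 1)) % N, Nat.mod_lt _ hNpos, s + l % s, by
            have := Nat.mod_lt l hspos; omega, rfl⟩)
      exact this.mono_cost (by simp [hNs])
    have c7 : Computes {f | ∃ l ∈ range (N * s), f = W l}
        {f | ∃ o < Nk, f = fun d => W o d - W (Nk + o % r ^ (a + b)) d} Nk := by
      have := Computes.family (base := {f | ∃ l ∈ range (N * s), f = W l}) (range Nk)
        (fun o d => W o d - W (Nk + o % r ^ (a + b)) d) (t := 1) (fun o ho => Computes.sub
          ⟨o, mem_range.2 (by have := mem_range.1 ho; omega), rfl⟩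
          ⟨Nk + o % r ^ (a + b), mem_range.2 (by
            have := Nat.mod_lt o (pow_pos hr0 (a + b)); omega), rfl⟩)
      refine (this.mono_cost (by simp)).mono_out ?_
      rintro _ ⟨o, ho, rfl⟩
      exact ⟨o, mem_range.2 ho, rfl⟩
    exact (((((c2.trans c3).trans c4).trans c5).trans c6).trans c7).mono_cost (by rw [zero_add])
  · set x := CycloQuot.x F r (a + b)
    have hgeomx : ∑ i ∈ range r, x ^ (r ^ (a + b) * i) = 0 := CycloQuot.geom r (a + b)
    have hz : ∑ i ∈ range r, (x ^ s) ^ (r ^ a * i) = 0 := by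
      rw [← hgeomx]
      refine sum_congr rfl fun i _ => ?_
      rw [← pow_mul, ← mul_assoc, hs, ← pow_add, add_comm b a]
    have hzN : (x ^ s) ^ N = 1 := pow_succ_eq_one_of_geom hz
    have hgeomy : ∑ i ∈ range r, y ^ (r ^ c * i) = 0 := CycloQuot.geom r c
    have hHc : ∀ t, ∀ i < Nc, H t i d = (cyclicProd r a m (blockPoly (fun i => V i d) s)
        (blockPoly γ s) t).coeff i := by
      intro t i hi
      refine coeff_cyclicProd_of_dft hrF hδ hab (fun i => V i d) γ (fun e i => Y e i d) ?_
        (fun t i => H t i d) (fun t i => rfl) t hi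
      intro e _ _
      rw [hYe]
      congr 1
      exact sum_fold hr0 rfl hgeomy (fun l => Vh e l d)
    rw [sum_fold hr0 hNs hgeomx (fun l => W l d), sum_overlap hNpos hspos hzN
      (fun t i => H t i d), mul_comm g, hγ, sum_eq_sum_blockPoly γ hNkm x,
      sum_eq_sum_blockPoly (fun i => V i d) hNkm x, ← sum_cyclicProd hr0 hz]
    refine sum_congr rfl fun t _ => ?_
    congr 1
    have hdeg : (cyclicProd r a m (blockPoly (fun i => V i d) s) (blockPoly γ s) t).natDegree <
        2 * s := by
      refine (natDegree_cyclicProd_le (natDegree_blockPoly_le _ s)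
        (natDegree_blockPoly_le γ s) t).trans_lt ?_
      omega
    rw [aeval_eq_sum_range' hdeg]
    refine sum_congr rfl fun i hi => ?_
    rw [hHc t i (by rw [hNc2]; exact mem_range.1 hi), Algebra.smul_def]

end MulStep

/-! ### Fast multiplication by Toeplitz matrices -/

section Toeplitz

open Finset Polynomial

variable {D F : Type*} [Field F]

/-- A function of order `u log u`, which solves the recurrence of `logFactor_half`, to which the
Schönhage–Strassen recursion leads. -/
def logFactor (u : ℕ) : ℕ := u * Nat.log 2 u + 2 * u + 1

theorem logFactor_mono : Monotone logFactor := by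
  intro u v h
  have := Nat.mul_le_mul h (Nat.log_mono_right (b := 2) h)
  simp only [logFactor]
  omega

theorem logFactor_half {u : ℕ} (hu : 2 ≤ u) : 2 * logFactor (u / 2) + (u - 1) ≤ logFactor u := by
  have h1 : Nat.log 2 u = Nat.log 2 (u / 2) + 1 := by
    rw [Nat.log_div_base, Nat.sub_add_cancel (Nat.log_pos one_lt_two hu)]
  simp only [logFactor, h1]
  have h2 : 2 * (u / 2) ≤ u := Nat.mul_div_le u 2
  have h3 := Nat.mul_le_mul_right (Nat.log 2 (u / 2)) h2
  rw [mul_add]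
  nlinarith [Nat.sub_add_cancel (show 1 ≤ u by omega)]

/-- The Schönhage–Strassen bound: a level of the recursion halves the exponent `k` and doubles the
number of coordinates, at the cost of `O(k)` operations per coordinate. -/
theorem MulCost.fast {r δ : ℕ} [hr : Fact r.Prime] (hrF : (r : F) ≠ 0)
    (hδ : (r - 1) * r ^ δ = 2) (hr3 : r ≤ 3) (hδ1 : δ ≤ 1) (hrδ : r ^ (2 + δ) ≤ 9) (k : ℕ) :
    MulCost D F r k ((r - 1) * r ^ k * (400 * logFactor (k - 3))) := by
  have hr0 : 0 < r := hr.out.pos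
  have hr2 : 2 ≤ r := hr.out.two_le
  induction k using Nat.strong_induction_on with
  | _ k ih =>
  -- the recursion passes from `k` to `k - k / 2 + δ`, which is less than `k` for `k ≥ 4`; the shift
  -- in `logFactor (k - 3)` absorbs `δ` and the rounding
  rcases Nat.lt_or_ge k 4 with hk | hk
  · refine (MulCost.naive r k).mono (Nat.mul_le_mul_left _ ?_)
    have h1 : r ^ k ≤ 3 ^ 3 :=
      (Nat.pow_le_pow_left hr3 k).trans (Nat.pow_le_pow_right (by norm_num) (by omega))
    have h2 : (r - 1) * r ^ k ≤ 2 * 3 ^ 3 := Nat.mul_le_mul (by omega) h1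
    have h3 : logFactor (k - 3) = 1 := by
      rw [show k - 3 = 0 by omega]; rfl
    rw [h3]
    omega
  · obtain ⟨a, ha⟩ : ∃ a, a = k / 2 := ⟨_, rfl⟩
    obtain ⟨b, hb⟩ : ∃ b, b = k - k / 2 := ⟨_, rfl⟩
    have hk' : k = a + b := by omega
    have hstep := MulCost.step hrF hδ (a := a) (b := b) (by omega) (ih (b + δ) (by omega))
    rw [← hk'] at hstep
    refine hstep.mono ?_
    set p := r ^ k with hp
    have hpp : p = r ^ a * r ^ b := by rw [hp, hk', pow_add]
    have hc : (r - 1) * r ^ (b + δ) = 2 * r ^ b := by rw [pow_add, ← hδ]; ring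
    have hβ : logFactor (b + δ - 3) ≤ logFactor ((k - 3) / 2) := logFactor_mono (by omega)
    have e1 : 2 * r * (a + 1) * r ^ (a + 1) * r ^ (b + δ + 1) ≤ 54 * (a + 1) * p := by
      have : 2 * r * (a + 1) * r ^ (a + 1) * r ^ (b + δ + 1) =
          (r * r ^ (2 + δ)) * (2 * (a + 1) * p) := by rw [hpp]; ring
      rw [this]
      calc _ ≤ (3 * 9) * (2 * (a + 1) * p) :=
            Nat.mul_le_mul_right _ (Nat.mul_le_mul hr3 hrδ)
        _ = _ := by ring
    have e2 : (r - 1) * r ^ a * ((r - 1) * r ^ (b + δ) +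
        (r - 1) * r ^ (b + δ) * (400 * logFactor (b + δ - 3))) ≤
        (r - 1) * p * (2 + 2 * (400 * logFactor ((k - 3) / 2))) := by
      rw [hc, hpp]
      calc _ = (r - 1) * (r ^ a * r ^ b) * (2 + 2 * (400 * logFactor (b + δ - 3))) := by ring
        _ ≤ _ := Nat.mul_le_mul_left _ (by omega)
    have e3 : r ^ (a + 1) * ((r - 1) * r ^ (b + δ)) * 2 ≤ 12 * p := by
      rw [hc, hpp]
      calc r ^ (a + 1) * (2 * r ^ b) * 2 = r * (4 * (r ^ a * r ^ b)) := by ring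
        _ ≤ 3 * (4 * (r ^ a * r ^ b)) := Nat.mul_le_mul_right _ hr3
        _ = _ := by ring
    have e4 : r ^ (k + 1) ≤ 3 * p := by
      rw [pow_succ']; exact Nat.mul_le_mul_right _ hr3
    have hpN : p ≤ (r - 1) * p := Nat.le_mul_of_pos_left _ (by omega)
    have hfin : 108 * (a + 1) + 18 + 2 * (400 * logFactor ((k - 3) / 2)) ≤
        400 * logFactor (k - 3) := by
      rcases Nat.lt_or_ge (k - 3) 2 with h1 | h1
      · have : k - 3 = 1 := by omega
        rw [this]
        have h2 : logFactor (1 / 2) = 1 := rfl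
        have h3 : logFactor 1 = 3 := by simp [logFactor]
        rw [h2, h3]
        omega
      · have := logFactor_half h1
        omega
    have e0 : 108 * (a + 1) * p ≤ 108 * (a + 1) * ((r - 1) * p) := Nat.mul_le_mul_left _ hpN
    calc _ ≤ 108 * (a + 1) * ((r - 1) * p) +
          (r - 1) * p * (2 + 2 * (400 * logFactor ((k - 3) / 2))) + 15 * ((r - 1) * p) +
          (r - 1) * p := by linarith
      _ = (r - 1) * p * (108 * (a + 1) + 18 + 2 * (400 * logFactor ((k - 3) / 2))) := by ring
      _ ≤ _ := Nat.mul_le_mul_left _ hfin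

/-- The cost per coefficient of a multiplication of polynomials with `n` coefficients. -/
def mulFactor (n : ℕ) : ℕ := 7200 * logFactor (Nat.log 2 n)

theorem mulFactor_mono : Monotone mulFactor := fun _ _ h =>
  Nat.mul_le_mul_left _ (logFactor_mono (Nat.log_mono_right h))

/-- A Toeplitz product consists of `n` consecutive coefficients of the product of a polynomial of
degree less than `2 n`, formed from the matrix, and one of degree less than `n`, formed from the
vector. It is computed in a cyclotomic quotient of rank between `3 n` and `18 n`. -/
theorem computes_toeplitz_aux {r δ : ℕ} [hr : Fact r.Prime] (hrF : (r : F) ≠ 0)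
    (hδ : (r - 1) * r ^ δ = 2) (hr3 : r ≤ 3) (hδ1 : δ ≤ 1) (hrδ : r ^ (2 + δ) ≤ 9) {n : ℕ}
    (hn : 0 < n) (t : ℤ → F) (I : ℕ → D → F) :
    Computes {f | ∃ j < n, f = I j}
      {f | ∃ i < n, f = fun d => ∑ j ∈ range n, t ((i : ℤ) - j) * I j d} (n * mulFactor n) := by
  have hr2 : 2 ≤ r := hr.out.two_le
  set k := Nat.clog r (3 * n) with hk
  set N := (r - 1) * r ^ k with hN
  have h1 : 3 * n ≤ r ^ k := Nat.le_pow_clog hr2 _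
  have h2 : 3 * n ≤ N := h1.trans (Nat.le_mul_of_pos_left _ (by omega))
  have h3 : r ^ (k - 1) < 3 * n := Nat.pow_pred_clog_lt_self hr2 (by omega)
  have hk1 : 1 ≤ k := by
    by_contra! h
    have : k = 0 := by omega
    rw [this, pow_zero] at h1
    omega
  have hkl : k ≤ Nat.log 2 n + 3 := by
    have h4 : 2 ^ (k - 1) < 2 ^ (Nat.log 2 n + 3) := by
      calc 2 ^ (k - 1) ≤ r ^ (k - 1) := Nat.pow_le_pow_left hr2 _
        _ < 3 * n := h3
        _ < 3 * 2 ^ (Nat.log 2 n + 1) := by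
          have := Nat.lt_pow_succ_log_self one_lt_two n
          omega
        _ ≤ 2 ^ (Nat.log 2 n + 3) := by rw [pow_succ, pow_add]; omega
    have := (Nat.pow_lt_pow_iff_right one_lt_two).1 h4
    omega
  have hNn : N ≤ 18 * n := by
    have : r ^ k = r * r ^ (k - 1) := by rw [← pow_succ', Nat.sub_add_cancel hk1]
    rw [hN, this]
    calc (r - 1) * (r * r ^ (k - 1)) ≤ 2 * (3 * (3 * n)) :=
          Nat.mul_le_mul (by omega) (Nat.mul_le_mul hr3 h3.le)
      _ = 18 * n := by ring
  set G : F[X] := ∑ u ∈ range (2 * n), C (t ((u : ℤ) - (n - 1))) * X ^ u with hG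
  have hGc : ∀ u < 2 * n, G.coeff u = t ((u : ℤ) - (n - 1)) := by
    intro u hu
    simp [hG, coeff_X_pow, hu]
  have hGdeg : G.natDegree ≤ 2 * n - 1 := by
    refine natDegree_sum_le_of_forall_le _ _ fun u hu => ?_
    refine (natDegree_C_mul_X_pow_le _ _).trans ?_
    have := mem_range.1 hu
    omega
  obtain ⟨O, hO, hOe⟩ := MulCost.fast hrF hδ hr3 hδ1 hrδ k (aeval (CycloQuot.x F r k) G)
    (fun j d => if j < n then I j d else 0)
  have hpad : Computes {f | ∃ j < n, f = I j}
      {f : D → F | ∃ j < N, f = fun d => if j < n then I j d else 0} 0 := by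
    refine Computes.of_subset ?_
    rintro _ ⟨j, -, rfl⟩
    by_cases hj : j < n
    · exact .inl ⟨j, hj, by simp [hj]⟩
    · exact .inr ⟨0, by ext; simp [hj]⟩
  refine ((hpad.trans hO).mono_cost ?_).mono_out ?_
  · rw [zero_add]
    calc N * (400 * logFactor (k - 3)) ≤ 18 * n * (400 * logFactor (Nat.log 2 n)) :=
          Nat.mul_le_mul hNn (Nat.mul_le_mul_left _ (logFactor_mono (by omega)))
      _ = n * mulFactor n := by rw [mulFactor]; ring
  · rintro _ ⟨i, hi, rfl⟩
    refine ⟨n - 1 + i, by omega, ?_⟩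
    ext d
    set p : F[X] := ∑ j ∈ range n, C (I j d) * (G * X ^ j) with hp
    have hpdeg : p.natDegree < N := by
      refine (natDegree_sum_le_of_forall_le (n := 3 * n - 2) _ _ fun j hj => ?_).trans_lt
        (by omega)
      refine (natDegree_C_mul_le _ _).trans (natDegree_mul_le.trans ?_)
      rw [natDegree_X_pow]
      have := mem_range.1 hj
      omega
    have hev : ∑ i ∈ range N, algebraMap F _ (O i d) * CycloQuot.x F r k ^ i =
        aeval (CycloQuot.x F r k) p := by
      rw [hOe]
      have hnN : n ≤ N := by omega
      have : ∑ j ∈ range N, algebraMap F (CycloQuot F r k) (if j < n then I j d else 0) *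
          CycloQuot.x F r k ^ j =
          ∑ j ∈ range n, algebraMap F (CycloQuot F r k) (I j d) * CycloQuot.x F r k ^ j := by
        rw [← sum_range_ite_lt hnN]
        refine sum_congr rfl fun j _ => ?_
        split_ifs <;> simp
      rw [this, hp, map_sum (aeval (CycloQuot.x F r k)) (fun j => C (I j d) * (G * X ^ j)),
        mul_sum]
      refine sum_congr rfl fun j _ => ?_
      simp only [map_mul, aeval_C, map_pow, aeval_X]
      ring
    rw [CycloQuot.coeff_eq hpdeg hev (i := n - 1 + i) (by omega), hp, finsetSum_coeff]
    refine sum_congr rfl fun j hj => ?_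
    have hj' := mem_range.1 hj
    rw [coeff_C_mul, coeff_mul_X_pow', if_pos (by omega), hGc _ (by omega), mul_comm]
    congr 2
    omega

/-- Fast multiplication by a fixed Toeplitz matrix. In characteristic `2`, transforms of length
`3 ^ k` replace those of length `2 ^ k`. -/
theorem computes_toeplitz (n : ℕ) (t : ℤ → F) (I : ℕ → D → F) :
    Computes {f | ∃ j < n, f = I j}
      {f | ∃ i < n, f = fun d => ∑ j ∈ range n, t ((i : ℤ) - j) * I j d} (n * mulFactor n) := by
  rcases Nat.eq_zero_or_pos n with rfl | hn
  · refine (Computes.of_subset ?_).mono_cost (Nat.zero_le _)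
    rintro _ ⟨i, hi, -⟩
    exact absurd hi (Nat.not_lt_zero i)
  · by_cases h2 : (2 : F) = 0
    · have h3 : ((3 : ℕ) : F) ≠ 0 := by
        have : ((3 : ℕ) : F) = 2 + 1 := by norm_num
        rw [this, h2, zero_add]
        exact one_ne_zero
      have : Fact (Nat.Prime 3) := ⟨Nat.prime_three⟩
      exact computes_toeplitz_aux (r := 3) (δ := 0) h3 (by norm_num) le_rfl (by norm_num)
        (by norm_num) hn t I
    · have : Fact (Nat.Prime 2) := ⟨Nat.prime_two⟩
      exact computes_toeplitz_aux (r := 2) (δ := 1) (by exact_mod_cast h2) (by norm_num)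
        (by norm_num) le_rfl (by norm_num) hn t I

end Toeplitz

/-! ### Product trees and remainder trees -/

section Trees

open Finset Polynomial

theorem natDegree_prod_le_sum {F ι : Type*} [Field F] {Λ : Finset ι} {P : ι → F[X]} {s : ι → ℕ}
    (h : ∀ l ∈ Λ, (P l).natDegree ≤ s l) : (∏ l ∈ Λ, P l).natDegree ≤ ∑ l ∈ Λ, s l :=
  (natDegree_prod_le _ _).trans (sum_le_sum h)

variable {D F ι : Type*} [Field F] [DecidableEq ι]

theorem exists_halves {Λ : Finset ι} {h : ℕ} (hΛ : Λ.card ≤ 2 ^ (h + 1)) :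
    ∃ Λ₁ Λ₂ : Finset ι, Disjoint Λ₁ Λ₂ ∧ Λ₁ ∪ Λ₂ = Λ ∧ Λ₁.card ≤ 2 ^ h ∧ Λ₂.card ≤ 2 ^ h := by
  obtain ⟨Λ₁, h1, h2⟩ := exists_subset_card_eq (min_le_left Λ.card (2 ^ h))
  refine ⟨Λ₁, Λ \ Λ₁, disjoint_sdiff, union_sdiff_of_subset h1, by omega, ?_⟩
  rw [card_sdiff_of_subset h1, h2]
  rw [pow_succ] at hΛ
  omega

theorem prod_erase_union {M : Type*} [CommMonoid M] {Λ₁ Λ₂ : Finset ι} (h : Disjoint Λ₁ Λ₂)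
    (P : ι → M) {l : ι} (hl : l ∈ Λ₁) :
    ∏ l' ∈ (Λ₁ ∪ Λ₂).erase l, P l' = (∏ l' ∈ Λ₁.erase l, P l') * ∏ l' ∈ Λ₂, P l' := by
  have hl2 : l ∉ Λ₂ := Finset.disjoint_left.1 h hl
  rw [erase_union_distrib, erase_eq_of_notMem hl2, prod_union]
  exact h.mono_left (erase_subset _ _)

/-- A remainder tree without divisions. The remainders of `U` modulo the polynomials `P l` are
described by the values `Φ (U * X ^ i * ∏ l' ≠ l, P l')`, for a linear functional `Φ` that
vanishes on the multiples of `∏ l, P l`. In going to one half of the polynomials, the functional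
is multiplied by the product of the other half, which is a Toeplitz matrix-vector product. -/
theorem computes_remainderTree {N : ℕ} {P : ι → F[X]} {s : ι → ℕ}
    (hP : ∀ l, (P l).natDegree ≤ s l) (h : ℕ) :
    ∀ Λ : Finset ι, Λ.card ≤ 2 ^ h → ∑ l ∈ Λ, s l ≤ N → ∀ Ψ : D → F[X] →ₗ[F] F,
      Computes {f | ∃ j < ∑ l ∈ Λ, s l, f = fun d => Ψ d (X ^ j)}
        {f | ∃ l ∈ Λ, ∃ i < s l, f = fun d => Ψ d (X ^ i * ∏ l' ∈ Λ.erase l, P l')}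
        (h * (2 * (∑ l ∈ Λ, s l) * mulFactor N)) := by
  induction h with
  | zero =>
    intro Λ hΛ _ Ψ
    refine (Computes.of_subset ?_).mono_cost (Nat.zero_le _)
    rintro _ ⟨l, hl, i, hi, rfl⟩
    have : Λ = {l} := by
      rw [pow_zero, card_le_one] at hΛ
      exact eq_singleton_iff_unique_mem.2 ⟨hl, fun m hm => hΛ m hm l hl⟩
    subst this
    exact .inl ⟨i, by simpa using hi, by simp⟩
  | succ h ih =>
    intro Λ hΛ hN Ψ
    obtain ⟨Λ₁, Λ₂, hdis, rfl, h1, h2⟩ := exists_halves hΛ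
    set n := ∑ l ∈ Λ₁ ∪ Λ₂, s l with hn
    have hsum : n = ∑ l ∈ Λ₁, s l + ∑ l ∈ Λ₂, s l := by rw [hn, sum_union hdis]
    -- one half of the step, stated for both halves
    have half : ∀ Λa Λb : Finset ι, n = ∑ l ∈ Λa, s l + ∑ l ∈ Λb, s l → Λa.card ≤ 2 ^ h →
        Disjoint Λa Λb →
        Computes {f | ∃ j < n, f = fun d => Ψ d (X ^ j)}
          {f | ∃ l ∈ Λa, ∃ i < s l,
            f = fun d => Ψ d (X ^ i * ∏ l' ∈ (Λa ∪ Λb).erase l, P l')}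
          (n * mulFactor N + h * (2 * (∑ l ∈ Λa, s l) * mulFactor N)) := by
      intro Λa Λb hab ha hd
      set Q := ∏ l ∈ Λb, P l with hQ
      have hQd : Q.natDegree ≤ ∑ l ∈ Λb, s l := natDegree_prod_le_sum fun l _ => hP l
      have hrec := ih Λa ha (by omega) (fun d => (Ψ d).comp (LinearMap.mulRight F Q))
      have hT := computes_toeplitz n
        (fun z => if z ≤ 0 then Q.coeff (-z).toNat else 0) (fun j d => Ψ d (X ^ j))
      have hT' := hT.mono_cost (Nat.mul_le_mul_left n (mulFactor_mono (show n ≤ N by omega)))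
      refine ((hT'.mono_out ?_).trans hrec).mono_out ?_
      · rintro _ ⟨i, hi, rfl⟩
        refine ⟨i, by omega, ?_⟩
        ext d
        have hdeg : (X ^ i * Q).natDegree < n := by
          refine natDegree_mul_le.trans_lt ?_
          rw [natDegree_X_pow]
          omega
        rw [LinearMap.comp_apply, LinearMap.mulRight_apply, as_sum_range' _ n hdeg, map_sum]
        refine sum_congr rfl fun j _ => ?_
        rw [← C_mul_X_pow_eq_monomial, ← smul_eq_C_mul, map_smul, smul_eq_mul, coeff_X_pow_mul']
        congr 1
        by_cases hij : i ≤ j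
        · rw [if_pos hij, if_pos (by omega)]
          congr 1
          omega
        · rw [if_neg hij, if_neg (by omega)]
      · rintro _ ⟨l, hl, i, hi, rfl⟩
        refine ⟨l, hl, i, hi, ?_⟩
        ext d
        rw [prod_erase_union hd P hl, LinearMap.comp_apply, LinearMap.mulRight_apply, mul_assoc]
    have e1 := half Λ₁ Λ₂ hsum h1 hdis
    have e2 := half Λ₂ Λ₁ (by omega) h2 hdis.symm
    refine ((e1.union e2).mono_cost ?_).mono_out ?_
    · rw [hsum]; apply le_of_eq; ring
    · rintro _ ⟨l, hl, i, hi, rfl⟩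
      rcases mem_union.1 hl with hl | hl
      · exact .inl ⟨l, hl, i, hi, rfl⟩
      · exact .inr ⟨l, hl, i, hi, by rw [union_comm]⟩

/-- Linear combinations of the products `∏ l' ≠ l, P l'`, as they occur in Lagrange's
interpolation formula. -/
noncomputable def combination (P : ι → F[X]) (Λ : Finset ι) (w : ι → F) : F[X] :=
  ∑ l ∈ Λ, C (w l) * ∏ l' ∈ Λ.erase l, P l'

theorem combination_union (P : ι → F[X]) {Λ₁ Λ₂ : Finset ι} (h : Disjoint Λ₁ Λ₂) (w : ι → F) :
    combination P (Λ₁ ∪ Λ₂) w =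
      combination P Λ₁ w * ∏ l ∈ Λ₂, P l + combination P Λ₂ w * ∏ l ∈ Λ₁, P l := by
  simp only [combination]
  rw [sum_union h, sum_mul, sum_mul]
  congr 1
  · exact sum_congr rfl fun l hl => by rw [prod_erase_union h P hl, mul_assoc]
  · exact sum_congr rfl fun l hl => by
      rw [union_comm, prod_erase_union h.symm P hl, mul_assoc]

theorem coeff_combination_eq_zero {P : ι → F[X]} (hP : ∀ l, (P l).natDegree ≤ 1) {Λ : Finset ι}
    (w : ι → F) {i : ℕ} (hi : Λ.card ≤ i) : (combination P Λ w).coeff i = 0 := by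
  rw [combination, finsetSum_coeff]
  refine sum_eq_zero fun l hl => ?_
  rw [coeff_C_mul, coeff_eq_zero_of_natDegree_lt, mul_zero]
  refine (natDegree_prod_le_sum (s := fun _ => 1) fun l _ => hP l).trans_lt ?_
  have := card_pos.2 ⟨l, hl⟩
  rw [sum_const, card_erase_of_mem hl, smul_eq_mul]
  omega

/-- Multiplication of a polynomial by a fixed one, up to the coefficient `n - 1`. The coefficients
may be constants, as zeros are when `V` is padded. -/
theorem computes_coeff_mul {N n : ℕ} (hn : n ≤ N) (Q : F[X]) (V : D → F[X])
    {base : Set (D → F)}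
    (hV : ∀ j < n, (fun d => (V d).coeff j) ∈ base ∪ Set.range (Function.const D)) :
    Computes base {f | ∃ i < n, f = fun d => (V d * Q).coeff i} (n * mulFactor N) := by
  have h0 : Computes base {f | ∃ j < n, f = fun d => (V d).coeff j} 0 := by
    refine Computes.of_subset ?_
    rintro _ ⟨j, hj, rfl⟩
    exact hV j hj
  have hT := computes_toeplitz n (fun z => if 0 ≤ z then Q.coeff z.toNat else 0)
    (fun j d => (V d).coeff j)
  refine ((h0.trans hT).mono_cost ?_).mono_out ?_
  · rw [zero_add]; exact Nat.mul_le_mul_left _ (mulFactor_mono hn)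
  · rintro _ ⟨i, hi, rfl⟩
    refine ⟨i, hi, ?_⟩
    ext d
    rw [coeff_mul, Nat.sum_antidiagonal_eq_sum_range_succ_mk]
    have hsub : range (i + 1) ⊆ range n := range_subset_range.2 (by omega)
    rw [← sum_subset hsub]
    · refine sum_congr rfl fun j hj => ?_
      have hj' := mem_range.1 hj
      rw [if_pos (by omega), mul_comm]
      congr 2
      omega
    · intro j _ hj
      rw [mem_range] at hj
      rw [if_neg (by omega), zero_mul]

/-- The product tree: the coefficients of a combination of products of linear factors. -/
theorem computes_combination {N : ℕ} {P : ι → F[X]} (hP : ∀ l, (P l).natDegree ≤ 1)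
    (w : ι → D → F) (h : ℕ) :
    ∀ Λ : Finset ι, Λ.card ≤ 2 ^ h → Λ.card ≤ N →
      Computes {f | ∃ l ∈ Λ, f = w l}
        {f | ∃ i < Λ.card, f = fun d => (combination P Λ fun l => w l d).coeff i}
        (h * (3 * Λ.card * mulFactor N)) := by
  have hm : 1 ≤ mulFactor N := by
    have : 1 ≤ logFactor (Nat.log 2 N) := Nat.le_add_left _ _
    rw [mulFactor]
    omega
  induction h with
  | zero =>
    intro Λ hΛ _
    refine (Computes.of_subset ?_).mono_cost (Nat.zero_le _)
    rintro _ ⟨i, hi, rfl⟩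
    rw [pow_zero] at hΛ
    obtain ⟨l, rfl⟩ := card_eq_one.1 (show Λ.card = 1 by omega)
    have : i = 0 := by rw [card_singleton] at hi; omega
    subst this
    exact .inl ⟨l, by simp, by ext d; simp [combination]⟩
  | succ h ih =>
    intro Λ hΛ hN
    obtain ⟨Λ₁, Λ₂, hdis, rfl, h1, h2⟩ := exists_halves hΛ
    set n := (Λ₁ ∪ Λ₂).card with hn
    have hcard : n = Λ₁.card + Λ₂.card := card_union_of_disjoint hdis
    have half : ∀ (Λa : Finset ι) (Q : F[X]), Λa ⊆ Λ₁ ∪ Λ₂ → Λa.card ≤ 2 ^ h → Λa.card ≤ n →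
        Computes {f | ∃ l ∈ Λ₁ ∪ Λ₂, f = w l}
          {f | ∃ i < n, f = fun d => (combination P Λa (fun l => w l d) * Q).coeff i}
          (h * (3 * Λa.card * mulFactor N) + n * mulFactor N) := by
      intro Λa Q hsub ha han
      have e1 := (ih Λa ha (by omega)).mono_base (base' := {f | ∃ l ∈ Λ₁ ∪ Λ₂, f = w l}) (by
        rintro _ ⟨l, hl, rfl⟩; exact ⟨l, hsub hl, rfl⟩)
      refine e1.trans (computes_coeff_mul hN Q _ fun j _ => ?_)
      by_cases hj : j < Λa.card
      · exact .inl ⟨j, hj, rfl⟩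
      · exact .inr ⟨0, by ext d; simp [coeff_combination_eq_zero hP _ (not_lt.1 hj)]⟩
    have e1 := half Λ₁ (∏ l ∈ Λ₂, P l) subset_union_left h1 (by omega)
    have e2 := half Λ₂ (∏ l ∈ Λ₁, P l) subset_union_right h2 (by omega)
    have e3 := (e1.union e2).trans (Computes.family (range n) (fun i d =>
      (combination P Λ₁ (fun l => w l d) * ∏ l ∈ Λ₂, P l).coeff i +
      (combination P Λ₂ (fun l => w l d) * ∏ l ∈ Λ₁, P l).coeff i) (t := 1) fun i hi =>
        Computes.add (.inl ⟨i, mem_range.1 hi, rfl⟩) (.inr ⟨i, mem_range.1 hi, rfl⟩))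
    refine (e3.mono_cost ?_).mono_out ?_
    · rw [card_range, mul_one]
      have : n ≤ n * mulFactor N := Nat.le_mul_of_pos_right _ hm
      calc _ ≤ h * (3 * Λ₁.card * mulFactor N) + n * mulFactor N +
            (h * (3 * Λ₂.card * mulFactor N) + n * mulFactor N) + n * mulFactor N := by omega
        _ = _ := by rw [hcard]; ring
    · rintro _ ⟨i, hi, rfl⟩
      refine ⟨i, mem_range.2 hi, ?_⟩
      ext d
      rw [combination_union P hdis, coeff_add]

/-! ### Recovering the local data of an interpolated polynomial -/

/-- The interpolation polynomial is a linear combination as computed by `computes_combination`. -/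
theorem eq_combination {W : Finset ι} {x : ι → F} (hx : Set.InjOn x W) {U : F[X]}
    (hU : U.degree < W.card) :
    U = combination (fun k => X - C (x k)) W
      (fun k => (∏ k' ∈ W.erase k, (x k - x k'))⁻¹ * U.eval (x k)) := by
  conv_lhs => rw [Lagrange.eq_interpolate hx hU]
  rw [Lagrange.interpolate_apply, combination]
  refine sum_congr rfl fun k _ => ?_
  rw [Lagrange.basis, C_mul, mul_comm (C _) (C (U.eval (x k))), mul_assoc]
  congr 1
  simp only [Lagrange.basisDivisor, prod_mul_distrib]
  congr 1
  rw [← map_prod, prod_inv_distrib]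

/-- The coefficient of `1 / X` in the expansion of `p / G` at infinity. -/
noncomputable def residueForm (G : F[X]) : F[X] →ₗ[F] F :=
  (lcoeff F (G.natDegree - 1)).comp (modByMonicHom G)

/-- The bilinear form given by `residueForm` is nondegenerate modulo every monic factor. -/
theorem dvd_of_residueForm {P Q U : F[X]} (hP : P.Monic) (hQ : Q.Monic)
    (h : ∀ i < P.natDegree, residueForm (P * Q) (U * (X ^ i * Q)) = 0) : P ∣ U := by
  rw [← modByMonic_eq_zero_iff_dvd hP]
  by_contra hV
  set V := U %ₘ P with hVdef
  have hPQ : (P * Q).Monic := hP.mul hQ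
  have hP1 : P ≠ 1 := by rintro rfl; exact hV (by rw [hVdef, modByMonic_one])
  have hVd : V.natDegree < P.natDegree := natDegree_modByMonic_lt U hP hP1
  set i := P.natDegree - 1 - V.natDegree with hi
  have hmod : U * (X ^ i * Q) %ₘ (P * Q) = V * (X ^ i * Q) := by
    have hdeg : (V * (X ^ i * Q)).degree < (P * Q).degree := by
      refine degree_lt_degree ?_
      rw [hP.natDegree_mul hQ]
      refine natDegree_mul_le.trans_lt ?_
      have := natDegree_mul_le (p := (X : F[X]) ^ i) (q := Q)
      rw [natDegree_X_pow] at this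
      omega
    rw [← (modByMonic_eq_self_iff hPQ).2 hdeg]
    refine modByMonic_eq_of_dvd_sub hPQ ?_
    refine ⟨(U /ₘ P) * X ^ i, ?_⟩
    rw [← sub_mul]
    have : U - V = P * (U /ₘ P) := by
      rw [hVdef, sub_eq_iff_eq_add', modByMonic_add_div U P]
    rw [this]
    ring
  -- for this `i`, the form extracts the leading coefficient of the remainder `V`
  have h0 := h i (by omega)
  rw [residueForm, LinearMap.comp_apply, modByMonicHom_apply, hmod, lcoeff_apply] at h0
  have hXQ : (X ^ i * Q : F[X]).Monic := (monic_X_pow i).mul hQ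
  have hd : (V * (X ^ i * Q)).natDegree = (P * Q).natDegree - 1 := by
    rw [natDegree_mul' (by rw [hXQ.leadingCoeff, mul_one]; exact leadingCoeff_ne_zero.2 hV),
      (monic_X_pow i).natDegree_mul hQ, natDegree_X_pow, hP.natDegree_mul hQ]
    omega
  rw [← hd, coeff_natDegree, leadingCoeff_mul, hXQ.leadingCoeff, mul_one] at h0
  exact hV (leadingCoeff_eq_zero.1 h0)

end Trees

/-! ### Fast linear decoding -/

section Pipeline

open Finset Polynomial

variable {D F : Type*} [Field F]

/-- A linear form is a combination of the forms whose common kernel it vanishes on. -/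
theorem exists_coeff_of_ker_le {V : Type*} [AddCommGroup V] [Module F V] {s : ℕ}
    (L : ℕ → V →ₗ[F] F) (g : V →ₗ[F] F) (h : ∀ v, (∀ i < s, L i v = 0) → g v = 0) :
    ∃ w : ℕ → F, ∀ v, g v = ∑ i ∈ range s, w i * L i v := by
  have hmem : g ∈ Submodule.span F (Set.range fun i : Fin s => L i) := by
    refine mem_span_of_iInf_ker_le_ker fun v hv => ?_
    rw [Submodule.mem_iInf] at hv
    exact h v fun i hi => hv ⟨i, hi⟩
  obtain ⟨c, hc⟩ := (Submodule.mem_span_range_iff_exists_fun F).1 hmem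
  refine ⟨fun i => if h : i < s then c ⟨i, h⟩ else 0, fun v => ?_⟩
  rw [← hc, LinearMap.sum_apply, ← Fin.sum_univ_eq_sum_range
    (fun i => (if h : i < s then c ⟨i, h⟩ else 0) * L i v)]
  exact sum_congr rfl fun i _ => by simp

/-- The cost, per coefficient, of an interpolation at `n` points and of a remainder tree. -/
def treeFactor (n : ℕ) : ℕ := 7 * (Nat.log 2 n + 1) * mulFactor n

/-- Fast linear decoding. A polynomial `U = ∑ c t • E t` of degree less than `|W|` is given by its
values at the points `x k`, and those unknowns `c t` are to be found which are determined by the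
remainder of `U` modulo one of the polynomials `P l`. The values are given up to the known factors
`a k`. -/
theorem exists_linear_decoding {κ ι τ : Type*} [DecidableEq κ] [DecidableEq ι] [Fintype τ]
    {W : Finset κ} {x : κ → F} (hx : Set.InjOn x W) (a : κ → F) {Λ : Finset ι} {P : ι → F[X]}
    (hP : ∀ l, (P l).Monic) {N : ℕ} (hW : W.card ≤ N) (hM : ∑ l ∈ Λ, (P l).natDegree ≤ N)
    (hΛ : ∀ l ∈ Λ, 0 < (P l).natDegree) (E : τ → F[X]) (hE : ∀ t, (E t).degree < W.card)
    (target : ι → Finset τ)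
    (hker : ∀ l ∈ Λ, ∀ c : τ → F, P l ∣ ∑ t, C (c t) * E t → ∀ t ∈ target l, c t = 0)
    (v : κ → D → F) :
    ∃ z : ι → τ → D → F,
      Computes {f | ∃ k ∈ W, f = v k} {f | ∃ l ∈ Λ, ∃ t ∈ target l, f = z l t}
        (N * treeFactor N + ∑ l ∈ Λ, (target l).card * (2 * (P l).natDegree)) ∧
      ∀ d (c : τ → F), (∀ k ∈ W, a k * v k d = (∑ t, C (c t) * E t).eval (x k)) →
        ∀ l ∈ Λ, ∀ t ∈ target l, z l t d = c t := by
  set s : ι → ℕ := fun l => (P l).natDegree with hs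
  set M := ∑ l ∈ Λ, s l with hMdef
  set G := ∏ l ∈ Λ, P l with hG
  have hGm : G.Monic := monic_prod_of_monic _ _ fun l _ => hP l
  set h := Nat.log 2 N + 1 with hh
  have hNh : N ≤ 2 ^ h := (Nat.lt_pow_succ_log_self one_lt_two N).le
  have hΛM : Λ.card ≤ M := by
    rw [hMdef, card_eq_sum_ones]
    exact sum_le_sum fun l hl => hΛ l hl
  -- interpolation
  set b : κ → F := fun k => (∏ k' ∈ W.erase k, (x k - x k'))⁻¹ * a k with hb
  set U : D → F[X] := fun d => combination (fun k => X - C (x k)) W (fun k => b k * v k d) with hU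
  have hX1 : ∀ k : κ, (X - C (x k)).natDegree ≤ 1 := fun k => (natDegree_X_sub_C _).le
  have c1 : Computes {f | ∃ k ∈ W, f = v k} {f | ∃ k ∈ W, f = fun d => b k * v k d} W.card := by
    have := Computes.family (base := {f | ∃ k ∈ W, f = v k}) W (fun k d => b k * v k d) (t := 1)
      fun k hk => Computes.const_mul (b k) ⟨k, hk, rfl⟩
    rwa [mul_one] at this
  have c2 := c1.trans (computes_combination hX1 (fun k d => b k * v k d) h W
    (hW.trans hNh) hW)
  -- the expansion at infinity of `U / G`
  set Ψ : D → F[X] →ₗ[F] F := fun d => (residueForm G).comp (LinearMap.mulLeft F (U d)) with hΨ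
  have c3 : Computes {f | ∃ i < W.card, f = fun d => (U d).coeff i}
      {f | ∃ j < M, f = fun d => Ψ d (X ^ j)} (N * mulFactor N) := by
    have h0 : Computes {f | ∃ i < W.card, f = fun d => (U d).coeff i}
        {f | ∃ i < N, f = fun d => (U d).coeff (N - 1 - i)} 0 := by
      refine Computes.of_subset ?_
      rintro _ ⟨i, hi, rfl⟩
      by_cases hi' : N - 1 - i < W.card
      · exact .inl ⟨_, hi', rfl⟩
      · refine .inr ⟨0, ?_⟩
        ext d
        exact (coeff_combination_eq_zero hX1 _ (not_lt.1 hi')).symm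
    have hT := computes_toeplitz N (fun z => residueForm G (X ^ (z + (N - 1)).toNat))
      (fun i d => (U d).coeff (N - 1 - i))
    refine ((h0.trans hT).mono_cost (by rw [zero_add])).mono_out ?_
    rintro _ ⟨j, hj, rfl⟩
    refine ⟨j, by omega, ?_⟩
    ext d
    have hdeg : (U d).natDegree < N := by
      rcases Nat.eq_zero_or_pos N with hN0 | hN0
      · omega
      · refine Nat.lt_of_le_pred hN0 (natDegree_le_iff_coeff_eq_zero.2 fun i hi => ?_)
        exact coeff_combination_eq_zero hX1 _ (by rw [Nat.pred_eq_sub_one] at hi; omega)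
    rw [← sum_range_reflect]
    simp only [hΨ, LinearMap.comp_apply, LinearMap.mulLeft_apply]
    conv_lhs => rw [as_sum_range' _ N hdeg, sum_mul, map_sum]
    refine sum_congr rfl fun i hi => ?_
    have hi' := mem_range.1 hi
    rw [← C_mul_X_pow_eq_monomial, mul_assoc, ← pow_add, ← smul_eq_C_mul, map_smul, smul_eq_mul,
      mul_comm, show N - 1 - (N - 1 - i) = i by omega,
      show ((j : ℤ) - ((N - 1 - i : ℕ) : ℤ) + (N - 1)).toNat = i + j by omega]
  have c4 := c3.trans (computes_remainderTree (N := N) (fun l => le_refl (P l).natDegree) h Λ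
    (hΛM.trans (hM.trans hNh)) hM Ψ)
  -- local solutions
  have hloc : ∀ l t, ∃ w : ℕ → F, l ∈ Λ → t ∈ target l → ∀ c : τ → F, c t =
      ∑ i ∈ range (s l), w i * residueForm G
        ((∑ t, C (c t) * E t) * (X ^ i * ∏ l' ∈ Λ.erase l, P l')) := by
    intro l t
    by_cases hlt : l ∈ Λ ∧ t ∈ target l
    swap
    · exact ⟨0, fun h1 h2 => absurd ⟨h1, h2⟩ hlt⟩
    have hGl : G = P l * ∏ l' ∈ Λ.erase l, P l' := (mul_prod_erase Λ P hlt.1).symm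
    let comb : (τ → F) →ₗ[F] F[X] := Fintype.linearCombination F E
    have hcomb : ∀ c, comb c = ∑ t, C (c t) * E t := fun c => by
      simp [comb, Fintype.linearCombination_apply, smul_eq_C_mul]
    obtain ⟨w, hw⟩ := exists_coeff_of_ker_le (s := s l)
      (fun i => ((residueForm G).comp (LinearMap.mulRight F (X ^ i * ∏ l' ∈ Λ.erase l, P l'))).comp
        comb) (LinearMap.proj t) (by
          intro c hc
          refine hker l hlt.1 c ?_ t hlt.2
          rw [← hcomb]
          refine dvd_of_residueForm (hP l)
            (monic_prod_of_monic _ _ fun l' _ => hP l') (Q := ∏ l' ∈ Λ.erase l, P l') ?_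
          intro i hi
          rw [← hGl]
          exact hc i hi)
    refine ⟨w, fun _ _ c => ?_⟩
    have := hw c
    simp only [LinearMap.comp_apply, LinearMap.mulRight_apply, hcomb, LinearMap.proj_apply] at this
    exact this
  choose w hw using hloc
  refine ⟨fun l t d => ∑ i ∈ range (s l), w l t i * Ψ d (X ^ i * ∏ l' ∈ Λ.erase l, P l'), ?_, ?_⟩
  · have c5 := Computes.biUnion
      (base := {f | ∃ l ∈ Λ, ∃ i < s l, f = fun d => Ψ d (X ^ i * ∏ l' ∈ Λ.erase l, P l')}) Λ
      (fun l => {f | ∃ t ∈ target l, f = fun d =>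
        ∑ i ∈ range (s l), w l t i * Ψ d (X ^ i * ∏ l' ∈ Λ.erase l, P l')})
      (fun l => (target l).card * (2 * s l)) (by
        intro l hl
        refine Computes.family _ (fun t d =>
          ∑ i ∈ range (s l), w l t i * Ψ d (X ^ i * ∏ l' ∈ Λ.erase l, P l')) fun t _ => ?_
        have := Computes.linear
          (base := {f | ∃ l ∈ Λ, ∃ i < s l, f = fun d => Ψ d (X ^ i * ∏ l' ∈ Λ.erase l, P l')})
          (range (s l)) (w l t) (fun i d => Ψ d (X ^ i * ∏ l' ∈ Λ.erase l, P l'))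
          (fun i hi => ⟨l, hl, i, mem_range.1 hi, rfl⟩)
        rwa [card_range] at this)
    refine ((c2.trans (c4.trans c5)).mono_cost ?_).mono_out ?_
    · have hm : 1 ≤ mulFactor N := by
        have : 1 ≤ logFactor (Nat.log 2 N) := Nat.le_add_left _ _
        rw [mulFactor]
        omega
      have e1 : W.card ≤ N * mulFactor N := hW.trans (Nat.le_mul_of_pos_right _ hm)
      have e2 : h * (3 * W.card * mulFactor N) ≤ h * (3 * N * mulFactor N) := by gcongr
      have e3 : h * (2 * M * mulFactor N) ≤ h * (2 * N * mulFactor N) := by gcongr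
      have e4 : N * mulFactor N ≤ h * (N * mulFactor N) := Nat.le_mul_of_pos_left _ (by omega)
      have e5 : N * treeFactor N = h * (3 * N * mulFactor N) + h * (2 * N * mulFactor N) +
          h * (N * mulFactor N) + h * (N * mulFactor N) := by
        rw [treeFactor, ← hh]; ring
      rw [e5]
      change W.card + h * (3 * W.card * mulFactor N) + (N * mulFactor N +
        h * (2 * M * mulFactor N) +
          ∑ l ∈ Λ, (target l).card * (2 * (P l).natDegree)) ≤ _
      omega
    · rintro _ ⟨l, hl, t, ht, rfl⟩
      exact ⟨l, hl, t, ht, rfl⟩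
  · intro d c hdc l hl t ht
    have hUd : U d = ∑ t, C (c t) * E t := by
      have hdeg : (∑ t, C (c t) * E t).degree < W.card := by
        refine (degree_sum_le _ _).trans_lt ?_
        refine (Finset.sup_lt_iff (WithBot.bot_lt_coe _)).2 fun t _ => ?_
        refine lt_of_le_of_lt ?_ (hE t)
        rw [← smul_eq_C_mul]
        exact degree_smul_le _ _
      rw [eq_combination hx hdeg]
      simp only [hU, combination]
      refine sum_congr rfl fun k hk => ?_
      rw [← hdc k hk, hb]
      simp only [mul_assoc]
    rw [hw l t hl ht c]
    simp only [hΨ, LinearMap.comp_apply, LinearMap.mulLeft_apply, hUd]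

end Pipeline

/-! ### Power assignments -/

section Powers

open Finset

variable {LA LB N : ℕ} {S : Finset (Fin LA × Fin LB)} {Q : TaskAssignment S N}

namespace PowerAssignment

variable (P : PowerAssignment Q)

theorem powA_le (q : Fin N) (i : Fin LA) : P.powA q i ≤ Q.size q := by
  by_cases hi : i ∈ Q.left q
  · rcases P.values q with ⟨h, -⟩ | ⟨-, h⟩
    · obtain ⟨x, hx, h⟩ := h i hi
      have := (mem_Icc.1 hx).1
      omega
    · obtain ⟨y, hy, h⟩ := h i hi
      rw [h]
      exact Nat.mul_le_mul_right _ (mem_Icc.1 hy).2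
  · rw [P.powA_eq_zero q i hi]; exact Nat.zero_le _

theorem powB_le (q : Fin N) (j : Fin LB) : P.powB q j ≤ Q.size q := by
  by_cases hj : j ∈ Q.right q
  · rcases P.values q with ⟨-, h⟩ | ⟨h, -⟩
    · obtain ⟨y, hy, h⟩ := h j hj
      rw [h, TaskAssignment.size, mul_comm]
      exact Nat.mul_le_mul_left _ (mem_Icc.1 hy).2
    · obtain ⟨x, hx, h⟩ := h j hj
      have := (mem_Icc.1 hx).1
      omega
  · rw [P.powB_eq_zero q j hj]; exact Nat.zero_le _

theorem powA_add_powB_le_of_notMem {q : Fin N} {i : Fin LA} {j : Fin LB}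
    (h : (i, j) ∉ Q.left q ×ˢ Q.right q) : P.powA q i + P.powB q j ≤ Q.size q := by
  rw [mem_product, not_and_or] at h
  rcases h with h | h
  · rw [P.powA_eq_zero q i h, zero_add]; exact P.powB_le q j
  · rw [P.powB_eq_zero q j h, add_zero]; exact P.powA_le q i

/-- Desired products have pole orders beyond `size q`, so that their orders of vanishing are below
`size q`. -/
theorem size_lt_powA_add_powB {q : Fin N} {i : Fin LA} {j : Fin LB}
    (h : (i, j) ∈ Q.left q ×ˢ Q.right q) : Q.size q < P.powA q i + P.powB q j := by
  rw [mem_product] at h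
  rcases P.values q with ⟨h1, h2⟩ | ⟨h2, h1⟩
  · obtain ⟨x, hx, hA⟩ := h1 i h.1
    obtain ⟨y, hy, hB⟩ := h2 j h.2
    rw [mem_Icc] at hx hy
    have := Nat.mul_le_mul_right (Q.left q).card hy.1
    omega
  · obtain ⟨x, hx, hB⟩ := h2 j h.2
    obtain ⟨y, hy, hA⟩ := h1 i h.1
    rw [mem_Icc] at hx hy
    have := Nat.mul_le_mul_right (Q.right q).card hy.1
    omega

/-- Uniqueness of division with remainder, in the form in which it separates exponents. -/
theorem eq_of_mul_add_eq {L x y x' y' : ℕ} (hx : x ∈ Icc 1 L) (hx' : x' ∈ Icc 1 L)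
    (h : y * L + x' = y' * L + x) : y = y' ∧ x = x' := by
  rw [mem_Icc] at hx hx'
  have hy : y = y' := by
    rcases lt_trichotomy y y' with hlt | heq | hgt
    · have := Nat.mul_le_mul_right L hlt
      rw [Nat.succ_mul] at this
      omega
    · exact heq
    · have := Nat.mul_le_mul_right L hgt
      rw [Nat.succ_mul] at this
      omega
  subst hy
  exact ⟨rfl, by omega⟩

/-- Within a task group, different products have different pole orders. -/
theorem pow_add_injOn (q : Fin N) :
    Set.InjOn (fun s : Fin LA × Fin LB => P.powA q s.1 + P.powB q s.2)
      (Q.left q ×ˢ Q.right q : Finset (Fin LA × Fin LB)) := by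
  rintro ⟨i, j⟩ hs ⟨i', j'⟩ hs' h
  rw [mem_coe, mem_product] at hs hs'
  simp only at h hs hs'
  have hL : 0 < (Q.left q).card := card_pos.2 ⟨i, hs.1⟩
  have hR : 0 < (Q.right q).card := card_pos.2 ⟨j, hs.2⟩
  have hLs : (Q.left q).card ≤ Q.size q := Nat.le_mul_of_pos_right _ hR
  have hRs : (Q.right q).card ≤ Q.size q := Nat.le_mul_of_pos_left _ hL
  have key : P.powA q i = P.powA q i' ∧ P.powB q j = P.powB q j' ∧ P.powA q i ≠ 0 ∧
      P.powB q j ≠ 0 := by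
    rcases P.values q with ⟨h1, h2⟩ | ⟨h2, h1⟩
    · obtain ⟨x, hx, hA⟩ := h1 i hs.1
      obtain ⟨y, hy, hB⟩ := h2 j hs.2
      obtain ⟨x', hx', hA'⟩ := h1 i' hs'.1
      obtain ⟨y', hy', hB'⟩ := h2 j' hs'.2
      obtain ⟨rfl, rfl⟩ := eq_of_mul_add_eq hx hx'
        (show y * (Q.left q).card + x' = y' * (Q.left q).card + x by omega)
      rw [mem_Icc] at hx hy
      have := Nat.mul_le_mul_right (Q.left q).card hy.1
      omega
    · obtain ⟨x, hx, hB⟩ := h2 j hs.2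
      obtain ⟨y, hy, hA⟩ := h1 i hs.1
      obtain ⟨x', hx', hB'⟩ := h2 j' hs'.2
      obtain ⟨y', hy', hA'⟩ := h1 i' hs'.1
      obtain ⟨rfl, rfl⟩ := eq_of_mul_add_eq hx hx'
        (show y * (Q.right q).card + x' = y' * (Q.right q).card + x by omega)
      rw [mem_Icc] at hx hy
      have := Nat.mul_le_mul_right (Q.right q).card hy.1
      omega
  obtain ⟨hA, hB, hA0, hB0⟩ := key
  rw [P.powA_distinct q i i' hA0 (hA ▸ hA0) hA, P.powB_distinct q j j' hB0 (hB ▸ hB0) hB]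

/-- Since the task groups are disjoint, the pole orders of a product add up to at most the total
size of the groups plus the size of one group. -/
theorem sum_pow_le {i : Fin LA} {j : Fin LB} {s : ℕ} (hs : ∀ q, Q.size q ≤ s) :
    ∑ q, P.powA q i + ∑ q, P.powB q j ≤ ∑ q, Q.size q + s := by
  rw [← sum_add_distrib]
  by_cases h : ∃ q, (i, j) ∈ Q.left q ×ˢ Q.right q
  · obtain ⟨q₀, h₀⟩ := h
    rw [← add_sum_erase univ (fun q => P.powA q i + P.powB q j) (mem_univ q₀),
      ← add_sum_erase univ (fun q => Q.size q) (mem_univ q₀)]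
    have h1 : ∑ q ∈ univ.erase q₀, (P.powA q i + P.powB q j) ≤ ∑ q ∈ univ.erase q₀, Q.size q := by
      refine sum_le_sum fun q hq => P.powA_add_powB_le_of_notMem fun hmem => ?_
      exact Finset.disjoint_left.1 (Q.disjoint q q₀ (ne_of_mem_erase hq)) hmem h₀
    have h2 := P.powA_le q₀ i
    have h3 := P.powB_le q₀ j
    have h4 := hs q₀
    omega
  · have : ∑ q, (P.powA q i + P.powB q j) ≤ ∑ q, Q.size q :=
      sum_le_sum fun q _ => P.powA_add_powB_le_of_notMem fun hmem => h ⟨q, hmem⟩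
    omega

end PowerAssignment

end Powers

/-! ### The polynomial behind the responses -/

section Responses

open Finset Polynomial

variable {F : Type*} [Field F]

/-- Functions with different orders of vanishing below `s` are linearly independent modulo
`(X - f) ^ s`. -/
theorem eq_zero_of_pow_dvd_sum {τ : Type*} {S : Finset τ} {f : F} {s : ℕ} {e : τ → ℕ}
    (he : Set.InjOn e S) (hes : ∀ t ∈ S, e t < s) {H : τ → F[X]} (hH : ∀ t ∈ S, (H t).eval f ≠ 0)
    {c : τ → F} (h : (X - C f) ^ s ∣ ∑ t ∈ S, C (c t) * ((X - C f) ^ e t * H t)) :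
    ∀ t ∈ S, c t = 0 := by
  classical
  by_contra! hc
  obtain ⟨t₁, ht₁, hc₁⟩ := hc
  obtain ⟨t₀, ht₀, hmin⟩ := exists_min_image (S.filter fun t => c t ≠ 0) e
    ⟨t₁, mem_filter.2 ⟨ht₁, hc₁⟩⟩
  rw [mem_filter] at ht₀
  have hdvd : (X - C f) ^ (e t₀ + 1) ∣ C (c t₀) * ((X - C f) ^ e t₀ * H t₀) := by
    rw [← add_sum_erase S _ ht₀.1] at h
    refine (dvd_add_left (dvd_sum fun t ht => ?_)).1
      ((pow_dvd_pow _ (Nat.succ_le_of_lt (hes t₀ ht₀.1))).trans h)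
    by_cases hct : c t = 0
    · rw [hct, map_zero, zero_mul]; exact dvd_zero _
    · have htS := mem_of_mem_erase ht
      have h1 := hmin t (mem_filter.2 ⟨htS, hct⟩)
      have h2 : e t ≠ e t₀ := fun h => ne_of_mem_erase ht (he htS ht₀.1 h)
      exact ((pow_dvd_pow _ (by omega)).mul_right _).mul_left _
  rw [mul_left_comm, pow_succ] at hdvd
  have h3 := (mul_dvd_mul_iff_left (pow_ne_zero _ (X_sub_C_ne_zero f))).1 hdvd
  rw [dvd_iff_isRoot, IsRoot, eval_mul, eval_C] at h3
  exact mul_ne_zero ht₀.2 (hH t₀ ht₀.1) h3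

variable {m p n R N K : ℕ} {LA LB : ℕ} {S : Finset (Fin LA × Fin LB)} {Q : TaskAssignment S N}

namespace FCCData

variable (X' : FCCData F m p n R N K) (P : PowerAssignment Q) (ρ : ℕ)

/-- The order of vanishing at the pole `f r₀ q` of the contribution of
`A_i ^ r * B_j ^ r'` to the polynomial `∏ (z - f) ^ size * ∑ A ^ h(z) B ^ h(z)`, for
`t = (i, j, r, r')`. -/
def vanishingOrder (P : PowerAssignment Q) (ρ : ℕ)
    (t : Fin LA × Fin LB × Fin R × Fin R) (r₀ : Fin R) (q : Fin N) : ℕ :=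
  Q.size q * (1 + if r₀.val / ρ = t.2.2.1.val / ρ then 1 else 0) -
    (if r₀ = t.2.2.1 then P.powA q t.1 else 0) - (if r₀ = t.2.2.2 then P.powB q t.2.1 else 0)

/-- The contribution of `A_i ^ r * B_j ^ r'` to the polynomial
`∏ (z - f) ^ size * ∑ A ^ h(z) B ^ h(z)`; there is none if `r` and `r'` belong to different groups
of instances. -/
noncomputable def contribution (t : Fin LA × Fin LB × Fin R × Fin R) : F[X] :=
  if t.2.2.1.val / ρ = t.2.2.2.val / ρ then
    ∏ r₀, ∏ q, (X - C (X'.f r₀ q)) ^ vanishingOrder P ρ t r₀ q else 0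

/-- The subtractions in `vanishingOrder` do not truncate. -/
theorem vanishingOrder_add {t : Fin LA × Fin LB × Fin R × Fin R}
    (ht : t.2.2.1.val / ρ = t.2.2.2.val / ρ) (r₀ : Fin R) (q : Fin N) :
    vanishingOrder P ρ t r₀ q + (if r₀ = t.2.2.1 then P.powA q t.1 else 0) +
      (if r₀ = t.2.2.2 then P.powB q t.2.1 else 0) =
      Q.size q + (if r₀.val / ρ = t.2.2.1.val / ρ then Q.size q else 0) := by
  have hA := P.powA_le q t.1
  have hB := P.powB_le q t.2.1
  have h1 : r₀ = t.2.2.1 → r₀.val / ρ = t.2.2.1.val / ρ := by rintro rfl; rfl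
  have h2 : r₀ = t.2.2.2 → r₀.val / ρ = t.2.2.1.val / ρ := by rintro rfl; exact ht.symm
  unfold vanishingOrder
  by_cases h : r₀.val / ρ = t.2.2.1.val / ρ
  · simp only [h, if_true]
    split_ifs <;> omega
  · simp only [h, if_false, mt h1 h, mt h2 h]
    omega

/-- The instances fall into groups of `ρ` elements, since `ρ` divides their number. -/
theorem card_group {ρ h : ℕ} (hρ : ρ ∣ R) (hh : h < R / ρ) :
    (univ.filter fun r : Fin R => r.val / ρ = h).card = ρ := by
  obtain ⟨φ, rfl⟩ := hρ
  have hρ0 : 0 < ρ := Nat.pos_of_ne_zero (by rintro rfl; simp at hh)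
  rw [Nat.mul_div_cancel_left _ hρ0] at hh
  have hle : ρ * (h + 1) ≤ ρ * φ := Nat.mul_le_mul_left _ hh
  rw [mul_add, mul_one] at hle
  refine Eq.trans (Eq.symm ?_) (card_range ρ)
  refine card_bij (fun i hi => ⟨ρ * h + i, by have := mem_range.1 hi; omega⟩) ?_ ?_ ?_
  · intro i hi
    rw [mem_filter]
    refine ⟨mem_univ _, ?_⟩
    simp only
    rw [Nat.mul_add_div hρ0, Nat.div_eq_of_lt (mem_range.1 hi), add_zero]
  · intro i _ j _ hij
    simpa using hij
  · intro r hr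
    rw [mem_filter] at hr
    have := Nat.div_add_mod r.val ρ
    refine ⟨r.val % ρ, mem_range.2 (Nat.mod_lt _ hρ0), ?_⟩
    ext
    simp only
    rw [← hr.2, this]

/-- The sum `∑ c t • E t` of all contributions has degree less than the threshold. -/
theorem natDegree_contribution_le {ρ : ℕ} (hρ : ρ ∣ R) (t : Fin LA × Fin LB × Fin R × Fin R) :
    ((X'.contribution P ρ t).natDegree : ℤ) + 1 ≤ fcsaThreshold P R ρ ∨
      X'.contribution P ρ t = 0 := by
  by_cases ht : t.2.2.1.val / ρ = t.2.2.2.val / ρ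
  swap
  · exact .inr (if_neg ht)
  left
  have h1 : (X'.contribution P ρ t).natDegree ≤ ∑ r₀, ∑ q, vanishingOrder P ρ t r₀ q := by
    rw [contribution, if_pos ht]
    refine (natDegree_prod_le _ _).trans (sum_le_sum fun r₀ _ => ?_)
    refine (natDegree_prod_le _ _).trans (sum_le_sum fun q _ => ?_)
    refine natDegree_pow_le.trans ?_
    rw [natDegree_X_sub_C, mul_one]
  have h2 : ∑ r₀, ∑ q, vanishingOrder P ρ t r₀ q + ∑ q, P.powA q t.1 + ∑ q, P.powB q t.2.1 =
      (R + ρ) * ∑ q, Q.size q := by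
    have e1 : ∑ q, P.powA q t.1 = ∑ r₀, ∑ q, if r₀ = t.2.2.1 then P.powA q t.1 else 0 := by
      rw [sum_comm]; simp
    have e2 : ∑ q, P.powB q t.2.1 = ∑ r₀, ∑ q, if r₀ = t.2.2.2 then P.powB q t.2.1 else 0 := by
      rw [sum_comm]; simp
    rw [e1, e2, ← sum_add_distrib, ← sum_add_distrib]
    simp_rw [← sum_add_distrib, vanishingOrder_add P ρ ht, sum_add_distrib]
    have e3 : ∀ r₀ : Fin R, (∑ q, if r₀.val / ρ = t.2.2.1.val / ρ then Q.size q else 0) =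
        if r₀.val / ρ = t.2.2.1.val / ρ then ∑ q, Q.size q else 0 := by
      intro r₀; split_ifs <;> simp
    simp_rw [e3]
    rw [← sum_filter, sum_const, sum_const,
      card_group hρ (Nat.div_lt_div_of_lt_of_dvd hρ t.2.2.1.isLt), card_univ, Fintype.card_fin,
      smul_eq_mul, smul_eq_mul, add_mul]
  have h3 : (⨅ i, ∑ q, P.powA q i) ≤ ∑ q, P.powA q t.1 := ciInf_le (OrderBot.bddBelow _) t.1
  have h4 : (⨅ j, ∑ q, P.powB q j) ≤ ∑ q, P.powB q t.2.1 := ciInf_le (OrderBot.bddBelow _) t.2.1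
  have h2' : ((∑ r₀, ∑ q, vanishingOrder P ρ t r₀ q : ℕ) : ℤ) + (∑ q, P.powA q t.1 : ℕ) +
      (∑ q, P.powB q t.2.1 : ℕ) = (R + ρ) * ((∑ q, Q.size q : ℕ) : ℤ) := by exact_mod_cast h2
  rw [fcsaThreshold, ← Nat.cast_sum]
  omega

theorem f_injective {r r' : Fin R} {q q' : Fin N} (h : X'.f r q = X'.f r' q') :
    r = r' ∧ q = q' := by
  have := @X'.distinct (.inl (r, q)) (.inl (r', q')) h
  simpa using this

theorem x_sub_f_ne_zero (k : Fin K) (r : Fin R) (q : Fin N) : X'.x k - X'.f r q ≠ 0 := by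
  intro h
  have := @X'.distinct (.inr k) (.inl (r, q)) (sub_eq_zero.1 h)
  simp at this

theorem x_injective : Function.Injective X'.x := by
  intro k k' h
  have := @X'.distinct (.inr k) (.inr k') h
  simpa using this

/-- Modulo the power of `z - f r q` that belongs to the task group `q`, only the desired products
of the instance `r` contribute. -/
theorem pow_dvd_contribution {r : Fin R} {q : Fin N} {t : Fin LA × Fin LB × Fin R × Fin R}
    (ht : ¬ ((t.1, t.2.1) ∈ Q.left q ×ˢ Q.right q ∧ t.2.2.1 = r ∧ t.2.2.2 = r)) :
    (X - C (X'.f r q)) ^ Q.size q ∣ X'.contribution P ρ t := by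
  by_cases htρ : t.2.2.1.val / ρ = t.2.2.2.val / ρ
  swap
  · rw [contribution, if_neg htρ]; exact dvd_zero _
  have hle : Q.size q ≤ vanishingOrder P ρ t r q := by
    have h := vanishingOrder_add P ρ htρ r q
    have hA := P.powA_le q t.1
    have hB := P.powB_le q t.2.1
    by_cases h1 : r = t.2.2.1 <;> by_cases h2 : r = t.2.2.2
    · have h3 : (t.1, t.2.1) ∉ Q.left q ×ˢ Q.right q := fun h3 => ht ⟨h3, h1.symm, h2.symm⟩
      have := P.powA_add_powB_le_of_notMem h3
      rw [if_pos h1, if_pos h2, if_pos (by rw [h1])] at h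
      omega
    · rw [if_pos h1, if_neg h2, if_pos (by rw [h1])] at h
      omega
    · rw [if_neg h1, if_pos h2, if_pos (by rw [h2, htρ])] at h
      omega
    · rw [if_neg h1, if_neg h2] at h
      omega
  rw [contribution, if_pos htρ]
  refine (pow_dvd_pow _ hle).trans ?_
  exact (dvd_prod_of_mem (fun q => (X - C (X'.f r q)) ^ vanishingOrder P ρ t r q)
    (mem_univ q)).trans (dvd_prod_of_mem (fun r₀ => ∏ q, (X - C (X'.f r₀ q)) ^
      vanishingOrder P ρ t r₀ q) (mem_univ r))

/-- The unknowns that the local data at the pole `f r q` determine. -/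
def targets (R : ℕ) (Q : TaskAssignment S N) (l : Fin R × Fin N) :
    Finset (Fin LA × Fin LB × Fin R × Fin R) :=
  (Q.left l.2 ×ˢ Q.right l.2).image fun s => (s.1, s.2, l.1, l.1)

theorem card_targets_le (l : Fin R × Fin N) : (targets R Q l).card ≤ Q.size l.2 :=
  card_image_le.trans (card_product _ _).le

theorem mem_targets {l : Fin R × Fin N} {t : Fin LA × Fin LB × Fin R × Fin R} :
    t ∈ targets R Q l ↔
      (t.1, t.2.1) ∈ Q.left l.2 ×ˢ Q.right l.2 ∧ t.2.2.1 = l.1 ∧ t.2.2.2 = l.1 := by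
  obtain ⟨i, j, r, r'⟩ := t
  simp only [targets, mem_image, Prod.mk.injEq, Prod.exists]
  constructor
  · rintro ⟨a, b, h, rfl, rfl, rfl, rfl⟩
    exact ⟨h, rfl, rfl⟩
  · rintro ⟨h, rfl, rfl⟩
    exact ⟨i, j, h, rfl, rfl, rfl, rfl⟩

/-- The remainder of `∑ c t • E t` modulo the power of `z - f r q` determines the unknowns of the
pole `f r q`. -/
theorem eq_zero_of_dvd_sum_contribution {l : Fin R × Fin N}
    {c : Fin LA × Fin LB × Fin R × Fin R → F}
    (h : (X - C (X'.f l.1 l.2)) ^ Q.size l.2 ∣ ∑ t, C (c t) * X'.contribution P ρ t) :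
    ∀ t ∈ targets R Q l, c t = 0 := by
  obtain ⟨r, q⟩ := l
  simp only at h
  have h1 : (X - C (X'.f r q)) ^ Q.size q ∣
      ∑ t ∈ targets R Q (r, q), C (c t) * X'.contribution P ρ t := by
    rw [← sum_add_sum_compl (targets R Q (r, q))] at h
    refine (dvd_add_left (dvd_sum fun t ht => ?_)).1 h
    refine (pow_dvd_contribution X' P ρ fun h' => ?_).mul_left _
    exact (mem_compl.1 ht) (mem_targets.2 h')
  -- the order of vanishing and the cofactor of the contribution of `t`
  set H : Fin LA × Fin LB × Fin R × Fin R → F[X] := fun t =>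
    ∏ l' ∈ (univ : Finset (Fin R × Fin N)).erase (r, q),
      (X - C (X'.f l'.1 l'.2)) ^ vanishingOrder P ρ t l'.1 l'.2 with hH
  have h2 : ∀ t ∈ targets R Q (r, q), X'.contribution P ρ t =
      (X - C (X'.f r q)) ^ vanishingOrder P ρ t r q * H t := by
    intro t ht
    obtain ⟨-, hr, hr'⟩ := mem_targets.1 ht
    rw [contribution, if_pos (by rw [hr, hr']), ← Fintype.prod_prod_type',
      ← mul_prod_erase univ _ (mem_univ (r, q))]
  have hord : ∀ t ∈ targets R Q (r, q),
      vanishingOrder P ρ t r q + (P.powA q t.1 + P.powB q t.2.1) = 2 * Q.size q := by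
    intro t ht
    obtain ⟨-, hr, hr'⟩ := mem_targets.1 ht
    have := vanishingOrder_add P ρ (t := t) (by rw [hr, hr']) r q
    rw [if_pos hr.symm, if_pos hr'.symm, if_pos (by rw [hr])] at this
    omega
  rw [sum_congr rfl fun t ht => by rw [h2 t ht]] at h1
  refine eq_zero_of_pow_dvd_sum ?_ ?_ ?_ h1
  · intro t ht t' ht' he
    have e1 := hord t ht
    have e2 := hord t' ht'
    obtain ⟨hs, hr, hr'⟩ := mem_targets.1 ht
    obtain ⟨hs', hrr, hrr'⟩ := mem_targets.1 ht'
    have := P.pow_add_injOn q hs hs' (by simp only at he ⊢; omega)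
    rw [Prod.mk.injEq] at this
    ext1
    · exact this.1
    ext1
    · exact this.2
    ext1
    · rw [hr, hrr]
    · rw [hr', hrr']
  · intro t ht
    have e1 := hord t ht
    have := P.size_lt_powA_add_powB (mem_targets.1 ht).1
    simp only at this
    omega
  · intro t _
    rw [hH]
    simp only
    rw [eval_prod]
    refine prod_ne_zero_iff.2 fun l' hl' => ?_
    rw [eval_pow, eval_sub, eval_X, eval_C]
    refine pow_ne_zero _ fun h0 => ne_of_mem_erase hl' ?_
    obtain ⟨e1, e2⟩ := X'.f_injective (sub_eq_zero.1 h0)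
    ext1
    · exact e1.symm
    · exact e2.symm

end FCCData

end Responses

/-! ### The responses as values of the polynomial -/

section ResponseValues

open Finset Polynomial

variable {F : Type*} [Field F]
variable {m p n R N K : ℕ} {LA LB : ℕ} {S : Finset (Fin LA × Fin LB)} {Q : TaskAssignment S N}

namespace FCCData

variable (X' : FCCData F m p n R N K) (P : PowerAssignment Q) (ρ : ℕ)

/-- The contribution of `A_i ^ r * B_j ^ r'` at an evaluation point is its coefficient in the
response, up to the common factor `∏ (x k - f) ^ size`. -/
theorem eval_contribution (k : Fin K) {h : Fin (R / ρ)} {t : Fin LA × Fin LB × Fin R × Fin R}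
    (hr : t.2.2.1 ∈ instances R ρ h) (hr' : t.2.2.2 ∈ instances R ρ h) :
    (X'.contribution P ρ t).eval (X'.x k) =
      (∏ r, ∏ q, (X'.x k - X'.f r q) ^ Q.size q) *
        ((∏ q, ∏ r ∈ instances R ρ h, (X'.x k - X'.f r q) ^ Q.size q) *
          ((∏ q, (X'.x k - X'.f t.2.2.1 q) ^ P.powA q t.1)⁻¹ *
            (∏ q, (X'.x k - X'.f t.2.2.2 q) ^ P.powB q t.2.1)⁻¹)) := by
  rw [instances, mem_filter] at hr hr'
  have htρ : t.2.2.1.val / ρ = t.2.2.2.val / ρ := hr.2.trans hr'.2.symm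
  have hA0 : ∏ q, (X'.x k - X'.f t.2.2.1 q) ^ P.powA q t.1 ≠ 0 :=
    prod_ne_zero_iff.2 fun q _ => pow_ne_zero _ (X'.x_sub_f_ne_zero k _ q)
  have hB0 : ∏ q, (X'.x k - X'.f t.2.2.2 q) ^ P.powB q t.2.1 ≠ 0 :=
    prod_ne_zero_iff.2 fun q _ => pow_ne_zero _ (X'.x_sub_f_ne_zero k _ q)
  rw [← mul_inv, ← mul_assoc, eq_mul_inv_iff_mul_eq₀ (mul_ne_zero hA0 hB0), ← mul_assoc]
  have e1 : ∏ q, (X'.x k - X'.f t.2.2.1 q) ^ P.powA q t.1 =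
      ∏ r, ∏ q, (X'.x k - X'.f r q) ^ (if r = t.2.2.1 then P.powA q t.1 else 0) := by
    rw [prod_eq_single t.2.2.1]
    · simp
    · intro r _ hne; simp [hne]
    · simp
  have e2 : ∏ q, (X'.x k - X'.f t.2.2.2 q) ^ P.powB q t.2.1 =
      ∏ r, ∏ q, (X'.x k - X'.f r q) ^ (if r = t.2.2.2 then P.powB q t.2.1 else 0) := by
    rw [prod_eq_single t.2.2.2]
    · simp
    · intro r _ hne; simp [hne]
    · simp
  have e3 : ∏ q, ∏ r ∈ instances R ρ h, (X'.x k - X'.f r q) ^ Q.size q =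
      ∏ r, ∏ q, (X'.x k - X'.f r q) ^ (if r.val / ρ = t.2.2.1.val / ρ then Q.size q else 0) := by
    rw [prod_comm, instances, prod_filter]
    refine prod_congr rfl fun r _ => ?_
    rw [hr.2]
    split_ifs <;> simp
  rw [e1, e2, e3, contribution, if_pos htρ, eval_prod, ← prod_mul_distrib, ← prod_mul_distrib,
    ← prod_mul_distrib]
  refine prod_congr rfl fun r _ => ?_
  rw [eval_prod, ← prod_mul_distrib, ← prod_mul_distrib, ← prod_mul_distrib]
  refine prod_congr rfl fun q _ => ?_
  rw [eval_pow, eval_sub, eval_X, eval_C, ← pow_add, ← pow_add, ← pow_add,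
    vanishingOrder_add P ρ htρ]

/-- A sum over the pairs of instances in the same group. -/
theorem sum_instances {M : Type*} [AddCommMonoid M] {ρ : ℕ} (hρ : ρ ∣ R)
    (G : Fin R → Fin R → M) (hG : ∀ r r', r.val / ρ ≠ r'.val / ρ → G r r' = 0) :
    ∑ h : Fin (R / ρ), ∑ r ∈ instances R ρ h, ∑ r' ∈ instances R ρ h, G r r' =
      ∑ r, ∑ r', G r r' := by
  simp only [instances, sum_filter]
  rw [sum_comm]
  refine sum_congr rfl fun r _ => ?_
  have hlt : r.val / ρ < R / ρ := Nat.div_lt_div_of_lt_of_dvd hρ r.isLt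
  rw [sum_eq_single ⟨r.val / ρ, hlt⟩]
  · rw [if_pos rfl]
    refine sum_congr rfl fun r' _ => ?_
    split_ifs with h
    · rfl
    · exact (hG r r' (Ne.symm h)).symm
  · intro h _ hne
    rw [if_neg]
    intro h'
    exact hne (by ext; exact h'.symm)
  · simp

/-- The value of `∑ A ^ h B ^ h` at the point `z`, which is the response of a worker. -/
def response (ρ : ℕ) {α β γ : ℕ} (A : Fin LA → Matrix (Fin α) (Fin β) F)
    (B : Fin LB → Matrix (Fin β) (Fin γ) F) (z : F) : Matrix (Fin (α / m)) (Fin (γ / n)) F :=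
  ∑ h, X'.encodeA P ρ A h z * X'.encodeB P ρ B h z

theorem of_mul_of_eq_response {α β γ : ℕ} (A : Fin LA → Matrix (Fin α) (Fin β) F)
    (B : Fin LB → Matrix (Fin β) (Fin γ) F) (z : F) :
    (Matrix.of fun u (v : Fin (R / ρ * (β / p))) =>
        X'.encodeA P ρ A (finProdFinEquiv.symm v).1 z u (finProdFinEquiv.symm v).2) *
      (Matrix.of fun (v : Fin (R / ρ * (β / p))) w =>
        X'.encodeB P ρ B (finProdFinEquiv.symm v).1 z (finProdFinEquiv.symm v).2 w) =
      X'.response P ρ A B z := by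
  ext u w
  rw [response, Matrix.mul_apply, Matrix.sum_apply]
  simp only [Matrix.mul_apply, Matrix.of_apply]
  rw [← Fintype.sum_prod_type']
  exact (Fintype.sum_equiv finProdFinEquiv _ _ fun v => by simp).symm

theorem encA_mul_encB (α β γ : ℕ) (dec) (k : Fin K) (A : Fin LA → Matrix (Fin α) (Fin β) F)
    (B : Fin LB → Matrix (Fin β) (Fin γ) F) :
    (X'.code P ρ α β γ dec).encA k A * (X'.code P ρ α β γ dec).encB k B =
      X'.response P ρ A B (X'.x k) :=
  X'.of_mul_of_eq_response P ρ A B (X'.x k)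

/-- After multiplication by `∏ (x k - f) ^ size`, an entry of the response of worker `k` is the
value at `x k` of a polynomial. -/
theorem mul_response_eq_eval {ρ : ℕ} (hρ : ρ ∣ R) {α β γ : ℕ} (k : Fin K)
    (A : Fin LA → Matrix (Fin α) (Fin β) F) (B : Fin LB → Matrix (Fin β) (Fin γ) F)
    (u : Fin (α / m)) (w : Fin (γ / n)) :
    (∏ r, ∏ q, (X'.x k - X'.f r q) ^ Q.size q) *
      X'.response P ρ A B (X'.x k) u w =
    (∑ t, C ((combineBlocks (X'.a t.2.2.1) (A t.1) * combineBlocks (X'.b t.2.2.2) (B t.2.1)) u w) *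
      X'.contribution P ρ t).eval (X'.x k) := by
  rw [response, eval_finsetSum, Fintype.sum_prod_type]
  simp_rw [Fintype.sum_prod_type, eval_mul, eval_C]
  have hinst : ∀ i j, ∑ r, ∑ r',
      (combineBlocks (X'.a r) (A i) * combineBlocks (X'.b r') (B j)) u w *
      (X'.contribution P ρ (i, j, r, r')).eval (X'.x k) =
      ∑ h : Fin (R / ρ), ∑ r ∈ instances R ρ h, ∑ r' ∈ instances R ρ h,
        (combineBlocks (X'.a r) (A i) * combineBlocks (X'.b r') (B j)) u w *
          (X'.contribution P ρ (i, j, r, r')).eval (X'.x k) := by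
    intro i j
    refine (sum_instances hρ _ fun r r' hne => ?_).symm
    rw [contribution, if_neg hne, eval_zero, mul_zero]
  simp_rw [hinst]
  rw [Matrix.sum_apply, mul_sum]
  simp_rw [sum_comm (s := (univ : Finset (Fin LB))) (t := (univ : Finset (Fin (R / ρ))))]
  rw [sum_comm]
  refine sum_congr rfl fun h _ => ?_
  simp only [encodeA, encodeB, Matrix.smul_mul, Matrix.sum_mul, Matrix.mul_sum, Matrix.mul_smul,
    Matrix.smul_apply, Matrix.sum_apply, smul_eq_mul, mul_sum]
  conv_rhs => rw [sum_comm]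
  refine sum_congr rfl fun j _ => ?_
  rw [sum_comm]
  refine sum_congr rfl fun i _ => ?_
  rw [sum_comm]
  refine sum_congr rfl fun r hr => sum_congr rfl fun r' hr' => ?_
  rw [eval_contribution X' P ρ k (t := (i, j, r, r')) hr hr']
  ring

end FCCData

end ResponseValues

/-! ### Decoding -/

section Decoding

open Finset Polynomial

variable {F : Type*} [Field F]

/-- The positions of a vector of length `d`, by the number of the block and the position within
the block. -/
def blockEquiv {d m : ℕ} (h : m ∣ d) : Fin m × Fin (d / m) ≃ Fin d :=
  finProdFinEquiv.trans (finCongr (Nat.mul_div_cancel' h))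

theorem blockEquiv_apply {d m : ℕ} (h : m ∣ d) (k : Fin m) (u : Fin (d / m)) :
    blockEquiv h (k, u) = blockIndex k u := by
  ext
  simp [blockEquiv, blockIndex]

theorem blockIndex_symm {d m : ℕ} (h : m ∣ d) (e : Fin d) :
    blockIndex ((blockEquiv h).symm e).1 ((blockEquiv h).symm e).2 = e := by
  rw [← blockEquiv_apply h, Prod.mk.eta, Equiv.apply_symm_apply]

theorem combineBlocks_apply {d e m p : ℕ} (a : Matrix (Fin m) (Fin p) F)
    (M : Matrix (Fin d) (Fin e) F) (u : Fin (d / m)) (v : Fin (e / p)) :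
    combineBlocks a M u v = ∑ k, ∑ l, a k l * M (blockIndex k u) (blockIndex l v) := by
  simp [combineBlocks, Matrix.sum_apply, gridBlock]

/-- A bilinear algorithm for scalar matrices also multiplies matrices of blocks. -/
theorem IsBilinearAlgorithm.mul_blocks {m p n R : ℕ} {a : Fin R → Matrix (Fin m) (Fin p) F}
    {b : Fin R → Matrix (Fin p) (Fin n) F} {c : Fin R → Matrix (Fin m) (Fin n) F}
    (h : IsBilinearAlgorithm a b c) {α β γ : ℕ} (hp : p ∣ β) (A : Matrix (Fin α) (Fin β) F)
    (B : Matrix (Fin β) (Fin γ) F) (k : Fin m) (u : Fin (α / m)) (l : Fin n) (w : Fin (γ / n)) :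
    (A * B) (blockIndex k u) (blockIndex l w) =
      ∑ r, c r k l * (combineBlocks (a r) A * combineBlocks (b r) B) u w := by
  have h1 : ∀ v : Fin (β / p), ∑ r, c r k l * (combineBlocks (a r) A u v) *
      (combineBlocks (b r) B v w) =
      ∑ r', A (blockIndex k u) (blockIndex r' v) * B (blockIndex r' v) (blockIndex l w) := by
    intro v
    have := h (Matrix.of fun q r => A (blockIndex q u) (blockIndex r v))
      (Matrix.of fun r s => B (blockIndex r v) (blockIndex s w)) k l
    simp only [Matrix.of_apply, Matrix.mul_apply] at this
    rw [← this]
    simp only [combineBlocks_apply]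
  rw [Matrix.mul_apply, ← (blockEquiv hp).sum_comp, Fintype.sum_prod_type, sum_comm]
  simp_rw [blockEquiv_apply, ← h1]
  rw [sum_comm]
  refine sum_congr rfl fun r _ => ?_
  rw [Matrix.mul_apply, mul_sum]
  exact sum_congr rfl fun v _ => by ring

variable {m p n R N K : ℕ} {LA LB : ℕ} {S : Finset (Fin LA × Fin LB)} {Q : TaskAssignment S N}

/-- A fast decoding function for a set of responding workers with at least `T` elements. Only `T` of
the responses are used, and the `(α / m) * (γ / n)` entries of the responses are treated separately.
-/
theorem FCCData.exists_decoder (X' : FCCData F m p n R N K) (P : PowerAssignment Q) {ρ : ℕ}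
    (hρ : ρ ∣ R) {α β γ : ℕ} (hm : m ∣ α) (hp : p ∣ β) (hn : n ∣ γ) {T N' : ℕ}
    (hT : (T : ℤ) = fcsaThreshold P R ρ) (hTN : T ≤ N') (hMN : R * ∑ q, Q.size q ≤ N')
    (W : Finset (Fin K)) (hW : T ≤ W.card) :
    ∃ dec : (W → Matrix (Fin (α / m)) (Fin (γ / n)) F) → S → Matrix (Fin α) (Fin γ) F,
      (∀ (A : Fin LA → Matrix (Fin α) (Fin β) F) (B : Fin LB → Matrix (Fin β) (Fin γ) F),
        dec (fun k => X'.response P ρ A B (X'.x k)) = fun s => A s.1.1 * B s.1.2) ∧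
      Computes (Set.range fun (e : W × Fin (α / m) × Fin (γ / n))
          (C : W → Matrix (Fin (α / m)) (Fin (γ / n)) F) => C e.1 e.2.1 e.2.2)
        (Set.range fun (e : S × Fin α × Fin γ) C => dec C e.1 e.2.1 e.2.2)
        ((α / m) * (γ / n) * (N' * treeFactor N' + 2 * (R * ∑ q, Q.size q ^ 2)) +
          S.card * (α * γ) * (2 * R)) := by
  obtain ⟨W', hW'W, hW'T⟩ := exists_subset_card_eq hW
  set Λ : Finset (Fin R × Fin N) := univ.filter fun l => 0 < Q.size l.2 with hΛ
  set L : Fin R × Fin N → F[X] := fun l => (X - C (X'.f l.1 l.2)) ^ Q.size l.2 with hL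
  have hLm : ∀ l, (L l).Monic := fun l => (monic_X_sub_C _).pow _
  have hLd : ∀ l, (L l).natDegree = Q.size l.2 := fun l => by
    rw [hL]; simp only; rw [(monic_X_sub_C _).natDegree_pow, natDegree_X_sub_C, mul_one]
  have hM : ∑ l ∈ Λ, (L l).natDegree ≤ N' := by
    simp only [hLd]
    refine (sum_le_univ_sum_of_nonneg fun _ => Nat.zero_le _).trans ?_
    rw [Fintype.sum_prod_type]
    simpa using hMN
  have hE : ∀ t, (X'.contribution P ρ t).degree < W'.card := by
    intro t
    rw [hW'T]
    rcases X'.natDegree_contribution_le P hρ t with h | h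
    · refine degree_le_natDegree.trans_lt ?_
      rw [← hT] at h
      exact_mod_cast (show (X'.contribution P ρ t).natDegree < T by omega)
    · rw [h, degree_zero]; exact WithBot.bot_lt_coe _
  choose z hz hz' using fun (u : Fin (α / m)) (w : Fin (γ / n)) =>
    exists_linear_decoding (D := W → Matrix (Fin (α / m)) (Fin (γ / n)) F)
      (X'.x_injective.injOn (s := (W' : Set (Fin K))))
      (fun k => ∏ r, ∏ q, (X'.x k - X'.f r q) ^ Q.size q)
      hLm (hW'T.le.trans hTN) hM (fun l hl => by rw [hLd]; exact (mem_filter.1 hl).2)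
      (X'.contribution P ρ) hE (FCCData.targets R Q)
      (fun l _ c hc => X'.eq_zero_of_dvd_sum_contribution P ρ hc)
      (fun k Y => if h : k ∈ W then Y ⟨k, h⟩ u w else 0)
  choose g hg _ using fun s : S => Q.covers s.1 s.2
  have hmem : ∀ (s : S) (r : Fin R), (r, g s) ∈ Λ ∧
      (s.1.1, s.1.2, r, r) ∈ FCCData.targets R Q (r, g s) := by
    intro s r
    refine ⟨mem_filter.2 ⟨mem_univ _, ?_⟩, FCCData.mem_targets.2 ⟨hg s, rfl, rfl⟩⟩
    have := card_pos.2 ⟨_, hg s⟩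
    rwa [card_product] at this
  refine ⟨fun Y s => Matrix.of fun i j =>
    ∑ r, X'.c r ((blockEquiv hm).symm i).1 ((blockEquiv hn).symm j).1 *
      z ((blockEquiv hm).symm i).2 ((blockEquiv hn).symm j).2 (r, g s) (s.1.1, s.1.2, r, r) Y,
    ?_, ?_⟩
  · intro A B
    ext s i j
    simp only [Matrix.of_apply]
    conv_rhs => rw [← blockIndex_symm hm i, ← blockIndex_symm hn j, X'.bilinear.mul_blocks hp]
    refine sum_congr rfl fun r _ => ?_
    congr 1
    refine hz' _ _ _ (fun t => (combineBlocks (X'.a t.2.2.1) (A t.1) *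
      combineBlocks (X'.b t.2.2.2) (B t.2.1)) ((blockEquiv hm).symm i).2
        ((blockEquiv hn).symm j).2) ?_ (r, g s) (hmem s r).1 _ (hmem s r).2
    intro k hk
    rw [dif_pos (hW'W hk)]
    exact X'.mul_response_eq_eval P hρ k A B _ _
  · set base := Set.range fun (e : W × Fin (α / m) × Fin (γ / n))
      (Y : W → Matrix (Fin (α / m)) (Fin (γ / n)) F) => Y e.1 e.2.1 e.2.2 with hbase
    have hcost : ∑ l ∈ Λ, (FCCData.targets R Q l).card * (2 * (L l).natDegree) ≤
        2 * (R * ∑ q, Q.size q ^ 2) := by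
      calc _ ≤ ∑ l ∈ Λ, 2 * Q.size l.2 ^ 2 := by
            refine sum_le_sum fun l _ => ?_
            rw [hLd, pow_two, mul_left_comm]
            exact Nat.mul_le_mul_left _ (Nat.mul_le_mul_right _ (FCCData.card_targets_le l))
        _ ≤ ∑ l : Fin R × Fin N, 2 * Q.size l.2 ^ 2 :=
            sum_le_univ_sum_of_nonneg fun _ => Nat.zero_le _
        _ = _ := by
            rw [Fintype.sum_prod_type]
            simp only [sum_const, card_univ, Fintype.card_fin, smul_eq_mul, ← mul_sum]
            ring
    have c1 := Computes.biUnion (base := base) (univ : Finset (Fin (α / m) × Fin (γ / n)))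
      (fun e => {f | ∃ l ∈ Λ, ∃ t ∈ FCCData.targets R Q l, f = z e.1 e.2 l t})
      (fun _ => N' * treeFactor N' + 2 * (R * ∑ q, Q.size q ^ 2)) (by
        rintro ⟨u, w⟩ -
        refine ((hz u w).mono_cost (Nat.add_le_add_left hcost _)).mono_base ?_
        rintro _ ⟨k, hk, rfl⟩
        exact ⟨(⟨k, hW'W hk⟩, u, w), by ext Y; simp [hW'W hk]⟩)
    have c2 := c1.trans (Computes.family (univ : Finset (S × Fin α × Fin γ)) (fun e Y =>
      ∑ r, X'.c r ((blockEquiv hm).symm e.2.1).1 ((blockEquiv hn).symm e.2.2).1 *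
        z ((blockEquiv hm).symm e.2.1).2 ((blockEquiv hn).symm e.2.2).2 (r, g e.1)
          (e.1.1.1, e.1.1.2, r, r) Y) (t := 2 * R) (by
        rintro ⟨s, i, j⟩ -
        have := Computes.linear (base := {f | ∃ e ∈ (univ : Finset (Fin (α / m) × Fin (γ / n))),
            f ∈ {f | ∃ l ∈ Λ, ∃ t ∈ FCCData.targets R Q l, f = z e.1 e.2 l t}}) univ
          (fun r => X'.c r ((blockEquiv hm).symm i).1 ((blockEquiv hn).symm j).1)
          (fun r => z ((blockEquiv hm).symm i).2 ((blockEquiv hn).symm j).2 (r, g s)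
            (s.1.1, s.1.2, r, r)) (fun r _ => ⟨(_, _), mem_univ _, (r, g s), (hmem s r).1, _,
              (hmem s r).2, rfl⟩)
        simpa using this))
    refine (c2.mono_cost ?_).mono_out ?_
    · simp
    · rintro _ ⟨e, rfl⟩
      exact ⟨e, mem_univ _, rfl⟩

end Decoding

/-! ### Costs of encoding and of the workers -/

section Encoding

open Finset

variable {F : Type*} [Field F]

/-- The cost of evaluating a family of encoding functions: the combinations of the blocks are
computed once and for all. -/
theorem computes_encoding {κ : Type*} [Fintype κ] {d e m p R L ρ : ℕ} (hm : m ∣ d) (hp : p ∣ e)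
    (a : Fin R → Matrix (Fin m) (Fin p) F) (I : κ → Finset (Fin R)) (hI : ∀ k, (I k).card = ρ)
    (w : κ → Fin L → Fin R → F) :
    Computes (Set.range fun (x : Fin L × Fin d × Fin e)
        (A : Fin L → Matrix (Fin d) (Fin e) F) => A x.1 x.2.1 x.2.2)
      {f | ∃ k u v, f = fun A => ∑ i, ∑ r ∈ I k, w k i r * combineBlocks (a r) (A i) u v}
      (2 * (d * e * L * R) + Fintype.card κ * ((d / m) * (e / p)) * (2 * (L * ρ))) := by
  have c1 := Computes.family (base := Set.range fun (x : Fin L × Fin d × Fin e)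
      (A : Fin L → Matrix (Fin d) (Fin e) F) => A x.1 x.2.1 x.2.2)
    (univ : Finset (Fin L × Fin R × Fin (d / m) × Fin (e / p)))
    (fun x A => combineBlocks (a x.2.1) (A x.1) x.2.2.1 x.2.2.2) (t := 2 * (m * p)) (by
      rintro ⟨i, r, u, v⟩ -
      have := Computes.linear (base := Set.range fun (x : Fin L × Fin d × Fin e)
          (A : Fin L → Matrix (Fin d) (Fin e) F) => A x.1 x.2.1 x.2.2)
        (univ : Finset (Fin m × Fin p)) (fun x => a r x.1 x.2)
        (fun x A => A i (blockIndex x.1 u) (blockIndex x.2 v))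
        (fun x _ => ⟨(i, blockIndex x.1 u, blockIndex x.2 v), rfl⟩)
      simpa [combineBlocks_apply, Fintype.sum_prod_type] using this)
  have c2 := c1.trans (Computes.family (univ : Finset (κ × Fin (d / m) × Fin (e / p)))
    (fun x A => ∑ i, ∑ r ∈ I x.1, w x.1 i r * combineBlocks (a r) (A i) x.2.1 x.2.2)
    (t := 2 * (L * ρ)) (by
      rintro ⟨k, u, v⟩ -
      have := Computes.linear (base := {f | ∃ x ∈ (univ : Finset (Fin L × Fin R × Fin (d / m) ×
          Fin (e / p))), f = (fun x (A : Fin L → Matrix (Fin d) (Fin e) F) =>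
            combineBlocks (a x.2.1) (A x.1) x.2.2.1 x.2.2.2) x})
        ((univ : Finset (Fin L)) ×ˢ I k) (fun x => w k x.1 x.2)
        (fun x A => combineBlocks (a x.2) (A x.1) u v)
        (fun x _ => ⟨(x.1, x.2, u, v), mem_univ _, rfl⟩)
      simpa [sum_product, hI] using this))
  refine (c2.mono_cost ?_).mono_out ?_
  · refine Nat.add_le_add (le_of_eq ?_) (le_of_eq ?_)
    · simp only [card_univ, Fintype.card_prod, Fintype.card_fin]
      conv_rhs => rw [← Nat.mul_div_cancel' hm, ← Nat.mul_div_cancel' hp]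
      ring
    · simp only [card_univ, Fintype.card_prod, Fintype.card_fin]
  · rintro _ ⟨k, u, v, rfl⟩
    exact ⟨(k, u, v), mem_univ _, rfl⟩

variable {m p n R N K : ℕ} {LA LB : ℕ} {S : Finset (Fin LA × Fin LB)} {Q : TaskAssignment S N}

namespace FCCData

theorem encodeA_apply (X' : FCCData F m p n R N K) (P : PowerAssignment Q) {ρ α β : ℕ}
    (A : Fin LA → Matrix (Fin α) (Fin β) F) (h : Fin (R / ρ)) (z : F) (u : Fin (α / m))
    (v : Fin (β / p)) :
    X'.encodeA P ρ A h z u v = ∑ i, ∑ r ∈ instances R ρ h,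
      ((∏ q, ∏ r ∈ instances R ρ h, (z - X'.f r q) ^ Q.size q) *
        (∏ q, (z - X'.f r q) ^ P.powA q i)⁻¹) * combineBlocks (X'.a r) (A i) u v := by
  simp only [encodeA, Matrix.smul_apply, Matrix.sum_apply, smul_eq_mul, mul_sum, mul_assoc]

theorem encodeB_apply (X' : FCCData F m p n R N K) (P : PowerAssignment Q) {ρ β γ : ℕ}
    (B : Fin LB → Matrix (Fin β) (Fin γ) F) (h : Fin (R / ρ)) (z : F) (v : Fin (β / p))
    (w : Fin (γ / n)) :
    X'.encodeB P ρ B h z v w = ∑ j, ∑ r ∈ instances R ρ h,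
      (∏ q, (z - X'.f r q) ^ P.powB q j)⁻¹ * combineBlocks (X'.b r) (B j) v w := by
  simp only [encodeB, Matrix.smul_apply, Matrix.sum_apply, smul_eq_mul]

theorem encodesAIn (X' : FCCData F m p n R N K) (P : PowerAssignment Q) {ρ α β γ : ℕ} (dec)
    (hρ : ρ ∣ R) (hm : m ∣ α) (hp : p ∣ β) :
    (X'.code P ρ α β γ dec).EncodesAIn (2 * (α * β * LA * R) +
      K * (R / ρ) * ((α / m) * (β / p)) * (2 * (LA * ρ))) := by
  refine Computes.arithComputable ?_
  have := computes_encoding (κ := Fin K × Fin (R / ρ)) (L := LA) hm hp X'.a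
    (fun k => instances R ρ k.2) (fun k => card_group hρ k.2.isLt)
    (fun k i r => (∏ q, ∏ r ∈ instances R ρ k.2, (X'.x k.1 - X'.f r q) ^ Q.size q) *
      (∏ q, (X'.x k.1 - X'.f r q) ^ P.powA q i)⁻¹)
  refine (this.mono_cost (by simp)).mono_out ?_
  rintro _ ⟨⟨k, u, v⟩, rfl⟩
  refine ⟨(k, (finProdFinEquiv.symm v).1), u, (finProdFinEquiv.symm v).2, ?_⟩
  ext A
  exact X'.encodeA_apply P A (finProdFinEquiv.symm v).1 (X'.x k) u (finProdFinEquiv.symm v).2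

theorem encodesBIn (X' : FCCData F m p n R N K) (P : PowerAssignment Q) {ρ α β γ : ℕ} (dec)
    (hρ : ρ ∣ R) (hp : p ∣ β) (hn : n ∣ γ) :
    (X'.code P ρ α β γ dec).EncodesBIn (2 * (β * γ * LB * R) +
      K * (R / ρ) * ((β / p) * (γ / n)) * (2 * (LB * ρ))) := by
  refine Computes.arithComputable ?_
  have := computes_encoding (κ := Fin K × Fin (R / ρ)) (L := LB) hp hn X'.b
    (fun k => instances R ρ k.2) (fun k => card_group hρ k.2.isLt)
    (fun k j r => (∏ q, (X'.x k.1 - X'.f r q) ^ P.powB q j)⁻¹)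
  refine (this.mono_cost (by simp)).mono_out ?_
  rintro _ ⟨⟨k, v, w⟩, rfl⟩
  refine ⟨(k, (finProdFinEquiv.symm v).1), (finProdFinEquiv.symm v).2, w, ?_⟩
  ext B
  exact X'.encodeB_apply P B (finProdFinEquiv.symm v).1 (X'.x k) (finProdFinEquiv.symm v).2 w

theorem worksIn (X' : FCCData F m p n R N K) (P : PowerAssignment Q) {ρ α β γ : ℕ} (dec)
    (k : Fin K) :
    (X'.code P ρ α β γ dec).WorksIn k ((α / m) * (γ / n) * (R / ρ * (β / p) * 2)) := by
  refine Computes.arithComputable ?_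
  set base := Set.range (Sum.elim
    (fun (e : Fin (α / m) × Fin (R / ρ * (β / p)))
      (M : Matrix (Fin (α / m)) (Fin (R / ρ * (β / p))) F ×
        Matrix (Fin (R / ρ * (β / p))) (Fin (γ / n)) F) => M.1 e.1 e.2)
    (fun (e : Fin (R / ρ * (β / p)) × Fin (γ / n)) M => M.2 e.1 e.2)) with hbase
  have hA (u : Fin (α / m)) (v : Fin (R / ρ * (β / p))) : (fun M : Matrix (Fin (α / m))
      (Fin (R / ρ * (β / p))) F × Matrix (Fin (R / ρ * (β / p))) (Fin (γ / n)) F =>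
        M.1 u v) ∈ base := ⟨.inl (u, v), rfl⟩
  have hB (v : Fin (R / ρ * (β / p))) (w : Fin (γ / n)) : (fun M : Matrix (Fin (α / m))
      (Fin (R / ρ * (β / p))) F × Matrix (Fin (R / ρ * (β / p))) (Fin (γ / n)) F =>
        M.2 v w) ∈ base := ⟨.inr (v, w), rfl⟩
  have := Computes.family (base := base) (univ : Finset (Fin (α / m) × Fin (γ / n)))
    (fun e M => ∑ v, M.1 e.1 v * M.2 v e.2) (t := R / ρ * (β / p) * 2) (by
      rintro ⟨u, w⟩ -
      have := Computes.sum (base := base) (t := 1) (univ : Finset (Fin (R / ρ * (β / p))))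
        (fun v M => M.1 u v * M.2 v w) (fun v _ => Computes.mul (hA u v) (hB v w))
      simpa using this)
  refine (this.mono_cost (by simp)).mono_out ?_
  rintro _ ⟨⟨u, w⟩, rfl⟩
  exact ⟨(u, w), mem_univ _, rfl⟩

end FCCData

end Encoding

/-! ### Existence of the data, and the size of the threshold -/

section Existence

open Finset

theorem exists_isBilinearAlgorithm (F : Type*) [Field F] (m p n : ℕ) :
    ∃ (a : Fin (bilinearComplexity F m p n) → Matrix (Fin m) (Fin p) F)
      (b : Fin (bilinearComplexity F m p n) → Matrix (Fin p) (Fin n) F)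
      (c : Fin (bilinearComplexity F m p n) → Matrix (Fin m) (Fin n) F),
      IsBilinearAlgorithm a b c := by
  refine Nat.sInf_mem (s := {R | ∃ (a : Fin R → Matrix (Fin m) (Fin p) F)
    (b : Fin R → Matrix (Fin p) (Fin n) F) (c : Fin R → Matrix (Fin m) (Fin n) F),
    IsBilinearAlgorithm a b c}) ?_
  -- the standard algorithm
  let e := (Fintype.equivFin (Fin m × Fin p × Fin n)).symm
  refine ⟨_, fun i => Matrix.single (e i).1 (e i).2.1 1,
    fun i => Matrix.single (e i).2.1 (e i).2.2 1, fun i => Matrix.single (e i).1 (e i).2.2 1, ?_⟩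
  intro A B j k
  rw [e.sum_comp (fun t => Matrix.single t.1 t.2.2 (1 : F) j k *
    (∑ q, ∑ r, Matrix.single t.1 t.2.1 (1 : F) q r * A q r) *
    (∑ r, ∑ s, Matrix.single t.2.1 t.2.2 (1 : F) r s * B r s))]
  simp [Fintype.sum_prod_type, Matrix.single_apply, ite_and, Matrix.mul_apply]

theorem bilinearComplexity_pos (F : Type*) [Field F] {m p n : ℕ} (hm : 0 < m) (hp : 0 < p)
    (hn : 0 < n) : 0 < bilinearComplexity F m p n := by
  obtain ⟨a, b, c, h⟩ := exists_isBilinearAlgorithm F m p n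
  by_contra! h0
  have : IsEmpty (Fin (bilinearComplexity F m p n)) := by
    rw [Nat.le_zero.1 h0]; infer_instance
  have h1 := h (Matrix.single ⟨0, hm⟩ ⟨0, hp⟩ 1) (Matrix.single ⟨0, hp⟩ ⟨0, hn⟩ 1) ⟨0, hm⟩ ⟨0, hn⟩
  rw [Finset.univ_eq_empty, Finset.sum_empty, Matrix.single_mul_single_same] at h1
  simp at h1

theorem nonempty_fccData (F : Type*) [Field F] [Fintype F] {m p n N K : ℕ}
    (h : bilinearComplexity F m p n * N + K ≤ Fintype.card F) :
    Nonempty (FCCData F m p n (bilinearComplexity F m p n) N K) := by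
  obtain ⟨a, b, c, habc⟩ := exists_isBilinearAlgorithm F m p n
  obtain ⟨φ⟩ := Function.Embedding.nonempty_of_card_le
    (α := (Fin (bilinearComplexity F m p n) × Fin N) ⊕ Fin K) (β := F) (by simpa using h)
  exact ⟨⟨a, b, c, habc, fun r q => φ (.inl (r, q)), fun k => φ (.inr k), by
    convert φ.injective using 1
    ext t
    rcases t with t | k <;> rfl⟩⟩

variable {LA LB N : ℕ} {S : Finset (Fin LA × Fin LB)} {Q : TaskAssignment S N}

/-- The threshold is positive, and not much smaller than the number of pole orders. -/
theorem exists_eq_fcsaThreshold (P : PowerAssignment Q) {R ρ : ℕ} (hS : S.Nonempty) (hR : 0 < R)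
    (hρ : 0 < ρ) : ∃ T : ℕ, (T : ℤ) = fcsaThreshold P R ρ ∧ 0 < T ∧
      R * ∑ q, Q.size q + 1 ≤ T + univ.sup Q.size := by
  obtain ⟨⟨i, j⟩, -⟩ := hS
  have h1 : (⨅ i, ∑ q, P.powA q i) ≤ ∑ q, P.powA q i := ciInf_le (OrderBot.bddBelow _) i
  have h2 : (⨅ j, ∑ q, P.powB q j) ≤ ∑ q, P.powB q j := ciInf_le (OrderBot.bddBelow _) j
  have h3 := P.sum_pow_le (i := i) (j := j) (s := univ.sup Q.size)
    (fun q => le_sup (mem_univ q))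
  have h4 : univ.sup Q.size ≤ ∑ q, Q.size q :=
    Finset.sup_le fun q hq => single_le_sum_of_canonicallyOrdered hq
  have h5 : ∑ q, Q.size q ≤ R * ∑ q, Q.size q := Nat.le_mul_of_pos_left _ hR
  have h6 : ∑ q, Q.size q ≤ ρ * ∑ q, Q.size q := Nat.le_mul_of_pos_left _ hρ
  have h7 : fcsaThreshold P R ρ = ((R * ∑ q, Q.size q : ℕ) : ℤ) + (ρ * ∑ q, Q.size q : ℕ) -
      ((⨅ i, ∑ q, P.powA q i : ℕ) : ℤ) - ((⨅ j, ∑ q, P.powB q j : ℕ) : ℤ) + 1 := by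
    rw [fcsaThreshold]
    push_cast
    ring
  refine ⟨(fcsaThreshold P R ρ).toNat, ?_, ?_, ?_⟩ <;> omega

theorem sup_size_sq_le (Q : TaskAssignment S N) : (univ.sup Q.size) ^ 2 ≤ ∑ q, Q.size q ^ 2 := by
  rcases (univ : Finset (Fin N)).eq_empty_or_nonempty with h | h
  · rw [h]; simp
  · obtain ⟨q, hq, hqs⟩ := exists_mem_eq_sup univ h Q.size
    rw [hqs]
    exact single_le_sum_of_canonicallyOrdered (f := fun q => Q.size q ^ 2) hq

end Existence

/-! ### The size of the decoding cost -/

section Estimates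

open Finset

theorem add_one_pow_three_le (l : ℕ) : (l + 1) ^ 3 ≤ 8 * 2 ^ l := by
  rcases lt_or_ge l 4 with h | h
  · interval_cases l <;> norm_num
  · induction l, h using Nat.le_induction with
    | base => norm_num
    | succ l hl ih =>
      rw [pow_succ 2 l]
      nlinarith [mul_le_mul hl hl (by norm_num) (by omega), mul_le_mul hl (mul_le_mul hl hl
        (by norm_num) (by omega)) (by norm_num) (by omega)]

/-- A crude bound, used when the number of unknowns is dominated by a single task group. -/
theorem treeFactor_le (n : ℕ) (hn : n ≠ 0) : treeFactor n ≤ 403200 * n := by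
  set l := Nat.log 2 n with hl
  have h1 : Nat.log 2 l ≤ l := Nat.log_le_self 2 l
  have h2 : (l + 1) ^ 3 ≤ 8 * n :=
    (add_one_pow_three_le l).trans (Nat.mul_le_mul_left _ (Nat.pow_log_le_self 2 hn))
  have h3 : l * Nat.log 2 l ≤ l * l := Nat.mul_le_mul_left _ h1
  calc treeFactor n = 50400 * ((l + 1) * (l * Nat.log 2 l + 2 * l + 1)) := by
        rw [treeFactor, mulFactor, logFactor, ← hl]; ring
    _ ≤ 50400 * ((l + 1) * (l * l + 2 * l + 1)) := by gcongr
    _ = 50400 * (l + 1) ^ 3 := by ring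
    _ ≤ 50400 * (8 * n) := by gcongr
    _ = 403200 * n := by ring

/-- The bound of `treeFactor` in terms of the logarithms in the decoding complexity. -/
theorem treeFactor_le_logb {T n : ℕ} (hT : 4 ≤ T) (hn : n ≤ 2 * T) :
    (treeFactor n : ℝ) ≤ 705600 * (Real.logb 2 T ^ 2 * Real.logb 2 (Real.logb 2 T)) := by
  set L := Real.logb 2 T with hL
  set M := Real.logb 2 L with hM
  have hT' : (4 : ℝ) ≤ T := by exact_mod_cast hT
  have h2L : 2 ≤ L := by
    rw [hL, Real.le_logb_iff_rpow_le (by norm_num) (by linarith)]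
    norm_num
    exact_mod_cast hT
  have h1M : 1 ≤ M := by
    rw [hM, Real.le_logb_iff_rpow_le (by norm_num) (by linarith)]
    simpa using h2L
  have hl : (Nat.log 2 n : ℝ) ≤ L + 1 := by
    have h1 : Nat.log 2 n ≤ Nat.log 2 T + 1 := by
      rw [← Nat.log_mul_base (by norm_num) (by omega : T ≠ 0), mul_comm T 2]
      exact Nat.log_mono_right hn
    have h2 : (Nat.log 2 T : ℝ) ≤ L := Real.natLog_le_logb T 2
    have h3 : (Nat.log 2 n : ℝ) ≤ Nat.log 2 T + 1 := by exact_mod_cast h1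
    linarith
  set l := Nat.log 2 n with hl'
  have hll : (Nat.log 2 l : ℝ) ≤ 2 * M := by
    rcases Nat.eq_zero_or_pos l with h0 | h0
    · rw [h0]
      simp only [Nat.log_zero_right, Nat.cast_zero]
      linarith
    · have h1 : (Nat.log 2 l : ℝ) ≤ Real.logb 2 l := Real.natLog_le_logb l 2
      have h2 : Real.logb 2 l ≤ Real.logb 2 (2 * L) :=
        Real.logb_le_logb_of_le (by norm_num) (by exact_mod_cast h0) (by linarith)
      rw [Real.logb_mul (by norm_num) (by linarith), Real.logb_self_eq_one (by norm_num)] at h2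
      linarith
  have h0 : (0 : ℝ) ≤ l := Nat.cast_nonneg l
  have h1 : (l : ℝ) * Nat.log 2 l ≤ (L + 1) * (2 * M) :=
    mul_le_mul hl hll (Nat.cast_nonneg _) (by linarith)
  have h2 : (l : ℝ) * Nat.log 2 l + 2 * l + 1 ≤ 7 * (L * M) := by
    nlinarith [mul_nonneg (by linarith : (0 : ℝ) ≤ L - 2) (by linarith : (0 : ℝ) ≤ M - 1)]
  calc (treeFactor n : ℝ) = 50400 * (((l : ℝ) + 1) * (l * Nat.log 2 l + 2 * l + 1)) := by
        rw [treeFactor, mulFactor, logFactor, ← hl']; push_cast; ring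
    _ ≤ 50400 * ((2 * L) * (7 * (L * M))) := by
        gcongr
        linarith
    _ = 705600 * (L ^ 2 * M) := by ring

theorem logb_term_nonneg (T : ℕ) :
    0 ≤ (T : ℝ) * Real.logb 2 T ^ 2 * Real.logb 2 (Real.logb 2 T) := by
  rcases Nat.lt_or_ge T 2 with h | h
  · interval_cases T <;> simp
  · have h1 : 1 ≤ Real.logb 2 T := by
      rw [Real.le_logb_iff_rpow_le (by norm_num) (by positivity)]
      simpa using (by exact_mod_cast h : (2 : ℝ) ≤ T)
    exact mul_nonneg (by positivity) (Real.logb_nonneg (by norm_num) h1)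

/-- The number `n` of values and unknowns exceeds twice the threshold `T` only if the size `s` of
one task group does so, and then the quadratic term of the local systems pays for the trees. -/
theorem mul_treeFactor_le {T s n : ℕ} {V : ℝ} (hT : 0 < T) (hn0 : n ≠ 0)
    (hn : n ≤ 2 * max T s) (hV : (s : ℝ) ^ 2 ≤ V) (hV1 : 1 ≤ V) :
    (n : ℝ) * treeFactor n ≤ 15000000 *
      ((T : ℝ) * Real.logb 2 T ^ 2 * Real.logb 2 (Real.logb 2 T) + V) := by
  have hlog := logb_term_nonneg T
  have hcrude : (n : ℝ) * treeFactor n ≤ 403200 * (n : ℝ) ^ 2 := by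
    have : (treeFactor n : ℝ) ≤ 403200 * n := by exact_mod_cast treeFactor_le n hn0
    nlinarith [(Nat.cast_nonneg n : (0 : ℝ) ≤ n)]
  rcases le_total T s with h | h
  · rw [max_eq_right h] at hn
    have h1 : (n : ℝ) ≤ 2 * s := by exact_mod_cast hn
    have h2 : (n : ℝ) ^ 2 ≤ (2 * s) ^ 2 := by gcongr
    nlinarith
  · rw [max_eq_left h] at hn
    rcases Nat.lt_or_ge T 4 with h4 | h4
    · have h1 : (n : ℝ) ≤ 6 := by exact_mod_cast (by omega : n ≤ 6)
      have h2 : (n : ℝ) ^ 2 ≤ 6 ^ 2 := by gcongr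
      nlinarith
    · have h1 := treeFactor_le_logb h4 hn
      have h2 : (n : ℝ) ≤ 2 * T := by exact_mod_cast hn
      have h3 := mul_le_mul h2 h1 (Nat.cast_nonneg _) (by positivity)
      nlinarith

end Estimates

/-! ### Thresholds, costs and the achievability theorem -/

section Achievability

open Finset

variable {F : Type*} [Field F] {m p n R N K : ℕ} {LA LB : ℕ} {S : Finset (Fin LA × Fin LB)}
  {Q : TaskAssignment S N}

namespace FCCData

/-- Decoding functions for all sets of responding workers. Sets with fewer than `T` elements are
answered by a fixed non-zero matrix, which is wrong for vanishing inputs; so the recovery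
threshold is not smaller than `T`, even if fewer responses happen to determine the products. -/
theorem exists_decoders (X' : FCCData F m p n R N K) (P : PowerAssignment Q) {ρ : ℕ}
    (hρ : ρ ∣ R) {α β γ : ℕ} (hm : m ∣ α) (hp : p ∣ β) (hn : n ∣ γ) {T n' : ℕ}
    (hT : (T : ℤ) = fcsaThreshold P R ρ) (hTn : T ≤ n') (hMn : R * ∑ q, Q.size q ≤ n') :
    ∃ dec : (W : Finset (Fin K)) → (W → Matrix (Fin (α / m)) (Fin (γ / n)) F) →
        S → Matrix (Fin α) (Fin γ) F,
      (X'.code P ρ α β γ dec).RecoversFrom T ∧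
      (∀ W, W.card < T → ∀ C s, dec W C s = Matrix.of fun _ _ => 1) ∧
      ∀ W, T ≤ W.card → (X'.code P ρ α β γ dec).DecodesIn W
        ((α / m) * (γ / n) * (n' * treeFactor n' + 2 * (R * ∑ q, Q.size q ^ 2)) +
          S.card * (α * γ) * (2 * R)) := by
  choose d hd using fun W hW => X'.exists_decoder P hρ hm hp hn hT hTn hMn W hW
  refine ⟨fun W C s => if h : T ≤ W.card then d W h C s else Matrix.of fun _ _ => 1, ?_, ?_, ?_⟩
  · intro W hW A B
    have h1 : (fun k : W => (X'.code P ρ α β γ fun W C s =>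
        if h : T ≤ W.card then d W h C s else Matrix.of fun _ _ => 1).encA k A *
        (X'.code P ρ α β γ fun W C s =>
        if h : T ≤ W.card then d W h C s else Matrix.of fun _ _ => 1).encB k B) =
        fun k : W => X'.response P ρ A B (X'.x k) :=
      funext fun k => X'.encA_mul_encB P ρ α β γ _ k A B
    rw [h1]
    exact (funext fun s => dif_pos hW).trans ((hd W hW).1 A B)
  · intro W hW C s
    exact dif_neg hW.not_ge
  · intro W hW
    refine Computes.arithComputable (((hd W hW).2.mono_base ?_).mono_out ?_)
    · rintro _ ⟨⟨k, u, v⟩, rfl⟩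
      exact ⟨⟨k, u, v⟩, rfl⟩
    · rintro _ ⟨⟨s, u, v⟩, rfl⟩
      refine ⟨(s, u, v), ?_⟩
      funext C
      change _ = (if h : T ≤ W.card then d W h C s else _) u v
      rw [dif_pos hW]

theorem recoveryThreshold_eq (X' : FCCData F m p n R N K) (P : PowerAssignment Q) {ρ α β γ T : ℕ}
    {dec : (W : Finset (Fin K)) → (W → Matrix (Fin (α / m)) (Fin (γ / n)) F) →
      S → Matrix (Fin α) (Fin γ) F} (hS : S.Nonempty) (hα : 0 < α) (hγ : 0 < γ)
    (hrec : (X'.code P ρ α β γ dec).RecoversFrom T)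
    (hjunk : ∀ W, W.card < T → ∀ C s, dec W C s = Matrix.of fun _ _ => 1) (hTK : T ≤ K) :
    (X'.code P ρ α β γ dec).recoveryThreshold = T := by
  refine le_antisymm (Nat.sInf_le hrec) (le_csInf ⟨T, hrec⟩ fun T' hT' => ?_)
  by_contra! hlt
  obtain ⟨W, -, hW⟩ := exists_subset_card_eq
    (s := (univ : Finset (Fin K))) (n := T') (by simpa using (hlt.trans_le hTK).le)
  obtain ⟨s, hs⟩ := hS
  have h1 := congrFun (hT' W hW.ge 0 0) ⟨s, hs⟩
  have h2 := (hjunk W (hW ▸ hlt) _ ⟨s, hs⟩).symm.trans h1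
  have h3 := congrFun (congrFun h2 ⟨0, hα⟩) ⟨0, hγ⟩
  simp at h3

theorem downloadCost_eq (X' : FCCData F m p n R N K) (P : PowerAssignment Q) {ρ α β γ T : ℕ}
    {dec : (W : Finset (Fin K)) → (W → Matrix (Fin (α / m)) (Fin (γ / n)) F) →
      S → Matrix (Fin α) (Fin γ) F} (hT : 0 < T) (hTK : T ≤ K)
    (h : (X'.code P ρ α β γ dec).recoveryThreshold = T) :
    (X'.code P ρ α β γ dec).downloadCost = ((α / m : ℕ) : ℝ) * (γ / n : ℕ) := by
  obtain ⟨W, -, hW⟩ := exists_subset_card_eq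
    (s := (univ : Finset (Fin K))) (n := T) (by simpa using hTK)
  have : Nonempty {W : Finset (Fin K) //
      W.card = (X'.code P ρ α β γ dec).recoveryThreshold} := ⟨⟨W, hW.trans h.symm⟩⟩
  have hT' : (T : ℝ) ≠ 0 := Nat.cast_ne_zero.2 hT.ne'
  have key : ∀ W : {W : Finset (Fin K) // W.card = (X'.code P ρ α β γ dec).recoveryThreshold},
      (∑ k ∈ W.1, ((X'.code P ρ α β γ dec).rows k : ℝ) * ((X'.code P ρ α β γ dec).cols k : ℝ)) /
        ((X'.code P ρ α β γ dec).recoveryThreshold : ℝ) = ((α / m : ℕ) : ℝ) * (γ / n : ℕ) := by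
    intro W
    change (∑ k ∈ W.1, ((α / m : ℕ) : ℝ) * ((γ / n : ℕ) : ℝ)) / _ = _
    rw [sum_const, W.2, h, nsmul_eq_mul, mul_div_cancel_left₀ _ hT']
  rw [VCDBMMCode.downloadCost, iSup_congr key, ciSup_const]

theorem uploadCostA_eq (X' : FCCData F m p n R N K) (P : PowerAssignment Q) {ρ α β γ : ℕ} (dec)
    (hK : 0 < K) : (X'.code P ρ α β γ dec).uploadCostA =
      ((α / m : ℕ) : ℝ) * ((R / ρ : ℕ) * (β / p : ℕ)) := by
  have hK' : (K : ℝ) ≠ 0 := Nat.cast_ne_zero.2 hK.ne'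
  change (1 / (K : ℝ)) * ∑ _k : Fin K, ((α / m : ℕ) : ℝ) * ((R / ρ * (β / p) : ℕ) : ℝ) = _
  rw [sum_const, card_univ, Fintype.card_fin, nsmul_eq_mul, Nat.cast_mul]
  field_simp

theorem uploadCostB_eq (X' : FCCData F m p n R N K) (P : PowerAssignment Q) {ρ α β γ : ℕ} (dec)
    (hK : 0 < K) : (X'.code P ρ α β γ dec).uploadCostB =
      ((R / ρ : ℕ) * (β / p : ℕ) : ℝ) * (γ / n : ℕ) := by
  have hK' : (K : ℝ) ≠ 0 := Nat.cast_ne_zero.2 hK.ne'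
  change (1 / (K : ℝ)) * ∑ _k : Fin K, ((R / ρ * (β / p) : ℕ) : ℝ) * ((γ / n : ℕ) : ℝ) = _
  rw [sum_const, card_univ, Fintype.card_fin, nsmul_eq_mul, Nat.cast_mul]
  field_simp

end FCCData

end Achievability

theorem theorem2 :
    ∃ C : ℝ, ∀ (F : Type*) [Field F] [Fintype F] (LA LB α β γ K N m p n R ρ : ℕ)
      (S : Finset (Fin LA × Fin LB)) (Q : TaskAssignment S N) (P : PowerAssignment Q),
      S.Nonempty → 0 < α → 0 < β → 0 < γ → 0 < K → 0 < m → 0 < p → 0 < n →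
      m ∣ α → p ∣ β → n ∣ γ →
      R = bilinearComplexity F m p n → ρ ∣ R →
      R * N + K < Fintype.card F →
      ∃ T : ℕ, (T : ℤ) = fcsaThreshold P R ρ ∧
        Nonempty (FCCData F m p n R N K) ∧
        ∀ X : FCCData F m p n R N K,
          ∃ dec : (W : Finset (Fin K)) → (W → Matrix (Fin (α / m)) (Fin (γ / n)) F) →
              S → Matrix (Fin α) (Fin γ) F,
            -- recovery threshold and download cost
            (X.code P ρ α β γ dec).RecoversFrom T ∧
            (T ≤ K → (X.code P ρ α β γ dec).recoveryThreshold = T ∧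
              (X.code P ρ α β γ dec).downloadCost = (α * γ : ℝ) / (m * n)) ∧
            -- upload costs
            (X.code P ρ α β γ dec).uploadCostA = (R / ρ : ℝ) * ((α * β : ℝ) / (m * p)) ∧
            (X.code P ρ α β γ dec).uploadCostB = (R / ρ : ℝ) * ((β * γ : ℝ) / (p * n)) ∧
            -- encoding complexities
            (∃ t : ℕ, (X.code P ρ α β γ dec).EncodesAIn t ∧
              (t : ℝ) ≤ C * (α * β * LA * R * ((K : ℝ) / (m * p) + 1))) ∧
            (∃ t : ℕ, (X.code P ρ α β γ dec).EncodesBIn t ∧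
              (t : ℝ) ≤ C * (β * γ * LB * R * ((K : ℝ) / (n * p) + 1))) ∧
            -- worker complexity
            (∃ t : Fin K → ℕ, (∀ k, (X.code P ρ α β γ dec).WorksIn k (t k)) ∧
              (1 / (K : ℝ)) * ∑ k, (t k : ℝ) ≤
                C * ((R / ρ : ℝ) * ((α * β * γ : ℝ) / (m * p * n)))) ∧
            -- decoding complexity
            (∀ W : Finset (Fin K), W.card = T →
              ∃ t : ℕ, (X.code P ρ α β γ dec).DecodesIn W t ∧
                (t : ℝ) ≤ C * (α * γ * R * S.card) +
                  C * ((α * γ : ℝ) / (m * n) *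
                    (T * Real.logb 2 T ^ 2 * Real.logb 2 (Real.logb 2 T) +
                      R * ∑ q, (Q.size q : ℝ) ^ 2))) := by
  refine ⟨20000000, ?_⟩
  intro F _ _ LA LB α β γ K N m p n R ρ S Q P hS hα hβ hγ hK hm hp hn hmα hpβ hnγ hR hρ hcard
  have hR0 : 0 < R := hR ▸ bilinearComplexity_pos F hm hp hn
  have hρ0 : 0 < ρ := Nat.pos_of_dvd_of_pos hρ hR0
  obtain ⟨T, hT, hT0, hTM⟩ := exists_eq_fcsaThreshold P hS hR0 hρ0
  refine ⟨T, hT, ?_, fun X => ?_⟩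
  · subst hR
    exact nonempty_fccData F hcard.le
  have hmR : (m : ℝ) ≠ 0 := Nat.cast_ne_zero.2 hm.ne'
  have hpR : (p : ℝ) ≠ 0 := Nat.cast_ne_zero.2 hp.ne'
  have hnR : (n : ℝ) ≠ 0 := Nat.cast_ne_zero.2 hn.ne'
  have hρR : (ρ : ℝ) ≠ 0 := Nat.cast_ne_zero.2 hρ0.ne'
  have hKR : (K : ℝ) ≠ 0 := Nat.cast_ne_zero.2 hK.ne'
  have eα : ((α / m : ℕ) : ℝ) = α / m := Nat.cast_div hmα hmR
  have eβ : ((β / p : ℕ) : ℝ) = β / p := Nat.cast_div hpβ hpR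
  have eγ : ((γ / n : ℕ) : ℝ) = γ / n := Nat.cast_div hnγ hnR
  have eR : ((R / ρ : ℕ) : ℝ) = R / ρ := Nat.cast_div hρ hρR
  obtain ⟨dec, hrec, hjunk, hdec⟩ := X.exists_decoders P hρ hmα hpβ hnγ (β := β) hT
    (le_max_left T (R * ∑ q, Q.size q)) (le_max_right T (R * ∑ q, Q.size q))
  refine ⟨dec, hrec, fun hTK => ?_, ?_, ?_, ⟨_, X.encodesAIn P dec hρ hmα hpβ, ?_⟩,
    ⟨_, X.encodesBIn P dec hρ hpβ hnγ, ?_⟩, ⟨_, X.worksIn P dec, ?_⟩,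
    fun W hW => ⟨_, hdec W hW.ge, ?_⟩⟩
  · have h := X.recoveryThreshold_eq P hS hα hγ hrec hjunk hTK
    refine ⟨h, ?_⟩
    rw [X.downloadCost_eq P hT0 hTK h, eα, eγ]
    field_simp
  · rw [X.uploadCostA_eq P dec hK, eα, eβ, eR]
    field_simp
  · rw [X.uploadCostB_eq P dec hK, eγ, eβ, eR]
    field_simp
  · push_cast [eα, eβ, eR]
    calc _ = 2 * (α * β * LA * R * ((K : ℝ) / (m * p) + 1)) := by field_simp; ring
      _ ≤ _ := by gcongr; norm_num
  · push_cast [eγ, eβ, eR]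
    calc _ = 2 * (β * γ * LB * R * ((K : ℝ) / (n * p) + 1)) := by field_simp; ring
      _ ≤ _ := by gcongr; norm_num
  · rw [Finset.sum_const, Finset.card_univ, Fintype.card_fin, nsmul_eq_mul]
    push_cast [eα, eγ, eβ, eR]
    calc _ = 2 * ((R / ρ : ℝ) * ((α * β * γ : ℝ) / (m * p * n))) := by field_simp
      _ ≤ _ := by gcongr; norm_num
  · -- a non-empty `S` makes some group non-empty, so that the quadratic term is at least `1`
    obtain ⟨s, hs⟩ := hS
    obtain ⟨q, hq, -⟩ := Q.covers s hs
    have hq1 : 1 ≤ Q.size q := by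
      rw [TaskAssignment.size, ← Finset.card_product]
      exact Finset.card_pos.2 ⟨s, hq⟩
    have hV : (Finset.univ.sup Q.size) ^ 2 ≤ R * ∑ q, Q.size q ^ 2 :=
      (sup_size_sq_le Q).trans (Nat.le_mul_of_pos_left _ hR0)
    have hV1 : 1 ≤ R * ∑ q, Q.size q ^ 2 :=
      ((Nat.one_le_pow 2 _ hq1).trans (Nat.pow_le_pow_left (Finset.le_sup (Finset.mem_univ q)) 2)
        ).trans hV
    have hmain := mul_treeFactor_le (T := T) (s := Finset.univ.sup Q.size)
      (n := max T (R * ∑ q, Q.size q)) (V := R * ∑ q, (Q.size q : ℝ) ^ 2) hT0 (by omega)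
      (by omega) (by exact_mod_cast hV) (by exact_mod_cast hV1)
    have hVR : (1 : ℝ) ≤ R * ∑ q, (Q.size q : ℝ) ^ 2 := by exact_mod_cast hV1
    have hlog := logb_term_nonneg T
    set n' := max T (R * ∑ q, Q.size q)
    set V : ℝ := R * ∑ q, (Q.size q : ℝ) ^ 2
    set Λ : ℝ := T * Real.logb 2 T ^ 2 * Real.logb 2 (Real.logb 2 T)
    calc _ = 2 * (α * γ * R * S.card : ℝ) +
          (α * γ : ℝ) / (m * n) * ((n' : ℝ) * treeFactor n' + 2 * V) := by
          push_cast [eα, eγ]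
          field_simp
          ring
      _ ≤ 20000000 * (α * γ * R * S.card : ℝ) +
          (α * γ : ℝ) / (m * n) * (20000000 * (Λ + V)) := by
          gcongr
          · norm_num
          · linarith
      _ = _ := by ring
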